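/- **Setting.** All matrices are complex. Let $t\ge 2$ and let $\mathcal C$ be the cycle quiver with vertices $1,\dots,t$ and one arrow $\alpha_i$ between $i$ and $[i+1]$ for each $i$, oriented arbitrarily: clockwise ($i\to[i+1]$) or counterclockwise ($i\leftarrow[i+1]$); here $[k]\in\{1,\dots,t\}$ is the residue of $k$ modulo $t$. A matrix representation $\mathbb A=(A_1,\dots,A_t)$ of $\mathcal C$ consists of dimensions $d_1,\dots,d_t\ge0$ and matrices $A_i$ of size $d_{[i+1]}\times d_i$ (clockwise) or $d_i\times d_{[i+1]}$ (counterclockwise). Isomorphism $\simeq$ and direct sum $\oplus$ are those of quiver representations; $\mathbb A^T=(A_1^T,\dots,A_t^T)$ is a representation of the cycle $\mathcal C^T$ with all arrows reversed. $\mathbb A$ is *regular* if all $d_i$ are equal and all $A_i$ are nonsingular. Representations of a chain $a - (a+1) - \cdots - b$ are treated in the same way; all chains below have arrows $k - (k+1)$ oriented as $\alpha_{[k]}$. $\mathbb L_{ij}$ ($a\le i\le j\le b$) is the chain representation with dimension $1$ at $i,\dots,j$, dimension $0$ elsewhere, and matrices $I_1$ between $i$ and $j$. The push-down $\mathbb P(\mathbb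 B)$ of a chain representation $\mathbb B$ is the representation of $\mathcal C$ whose space at $v$ is the direct sum of the spaces of $\mathbb B$ at all $k$ with $[k]=v$, the maps being the direct sums of the maps of $\mathbb B$. For $i\le j$, $\mathbb G_{ij}=\mathbb P(\mathbb L_{ij})$ is the representation of $\mathcal C$ with the basis $\{k : i\le k\le j,\ [k]=v\}$ at the vertex $v$, whose maps send $k\mapsto k+1$ or $k+1\mapsto k$ ($i\le k<j$) according to the orientation of $\alpha_{[k]}$, all other basis vectors going to $0$. A *regularizing decomposition* of $\mathbb A$ is an isomorphism of $\mathbb A$ with a direct sum of representations $\mathbb G_{ij}$ and one regular representation. **The algorithm for cycles** (result: $\mathbb A'$, $\widetilde{\mathbb A}$). If all clockwise arrows have matrices with linearly independent rows, put $\mathbb A'=0$, $\widetilde{\mathbb A}=\mathbb A$. Otherwise let $l\in\{1,\dots,t\}$ be the least index of a clockwise arrow whose matrix has linearly dependent rows. In step $r=l,l+1,\dots$ the vertex $[r+1]$ is split, by a unitary transformation (change of basis) at $[r+1]$ that also changes the matrix of $\alpha_{[r+1]}$ accordingly, into new vertices $(r+1)'$ and $[r+1]$, so that the matrix between $r'\oplus[r]$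 and $(r+1)'\oplus[r+1]$ (with $l'$ zero-dimensional) becomes $\begin{bmatrix}A_{r'}&0\\ *&A_{[r]}\end{bmatrix}$, where $A_{r'}$ lies between $r'$ and $(r+1)'$, $A_{[r]}$ lies between $[r]$ and $[r+1]$, and: $A_{[r]}$ has linearly independent rows if $\alpha_{[r]}$ is clockwise; $A_{r'}$ has linearly independent columns if $\alpha_{[r]}$ is counterclockwise. The block $*$ is then dropped. One stops after the first step $n\ge t$ for which the matrix between $(n+1)'$ and $[n+2]$ is zero; $\mathbb A'$ is the obtained representation of the chain $(l+1)'-\cdots-(n+1)'$, and $\widetilde{\mathbb A}$ the obtained representation of $\mathcal C$. **The algorithm for chains** (input: a representation of $a-\cdots-b$; result: a finite collection of pairs $(i,j)$). Before step $r$ ($a\le r<b$) each basis vector at $r$ is the end of a fragment $p-\cdots-r$; this divides the basis at $r$ into ordered strips $p_1,p_2,\dots$ according to $p$ (at the beginning there is the single strip $a$). By unitary transformations at $r$ within the strips and a unitary transformation at $r+1$ (which also changes the next matrix), the matrix of the arrow between $r$ and $r+1$ is reduced to a form in which the basis at $r+1$ is divided into strips $p_1,p_2,\dots$ and one more strip $r+1$,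 and the block in the row strip $p_i$ and the column strip $p_j$ is zero for $i>j$, arbitrary for $i<j$, and for $i=j$ equals $[\,0\ H_i\,]$ (if $r\to r+1$) or $\begin{bmatrix}H_i\\0\end{bmatrix}$ (if $r\leftarrow r+1$) with $H_i$ nonsingular; the rows, resp. columns, of the strip $r+1$ are zero. The fragments $p_i-\cdots-r$ outside the $H_i$ split off and give pairs $(p_i,r)$; the others are prolonged to $r+1$; the strip $r+1$ consists of new fragments and is placed last if $r\to r+1$, and first if $r\leftarrow r+1$. At the end each fragment $p-\cdots-b$ gives a pair $(p,b)$. **Theorem.** A regularizing decomposition of any matrix representation $\mathbb A$ of $\mathcal C$ can be constructed in 3 steps using only unitary transformations. Each of the algorithms below can always be carried out and stops after finitely many steps, and for all choices made in them the following holds. 1. The algorithm for cycles applied to $\mathbb A$ gives $\mathbb A\simeq\mathbb P(\mathbb A')\oplus\widetilde{\mathbb A}$. 2. The algorithm for cycles applied to the representation $\mathbb B:=\widetilde{\mathbb A}^T$ of $\mathcal C^T$ gives $\widetilde{\mathbb A}^T\simeq\mathbb P(\mathbb B')\oplus\widetilde{\mathbb B}$. 3. The algorithm for chains applied to $\mathbb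 A'$ and to $\mathbb B'^T$ gives $$\mathbb A'\simeq\mathbb L_{i_1j_1}\oplus\dots\oplus\mathbb L_{i_pj_p},\qquad \mathbb B'^T\simeq\mathbb L_{i_{p+1}j_{p+1}}\oplus\dots\oplus\mathbb L_{i_qj_q}.$$ Then $$\mathbb A\simeq\mathbb G_{i_1j_1}\oplus\dots\oplus\mathbb G_{i_qj_q}\oplus\widetilde{\mathbb B}^T,$$ and $\widetilde{\mathbb B}^T$ is regular. -/

import Mathlib

namespace QuiverCycle

/-! ### Matrices assigned to oriented edges

Bases are indexed by arbitrary finite types, so that a direct sum of spaces is a disjoint union of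
index types and a space split into strips is an index type with labels. -/

/-- A matrix is nonsingular if it has a two-sided inverse (in particular it is square). -/
def Nonsingular {m n : Type} [Fintype m] [Fintype n] [DecidableEq m] [DecidableEq n]
    (M : Matrix m n ℂ) : Prop :=
  ∃ N : Matrix n m ℂ, M * N = 1 ∧ N * M = 1

/-- The matrix of a linear map along an edge between spaces with bases `X` and `Y`:
of a map from the `X`-space to the `Y`-space if the edge is oriented forwards (`true`),
and of a map from the `Y`-space to the `X`-space if it is oriented backwards (`false`). -/
def Edge (b : Bool) (X Y : Type) : Type :=
  match b with
  | true => Matrix Y X ℂ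
  | false => Matrix X Y ℂ

namespace Edge

variable {X Y X' Y' : Type}

/-- The matrix of an edge that is oriented forwards. -/
def fwd (M : Edge true X Y) : Matrix Y X ℂ := M

/-- The matrix of an edge that is oriented backwards. -/
def bwd (M : Edge false X Y) : Matrix X Y ℂ := M

/-- The matrix entry that belongs to the basis vectors `x` and `y`. -/
def entry : {b : Bool} → Edge b X Y → X → Y → ℂ
  | true, M, x, y => M.fwd y x
  | false, M, x, y => M.bwd x y

/-- The matrix with prescribed entries. -/
def ofEntry : (b : Bool) → (X → Y → ℂ) → Edge b X Y
  | true, f => fun y x => f x y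
  | false, f => fun x y => f x y

/-- The transposed matrix, assigned to the reversed edge. -/
def tr : {b : Bool} → Edge b X Y → Edge (!b) X Y
  | true, M => M.fwd.transpose
  | false, M => M.bwd.transpose

/-- Transposition again, from the reversed edge to the edge. -/
def trBack : {b : Bool} → Edge (!b) X Y → Edge b X Y
  | true, M => Edge.bwd M |>.transpose
  | false, M => Edge.fwd M |>.transpose

/-- Direct sum of two matrices (block diagonal). -/
def sum : {b : Bool} → Edge b X Y → Edge b X' Y' → Edge b (X ⊕ X') (Y ⊕ Y')
  | true, M, M' => Matrix.fromBlocks M.fwd 0 0 M'.fwd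
  | false, M, M' => Matrix.fromBlocks M.bwd 0 0 M'.bwd

/-- The commutative square: `S` and `T`, at the two ends of the edge, carry `M` to `M'`. -/
def Intertwines [Fintype X] [Fintype Y] [Fintype X'] [Fintype Y']
    (S : Matrix X' X ℂ) (T : Matrix Y' Y ℂ) :
    {b : Bool} → Edge b X Y → Edge b X' Y' → Prop
  | true, M, M' => M'.fwd * S = T * M.fwd
  | false, M, M' => M'.bwd * T = S * M.bwd

/-- The new matrix after the unitary transformations `S` and `T` at the two ends of the edge. -/
def act [Fintype X] [Fintype Y] [DecidableEq X] [DecidableEq Y]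
    (S : Matrix.unitaryGroup X ℂ) (T : Matrix.unitaryGroup Y ℂ) :
    {b : Bool} → Edge b X Y → Edge b X Y
  | true, M => (T : Matrix Y Y ℂ) * M.fwd *
      ((S⁻¹ : Matrix.unitaryGroup X ℂ) : Matrix X X ℂ)
  | false, M => (S : Matrix X X ℂ) * M.bwd *
      ((T⁻¹ : Matrix.unitaryGroup Y ℂ) : Matrix Y Y ℂ)

/-- If the edge is oriented forwards, then its matrix has linearly independent rows. -/
def RowCond : {b : Bool} → Edge b X Y → Prop
  | true, M => LinearIndependent ℂ (Matrix.row M.fwd)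
  | false, _ => True

/-- The matrix of the edge is nonsingular. -/
def IsNonsingular [Fintype X] [Fintype Y] [DecidableEq X] [DecidableEq Y] :
    {b : Bool} → Edge b X Y → Prop
  | true, M => Nonsingular M.fwd
  | false, M => Nonsingular M.bwd

end Edge

/-! ### Matrix representations of a cycle -/

/-- A matrix representation of the cycle with vertices `1, …, t` (taken modulo `t`) and one arrow
between `i` and `i + 1` for each `i`; the arrow is `i → i + 1` (clockwise) if `o i = true` and
`i ← i + 1` (counterclockwise) if `o i = false`. -/
structure CycleRep {t : ℕ} (o : ZMod t → Bool) where
  idx : ZMod t → Type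
  [fintype : ∀ v, Fintype (idx v)]
  [decEq : ∀ v, DecidableEq (idx v)]
  mat : ∀ i, Edge (o i) (idx i) (idx (i + 1))

attribute [instance] CycleRep.fintype CycleRep.decEq

namespace CycleRep

variable {t : ℕ} {o : ZMod t → Bool}

/-- The dimension at the vertex `v`. -/
def dim (A : CycleRep o) (v : ZMod t) : ℕ := Fintype.card (A.idx v)

/-- Isomorphism of representations. -/
def Iso (A B : CycleRep o) : Prop :=
  ∃ S : ∀ v, Matrix (B.idx v) (A.idx v) ℂ,
    (∀ v, Nonsingular (S v)) ∧ ∀ i, Edge.Intertwines (S i) (S (i + 1)) (A.mat i) (B.mat i)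

/-- The zero representation. -/
def zero (o : ZMod t → Bool) : CycleRep o where
  idx _ := Empty
  mat i := Edge.ofEntry (o i) fun _ _ => 0

/-- Direct sum of two representations. -/
def sum (A B : CycleRep o) : CycleRep o where
  idx v := A.idx v ⊕ B.idx v
  mat i := (A.mat i).sum (B.mat i)

/-- Direct sum of a finite list of representations. -/
def listSum (L : List (CycleRep o)) : CycleRep o := L.foldr sum (zero o)

/-- The transpose representation, of the cycle with all arrows reversed. -/
def transpose (A : CycleRep o) : CycleRep (fun i => !(o i)) where
  idx := A.idx
  mat i := (A.mat i).tr

/-- The transpose of a representation of the reversed cycle. -/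
def transposeBack (A : CycleRep (fun i => !(o i))) : CycleRep o where
  idx := A.idx
  mat i := (A.mat i).trBack

/-- A representation is regular if all dimensions are equal and all matrices are nonsingular. -/
def Regular (A : CycleRep o) : Prop :=
  (∀ v w, A.dim v = A.dim w) ∧ ∀ i, (A.mat i).IsNonsingular

end CycleRep

/-- The vertex `[k]` of the cycle of length `t`, i.e. `k` modulo `t`, defined by recursion so that
`[k + 1]` is `[k] + 1` by definition. -/
def vtx (t : ℕ) : ℕ → ZMod t
  | 0 => 0
  | k + 1 => vtx t k + 1

theorem vtx_eq_cast (t k : ℕ) : vtx t k = (k : ZMod t) := by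
  induction k with
  | zero => simp [vtx]
  | succ k ih => simp [vtx, ih]

/-- The representation `𝔾_{ij}` of the cycle given by the clockwise walk
`i — (i+1) — ⋯ — j`: the basis vectors at `v` are the `k ∈ {i, …, j}` with `[k] = v`, and the
matrices are given by the edges `k — (k+1)` of the walk. -/
def G {t : ℕ} (o : ZMod t → Bool) (i j : ℕ) : CycleRep o where
  idx v := {k : ℕ // k ∈ (Finset.Icc i j).filter fun k => vtx t k = v}
  mat s := Edge.ofEntry (o s) fun k k' => if k'.1 = k.1 + 1 then 1 else 0

/-! ### Matrix representations of a chain -/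

/-- A matrix representation of the chain `a — (a+1) — ⋯ — b`; the arrow between `k` and `k + 1` is
`k → k + 1` if `o k = true` and `k ← k + 1` if `o k = false`. The spaces are defined for all `k`
and are zero for `k` outside `{a, …, b}`. -/
structure ChainRep (o : ℕ → Bool) (a b : ℕ) where
  idx : ℕ → Type
  [fintype : ∀ k, Fintype (idx k)]
  [decEq : ∀ k, DecidableEq (idx k)]
  isEmpty : ∀ k, ¬ (a ≤ k ∧ k ≤ b) → IsEmpty (idx k)
  mat : ∀ k, Edge (o k) (idx k) (idx (k + 1))

attribute [instance] ChainRep.fintype ChainRep.decEq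

namespace ChainRep

variable {o : ℕ → Bool} {a b : ℕ}

/-- Isomorphism of representations. -/
def Iso (A B : ChainRep o a b) : Prop :=
  ∃ S : ∀ k, Matrix (B.idx k) (A.idx k) ℂ,
    (∀ k, Nonsingular (S k)) ∧ ∀ k, Edge.Intertwines (S k) (S (k + 1)) (A.mat k) (B.mat k)

/-- The zero representation. -/
def zero (o : ℕ → Bool) (a b : ℕ) : ChainRep o a b where
  idx _ := Empty
  isEmpty _ _ := inferInstance
  mat k := Edge.ofEntry (o k) fun _ _ => 0

/-- Direct sum of two representations. -/
def sum (A B : ChainRep o a b) : ChainRep o a b where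
  idx k := A.idx k ⊕ B.idx k
  isEmpty k hk := by
    have := A.isEmpty k hk
    have := B.isEmpty k hk
    infer_instance
  mat k := (A.mat k).sum (B.mat k)

/-- Direct sum of a finite list of representations. -/
def listSum (L : List (ChainRep o a b)) : ChainRep o a b := L.foldr sum (zero o a b)

/-- The transpose of a representation of the reversed chain. -/
def transposeBack (A : ChainRep (fun k => !(o k)) a b) : ChainRep o a b where
  idx := A.idx
  isEmpty := A.isEmpty
  mat k := (A.mat k).trBack

/-- The representation `𝕃_{ij}`: dimension `1` at the vertices `i, …, j`, dimension `0` at the other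
vertices of the chain, and the matrices `I₁` along the edges between `i` and `j`. -/
def L (o : ℕ → Bool) (a b i j : ℕ) : ChainRep o a b where
  idx k := {_u : Unit // (a ≤ k ∧ k ≤ b) ∧ (i ≤ k ∧ k ≤ j)}
  isEmpty _ hk := ⟨fun u => hk u.2.1⟩
  mat k := Edge.ofEntry (o k) fun _ _ => 1

/-- The push-down `ℙ`: the space at the vertex `v` of the cycle is the direct sum of the spaces at
the vertices `k` of the chain with `[k] = v`, and the matrix of the arrow `i` is the direct sum of
the matrices of the arrows `k` with `[k] = i`. -/
def pushDown {t : ℕ} {o : ZMod t → Bool} (B : ChainRep (fun k => o (vtx t k)) a b) :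
    CycleRep o where
  idx v := Σ k : {k : ℕ // k ∈ (Finset.Icc a b).filter fun k => vtx t k = v}, B.idx k.1
  mat i := Edge.ofEntry (o i) fun p q =>
    if h : q.1.1 = p.1.1 + 1 then (B.mat p.1.1).entry p.2 (h ▸ q.2) else 0

end ChainRep

/-! ### The algorithm for cycles -/

section CycleAlgorithm

variable {t : ℕ} {o : ZMod t → Bool}

/-- The representation `𝔸⁽ʳ⁾` of the split quiver, with vertices `1, …, t` and
`(l+1)', …, (r+1)'`. It is stored as partitioned matrices: the basis vectors over the vertex `v` of
the cycle are `A.idx v`; such a vector has the label `none` if it belongs to the vertex `v` itself,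
and the label `some k` if it belongs to the vertex `k'` (with `[k] = v`). The matrix assigned to an
arrow of the split quiver is the block of the matrix `mat i` over which it lies that is cut out by
the labels of its two ends. -/
structure CycleState (A : CycleRep o) where
  mat : ∀ i, Edge (o i) (A.idx i) (A.idx (i + 1))
  lab : ∀ v, A.idx v → Option ℕ

/-- The initial state: the representation `A` itself, without primed vertices. -/
def CycleState.init (A : CycleRep o) : CycleState A where
  mat := A.mat
  lab _ _ := none

/-- The form of the matrix of the arrow `[r]` in step `r`. Here `X`, `Y` are the bases over `[r]`
and `[r+1]`, with their labels; `M` is the matrix after the unitary transformation at `[r+1]`, and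
`M'` is the matrix after dropping the block `*`.
* Clockwise: `M` has the columns `r' | [r]` and the rows `(r+1)'`, `[r+1]`, and is
  `[A_{r'}, 0; *, A_{[r]}]`, where `A_{[r]}` has linearly independent rows.
* Counterclockwise: `M` has the rows `r'`, `[r]` and the columns `(r+1)' | [r+1]`, and is
  `[A_{r'}, 0; *, A_{[r]}]`, where `A_{r'}` has linearly independent columns. -/
def ShaveForm {X Y : Type} (r : ℕ) (labX : X → Option ℕ) (labY : Y → Option ℕ) :
    {b : Bool} → Edge b X Y → Edge b X Y → Prop
  | true, M, M' =>
    (∀ y x, labY y = some (r + 1) → labX x = none → M.fwd y x = 0) ∧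
    LinearIndependent ℂ (fun (y : {y // labY y = none}) (x : {x // labX x = none}) => M.fwd y.1 x.1) ∧
    (∀ y x, M'.fwd y x = if labY y = none ∧ labX x = some r then 0 else M.fwd y x)
  | false, M, M' =>
    (∀ x y, labX x = some r → labY y = none → M.bwd x y = 0) ∧
    LinearIndependent ℂ
      (fun (y : {y // labY y = some (r + 1)}) (x : {x // labX x = some r}) => M.bwd x.1 y.1) ∧
    (∀ x y, M'.bwd x y = if labX x = none ∧ labY y = some (r + 1) then 0 else M.bwd x y)

/-- Step `r` of the algorithm (`s` is `𝔸⁽ʳ⁻¹⁾` and `s'` is `𝔸⁽ʳ⁾`): a unitary transformation `U` at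
the vertex `[r+1]` (it does not touch the primed vertices over it) puts the matrix of the arrow
`[r]` into the required form, the vertex `[r+1]` is split into `(r+1)'` and `[r+1]`, and the matrix
of the arrow `[r+1]` is changed by `U` accordingly. In step `l` no basis vector belongs to `l'` yet,
and the form is `[0; A_l]`. -/
def CycleStep (A : CycleRep o) (r : ℕ) (s s' : CycleState A) : Prop :=
  ∃ U : Matrix.unitaryGroup (A.idx (vtx t r + 1)) ℂ,
    (∀ x y, s.lab (vtx t r + 1) x ≠ none ∨ s.lab (vtx t r + 1) y ≠ none →
      (U : Matrix _ _ ℂ) x y = (1 : Matrix _ _ ℂ) x y) ∧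
    (∀ v, v ≠ vtx t r + 1 → s'.lab v = s.lab v) ∧
    (∀ x, s.lab (vtx t r + 1) x ≠ none → s'.lab (vtx t r + 1) x = s.lab (vtx t r + 1) x) ∧
    (∀ x, s.lab (vtx t r + 1) x = none →
      s'.lab (vtx t r + 1) x = none ∨ s'.lab (vtx t r + 1) x = some (r + 1)) ∧
    ShaveForm r (s.lab (vtx t r)) (s'.lab (vtx t r + 1))
      (Edge.act 1 U (s.mat (vtx t r))) (s'.mat (vtx t r)) ∧
    s'.mat (vtx t r + 1) = Edge.act U 1 (s.mat (vtx t r + 1)) ∧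
    ∀ j, j ≠ vtx t r → j ≠ vtx t r + 1 → s'.mat j = s.mat j

/-- The stopping condition after step `r`: `r ≥ t`, and the matrix assigned to the arrow between
`(r+1)'` and `[r+2]` is zero. -/
def CycleStops (A : CycleRep o) (r : ℕ) (s : CycleState A) : Prop :=
  t ≤ r ∧ ∀ x y, s.lab (vtx t (r + 1)) x = some (r + 1) → s.lab (vtx t (r + 1) + 1) y = none →
    (s.mat (vtx t (r + 1))).entry x y = 0

/-- `l` is the least element of `{1, …, t}` such that the arrow `l` is oriented clockwise and its
matrix has linearly dependent rows. -/
def FirstBad (A : CycleRep o) (l : ℕ) : Prop :=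
  1 ≤ l ∧ l ≤ t ∧ ¬ (A.mat (vtx t l)).RowCond ∧
    ∀ i, 1 ≤ i → i < l → (A.mat (vtx t i)).RowCond

/-- `s` can be the representation `𝔸⁽ʳ⁾` of a run of the algorithm, where `r ≥ l`. (The steps
`1, …, l - 1` do not change `A`.) -/
inductive CycleReach (A : CycleRep o) (l : ℕ) : ℕ → CycleState A → Prop
  | first (s : CycleState A) : CycleStep A l (CycleState.init A) s → CycleReach A l l s
  | next (r : ℕ) (s s' : CycleState A) : CycleReach A l r s → ¬ CycleStops A r s →
      CycleStep A (r + 1) s s' → CycleReach A l (r + 1) s'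

/-- The part of `𝔸⁽ⁿ⁾` on the primed vertices `a', …, b'`. -/
def CycleState.shave {A : CycleRep o} (s : CycleState A) (a b : ℕ) :
    ChainRep (fun k => o (vtx t k)) a b where
  idx k := {x : A.idx (vtx t k) // s.lab (vtx t k) x = some k ∧ a ≤ k ∧ k ≤ b}
  isEmpty _ hk := ⟨fun x => hk x.2.2⟩
  mat k := Edge.ofEntry (o (vtx t k)) fun x y => (s.mat (vtx t k)).entry x.1 y.1

/-- The part of `𝔸⁽ⁿ⁾` on the vertices of the cycle. -/
def CycleState.rest {A : CycleRep o} (s : CycleState A) : CycleRep o where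
  idx v := {x : A.idx v // s.lab v x = none}
  mat i := Edge.ofEntry (o i) fun x y => (s.mat i).entry x.1 y.1

/-- The result of the algorithm for cycles: a representation `chain` of a chain
`a — ⋯ — b` (denoted by `𝔸'`) and a representation `rest` of the cycle (denoted by `𝔸̃`). -/
structure CycleOutput (o : ZMod t → Bool) where
  a : ℕ
  b : ℕ
  chain : ChainRep (fun k => o (vtx t k)) a b
  rest : CycleRep o

/-- `X` is the result of a run of the algorithm for cycles on `A`. -/
inductive CycleAlgorithm (A : CycleRep o) : CycleOutput o → Prop
  | trivial : (∀ i, (A.mat i).RowCond) →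
      CycleAlgorithm A ⟨t + 2, t + 2, ChainRep.zero _ _ _, A⟩
  | shave (l n : ℕ) (s : CycleState A) : FirstBad A l → CycleReach A l n s → CycleStops A n s →
      CycleAlgorithm A ⟨l + 1, n + 1, s.shave (l + 1) (n + 1), s.rest⟩

/-- The algorithm for cycles can be carried out on `A`: it never gets stuck, whatever choices have
been made, the number of its steps is bounded, and so it produces a result. -/
def CycleAlgorithmWorks (A : CycleRep o) : Prop :=
  (∀ l, FirstBad A l →
    (∃ s, CycleStep A l (CycleState.init A) s) ∧
    (∀ r s, CycleReach A l r s → ¬ CycleStops A r s → ∃ s', CycleStep A (r + 1) s s') ∧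
    ∃ N, ∀ r s, CycleReach A l r s → r ≤ N) ∧
  ∃ X, CycleAlgorithm A X

end CycleAlgorithm

/-! ### The algorithm for chains -/

section ChainAlgorithm

variable {o : ℕ → Bool} {a b : ℕ}

/-- The data before step `r` of the algorithm for chains (step `a` is the first one).
* `cur` is the current matrix of the arrow between `r` and `r + 1`; the matrices of the further
  arrows are still those of `B`.
* The basis vectors at the vertex `r` are the ends of fragments
  `p — (p+1) — ⋯ — r`; `lab` gives the beginning `p` of each fragment.
* `strips` is the list `p₁, p₂, …` of the possible beginnings, in the order (from the top down) in
  which the fragments are arranged; it orders the strips of `cur`.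
* `out` is the collection of the pairs `(i, j)` of the representations `𝕃_{ij}` already split
  off. -/
structure ChainState (B : ChainRep o a b) (r : ℕ) where
  cur : Edge (o r) (B.idx r) (B.idx (r + 1))
  lab : B.idx r → ℕ
  strips : List ℕ
  out : Multiset (ℕ × ℕ)

/-- The initial state. -/
def ChainState.init (B : ChainRep o a b) : ChainState B a where
  cur := B.mat a
  lab _ := a
  strips := [a]
  out := 0

/-- The reduced form of the matrix of the arrow between `r` and `r + 1`. The basis `X` at `r` is
divided by `labX` into strips `p₁, p₂, …`; the basis `Y` at `r + 1` is divided by `labY` into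
strips `p₁, p₂, …` and a further one, `r + 1`; `surv` is the set of those elements of `X` that
belong to the rows or columns of the blocks `H`.
* `r → r + 1`: rows `Y`, columns `X`; the block in the row strip `pᵢ` and the column strip `pⱼ` is
  zero if `i > j`, arbitrary if `i < j`, and `[0 H]` with a nonsingular `H` if `i = j`; the rows
  of the further strip are zero.
* `r ← r + 1`: rows `X`, columns `Y`; the block in the row strip `pᵢ` and the column strip `pⱼ` is
  zero if `i > j`, arbitrary if `i < j`, and `[H; 0]` with a nonsingular `H` if `i = j`; the
  columns of the further strip are zero. -/
def ChainForm {X Y : Type} [Fintype X] [Fintype Y] [DecidableEq X] [DecidableEq Y] (r : ℕ)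
    (strips : List ℕ) (labX : X → ℕ) (labY : Y → ℕ) (surv : Finset X) :
    {b : Bool} → Edge b X Y → Prop
  | true, M =>
    (∀ y x, labY y = r + 1 → M.fwd y x = 0) ∧
    (∀ y x, labY y ∈ strips → strips.idxOf (labX x) < strips.idxOf (labY y) → M.fwd y x = 0) ∧
    (∀ y x, labY y = labX x → x ∉ surv → M.fwd y x = 0) ∧
    ∀ p ∈ strips, Nonsingular (Matrix.of
      fun (y : {y // labY y = p}) (x : {x // labX x = p ∧ x ∈ surv}) => M.fwd y.1 x.1)
  | false, M =>
    (∀ x y, labY y = r + 1 → M.bwd x y = 0) ∧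
    (∀ x y, labY y ∈ strips → strips.idxOf (labY y) < strips.idxOf (labX x) → M.bwd x y = 0) ∧
    (∀ x y, labY y = labX x → x ∉ surv → M.bwd x y = 0) ∧
    ∀ p ∈ strips, Nonsingular (Matrix.of
      fun (x : {x // labX x = p ∧ x ∈ surv}) (y : {y // labY y = p}) => M.bwd x.1 y.1)

/-- Step `r` of the algorithm for chains: unitary transformations `V` at the vertex `r`, within the
strips, and `U` at the vertex `r + 1` reduce the matrix of the arrow between `r` and `r + 1`. The
fragments whose ends do not belong to the blocks `H` split off; the others are prolonged to the
vertex `r + 1`; and the remaining basis vectors at `r + 1` start new fragments, which are arranged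
below the old ones if `r → r + 1` and above them if `r ← r + 1`. -/
def ChainStep (B : ChainRep o a b) (r : ℕ) (s : ChainState B r) (s' : ChainState B (r + 1)) :
    Prop :=
  ∃ (V : Matrix.unitaryGroup (B.idx r) ℂ) (U : Matrix.unitaryGroup (B.idx (r + 1)) ℂ)
    (surv : Finset (B.idx r)),
    (∀ x x', s.lab x ≠ s.lab x' → (V : Matrix _ _ ℂ) x x' = 0) ∧
    (∀ y, s'.lab y ∈ s.strips ∨ s'.lab y = r + 1) ∧
    ChainForm r s.strips s.lab s'.lab surv (Edge.act V U s.cur) ∧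
    s'.cur = Edge.act U 1 (B.mat (r + 1)) ∧
    s'.strips = (if o r = true then s.strips ++ [r + 1] else (r + 1) :: s.strips) ∧
    s'.out = s.out + (Finset.univ \ surv).val.map fun x => (s.lab x, r)

/-- `s` can occur before step `r` in a run of the algorithm. -/
inductive ChainReach (B : ChainRep o a b) : (r : ℕ) → ChainState B r → Prop
  | start : ChainReach B a (ChainState.init B)
  | next (r : ℕ) (s : ChainState B r) (s' : ChainState B (r + 1)) :
      ChainReach B r s → r < b → ChainStep B r s s' → ChainReach B (r + 1) s'

/-- `P` is the result of a run of the algorithm for chains on `B`: the collection of the pairs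
`(i, j)` of the obtained representations `𝕃_{ij}`, including the fragments that reach the last
vertex `b`. -/
def ChainAlgorithm (B : ChainRep o a b) (P : Multiset (ℕ × ℕ)) : Prop :=
  ∃ s : ChainState B b, ChainReach B b s ∧
    P = s.out + (Finset.univ : Finset (B.idx b)).val.map fun x => (s.lab x, b)

/-- The algorithm for chains can be carried out on `B`: it never gets stuck, whatever choices have
been made, and so it produces a result (after `b - a` steps). -/
def ChainAlgorithmWorks (B : ChainRep o a b) : Prop :=
  (∀ r s, ChainReach B r s → r < b → ∃ s', ChainStep B r s s') ∧ ∃ P, ChainAlgorithm B P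

end ChainAlgorithm

end QuiverCycle

open QuiverCycle

namespace QuiverCycle

/-! ### Linear algebra -/

section LinearAlgebra

open Matrix

variable {m n k : Type}

/-! Cycle algorithm as a filtration. Order labels with `none` above all numbers. If the unitary
transformations of a run are applied to `A` but no block is ever dropped, the result `F` is still
isomorphic to `A`. The forms imposed in the steps make the final `F` filtered. A clockwise arrow
sends a vector labelled `k` into labels at least `k + 1`, a counterclockwise arrow sends label `k +
1` into labels at least `k`, and unlabelled vectors go to unlabelled ones. The associated graded
representation is the push-down of `𝔸'` plus `𝔸̃`, so the isomorphism to be proved says that the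
filtration splits. Two conditions recorded along the run make it split: a clockwise arrow `[k]` maps
the labels above `k` onto the labels above `k + 1` (`cw_surj`), and a counterclockwise block from
`(k+1)'` to `k'` is injective (`ccw_inj`). A unitriangular base change is then found by descending
induction on the label (`FinalInv.exists_unitriangular`). Surjectivity solves for a new column at a
clockwise arrow, and injectivity permits an extension at a counterclockwise one. The descent starts
at `n + 1`, where the stopping condition gives zero, and ends at `l + 1`, because the arrow `l` is
clockwise.

A run ends because every step after `t` that does not stop has created a nonempty label class, and
distinct labels need distinct basis vectors.

Regularity. For each clockwise arrow the last of its steps shows that its block in `𝔸̃` has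
independent rows (`CycleAlgorithm.rowCond_rest`). The second run, on the transpose, does the same
for the other arrows, and the first property survives because the new remainder is a direct summand.
Read as arrays from `i` to `i + 1`, all matrices now have independent rows, so the dimensions weakly
decrease around the cycle. They are therefore equal, and all the matrices are square and
nonsingular.

Chain algorithm. Before step `r` the part of the chain up to `r` is isomorphic to a sum of
intervals, one for each pair already split off and one for each basis vector at `r` (`ChainInv`). A
nonzero block between the strips `p` and `q` is harmless exactly if it is a morphism between the
intervals from `p` to `r` and from `q` to `r`, and the rule for placing new strips makes the allowed
triangle consist of such morphisms. The reduced matrix therefore extends to an isomorphism from the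
old sum of intervals to the new one (`stepEntry`), or, if the arrow points backwards, from the new
one to the old one.

Each step exists because a unitary row transformation separates zero rows from independent rows
(`exists_unitary_rows`): take an orthonormal basis of the column space and complete it. -/

theorem linearIndependent_rows_iff_vecMul [Fintype m] {M : Matrix m n ℂ} :
    LinearIndependent ℂ (fun i j => M i j) ↔ ∀ c : m → ℂ, c ᵥ* M = 0 → c = 0 := by
  rw [Fintype.linearIndependent_iff]
  refine forall_congr' fun c => ?_
  have h : ∑ i, c i • (fun j => M i j) = c ᵥ* M := by
    ext j
    simp [Matrix.vecMul, dotProduct, Finset.sum_apply]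
  rw [h]
  exact imp_congr_right fun _ => ⟨fun h => funext h, fun h i => congrFun h i⟩

theorem mulVec_surjective_of_vecMul [Fintype m] [Fintype n] {M : Matrix m n ℂ}
    (h : ∀ c : m → ℂ, c ᵥ* M = 0 → c = 0) : Function.Surjective M.mulVec := by
  have hr := (linearIndependent_rows_iff_vecMul.2 h).rank_matrix
  have : LinearMap.range M.mulVecLin = ⊤ := by
    apply Submodule.eq_top_of_finrank_eq
    rw [← Matrix.rank, hr]
    simp
  intro w
  obtain ⟨c, hc⟩ := LinearMap.range_eq_top.1 this w
  exact ⟨c, hc⟩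

theorem sum_subtype_of_support [Fintype m] (p : m → Prop) [Fintype {x // p x}] (f : m → ℂ)
    (h : ∀ x, ¬ p x → f x = 0) : ∑ x : {x // p x}, f x.1 = ∑ x, f x := by
  classical
  rw [← Finset.sum_subset (Finset.filter_subset p Finset.univ) (by
    intro x _ hx
    exact h x (by simpa using hx))]
  exact (Finset.sum_subtype _ (by simp) f).symm

/-- If the rows of `F` in `D`, cut off to the columns in `C`, are linearly independent, then every
right hand side on `D` is attained on vectors supported in `C`. -/
theorem exists_supported_mulVec [Fintype m] [Fintype n] (D : m → Prop) (C : n → Prop)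
    (F : m → n → ℂ)
    (h : ∀ d : m → ℂ, (∀ y, ¬ D y → d y = 0) → (∀ x, C x → ∑ y, d y * F y x = 0) → d = 0)
    (w : m → ℂ) :
    ∃ c : n → ℂ, (∀ x, ¬ C x → c x = 0) ∧ ∀ y, D y → ∑ x, F y x * c x = w y := by
  classical
  obtain ⟨c, hc⟩ := mulVec_surjective_of_vecMul
    (M := Matrix.of fun (y : {y // D y}) (x : {x // C x}) => F y.1 x.1) (by
      intro d hd
      have := h (fun y => if hy : D y then d ⟨y, hy⟩ else 0) (fun y hy => by simp [hy]) (by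
        intro x hx
        have e := congrFun hd ⟨x, hx⟩
        simp only [vecMul, dotProduct, of_apply, Pi.zero_apply] at e
        rw [← sum_subtype_of_support D _ (fun y hy => by simp [hy]), ← e]
        exact Finset.sum_congr rfl fun y _ => by rw [dif_pos y.2])
      ext y
      simpa [y.2] using congrFun this y.1) (fun y => w y.1)
  refine ⟨fun x => if hx : C x then c ⟨x, hx⟩ else 0, fun x hx => by simp [hx], fun y hy => ?_⟩
  have e := congrFun hc ⟨y, hy⟩
  simp only [mulVec, dotProduct, of_apply] at e
  rw [← sum_subtype_of_support C _ (fun x hx => by simp [hx]), ← e]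
  exact Finset.sum_congr rfl fun x _ => by simp only [dif_pos x.2]

/-- The dual form of `exists_supported_mulVec`. -/
theorem exists_supported_vecMul [Fintype m] [Fintype n] (D : m → Prop) (C : n → Prop)
    (F : m → n → ℂ)
    (h : ∀ d : n → ℂ, (∀ x, ¬ C x → d x = 0) → (∀ y, D y → ∑ x, F y x * d x = 0) → d = 0)
    (w : n → ℂ) :
    ∃ c : m → ℂ, (∀ y, ¬ D y → c y = 0) ∧ ∀ x, C x → ∑ y, c y * F y x = w x := by
  obtain ⟨c, h1, h2⟩ := exists_supported_mulVec C D (fun x y => F y x)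
    (fun d hd h' => h d hd fun y hy => by simpa only [mul_comm] using h' y hy) w
  exact ⟨c, h1, fun x hx => by simpa only [mul_comm] using h2 x hx⟩

/-- The matrix of the map that sends the basis vector `x` to the basis vector `e x`. -/
def permMat [DecidableEq m] (e : n ≃ m) : Matrix m n ℂ := (1 : Matrix m m ℂ).submatrix id e

theorem permMat_apply [DecidableEq m] (e : n ≃ m) (y : m) (x : n) :
    permMat e y x = if y = e x then 1 else 0 := by
  simp [permMat, Matrix.one_apply]

/-! ### Nonsingular matrices with arbitrary row and column index types -/

section Nonsingular

variable [Fintype m] [Fintype n] [Fintype k] [DecidableEq m] [DecidableEq n] [DecidableEq k]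

theorem Nonsingular.one : Nonsingular (1 : Matrix m m ℂ) := ⟨1, by simp, by simp⟩

theorem Nonsingular.mul {M : Matrix m n ℂ} {N : Matrix n k ℂ} (hM : Nonsingular M)
    (hN : Nonsingular N) : Nonsingular (M * N) := by
  obtain ⟨M', h1, h2⟩ := hM
  obtain ⟨N', h3, h4⟩ := hN
  refine ⟨N' * M', ?_, ?_⟩
  · rw [Matrix.mul_assoc, ← Matrix.mul_assoc N, h3, Matrix.one_mul, h1]
  · rw [Matrix.mul_assoc, ← Matrix.mul_assoc M', h2, Matrix.one_mul, h4]

theorem Nonsingular.transpose {M : Matrix m n ℂ} (hM : Nonsingular M) : Nonsingular Mᵀ := by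
  obtain ⟨N, h1, h2⟩ := hM
  exact ⟨Nᵀ, by rw [← transpose_mul, h2, transpose_one], by
    rw [← transpose_mul, h1, transpose_one]⟩

theorem Nonsingular.unitary (U : Matrix.unitaryGroup m ℂ) :
    Nonsingular (U : Matrix m m ℂ) :=
  ⟨((U⁻¹ : Matrix.unitaryGroup m ℂ) : Matrix m m ℂ), by
    rw [← Submonoid.coe_mul]; simp, by rw [← Submonoid.coe_mul]; simp⟩

theorem Nonsingular.fromBlocks {m' n' : Type} [Fintype m'] [Fintype n'] [DecidableEq m']
    [DecidableEq n'] {M : Matrix m n ℂ} {N : Matrix m' n' ℂ} (hM : Nonsingular M)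
    (hN : Nonsingular N) : Nonsingular (Matrix.fromBlocks M 0 0 N) := by
  obtain ⟨M', h1, h2⟩ := hM
  obtain ⟨N', h3, h4⟩ := hN
  exact ⟨Matrix.fromBlocks M' 0 0 N', by simp [fromBlocks_multiply, h1, h3], by
    simp [fromBlocks_multiply, h2, h4]⟩

theorem Nonsingular.mulVec_eq_zero {M : Matrix m n ℂ} (hM : Nonsingular M) {v : n → ℂ}
    (h : M *ᵥ v = 0) : v = 0 := by
  obtain ⟨N, -, h2⟩ := hM
  rw [← one_mulVec v, ← h2, ← mulVec_mulVec, h, mulVec_zero]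

theorem Nonsingular.vecMul_eq_zero {M : Matrix m n ℂ} (hM : Nonsingular M) {v : m → ℂ}
    (h : v ᵥ* M = 0) : v = 0 := by
  obtain ⟨N, h1, -⟩ := hM
  rw [← vecMul_one v, ← h1, ← vecMul_vecMul, h, zero_vecMul]

/-- A trivial left kernel gives a right inverse, and a trivial right kernel then makes it two-sided.
No equality of cardinalities is needed, which suits blocks indexed by strips of unknown size. -/
theorem nonsingular_of_kernels {M : Matrix m n ℂ} (h1 : ∀ v, M *ᵥ v = 0 → v = 0)
    (h2 : ∀ v, v ᵥ* M = 0 → v = 0) : Nonsingular M := by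
  obtain ⟨N, hN⟩ := mulVec_surjective_iff_exists_right_inverse.1 (mulVec_surjective_of_vecMul h2)
  refine ⟨N, hN, ?_⟩
  have : ∀ v, (N * M) *ᵥ v = v := by
    intro v
    rw [← sub_eq_zero]
    apply h1
    rw [mulVec_sub, mulVec_mulVec, ← Matrix.mul_assoc, hN, Matrix.one_mul, sub_self]
  ext i j
  have e := congrFun (this (Pi.single j 1)) i
  simp only [mulVec_single_one, col_apply] at e
  rw [e, Matrix.one_apply, Pi.single_apply]

/-- A block triangular matrix with nonsingular diagonal blocks is nonsingular. -/
theorem nonsingular_of_triangular (α : n → ℕ) (β : m → ℕ) (M : Matrix m n ℂ)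
    (htri : ∀ y x, α x < β y → M y x = 0)
    (hdiag : ∀ p, Nonsingular
      (Matrix.of fun (y : {y // β y = p}) (x : {x // α x = p}) => M y.1 x.1)) :
    Nonsingular M := by
  apply nonsingular_of_kernels
  · intro v hv
    by_contra hne
    obtain ⟨x₀, hx₀⟩ : ∃ x, v x ≠ 0 := by
      by_contra! h
      exact hne (funext h)
    -- In the rows of the largest rank occurring in `v`, columns of smaller rank vanish by
    -- triangularity and coordinates of larger rank vanish by maximality, so only the diagonal block
    -- remains.
    obtain ⟨x, hx, hmax⟩ := Finset.exists_max_image (Finset.univ.filter fun x => v x ≠ 0) α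
      ⟨x₀, by simpa using hx₀⟩
    simp only [Finset.mem_filter, Finset.mem_univ, true_and] at hx hmax
    have := (hdiag (α x)).mulVec_eq_zero (v := fun x' => v x'.1) (by
      ext y
      have e := congrFun hv y.1
      simp only [mulVec, dotProduct, of_apply, Pi.zero_apply] at e ⊢
      rw [← e]
      refine sum_subtype_of_support (fun x' => α x' = α x) (fun x' => M y.1 x' * v x') ?_
      intro x' hx'
      rcases lt_or_gt_of_ne hx' with h | h
      · rw [htri _ _ (by rw [y.2]; exact h), zero_mul]
      · have : v x' = 0 := by
          by_contra h'
          exact absurd (hmax x' h') (not_le.2 h)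
        rw [this, mul_zero])
    exact hx (congrFun this ⟨x, rfl⟩)
  · intro v hv
    by_contra hne
    obtain ⟨y₀, hy₀⟩ : ∃ x, v x ≠ 0 := by
      by_contra! h
      exact hne (funext h)
    obtain ⟨y, hy, hmin⟩ := Finset.exists_min_image (Finset.univ.filter fun x => v x ≠ 0) β
      ⟨y₀, by simpa using hy₀⟩
    simp only [Finset.mem_filter, Finset.mem_univ, true_and] at hy hmin
    have := (hdiag (β y)).vecMul_eq_zero (v := fun y' => v y'.1) (by
      ext x
      have e := congrFun hv x.1
      simp only [vecMul, dotProduct, of_apply, Pi.zero_apply] at e ⊢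
      rw [← e]
      refine sum_subtype_of_support (fun y' => β y' = β y) (fun y' => v y' * M y' x.1) ?_
      intro y' hy'
      rcases lt_or_gt_of_ne hy' with h | h
      · have : v y' = 0 := by
          by_contra h'
          exact absurd (hmin y' h') (not_le.2 h)
        rw [this, zero_mul]
      · rw [htri _ _ (by rw [x.2]; exact h), mul_zero])
    exact hy (congrFun this ⟨y, rfl⟩)

theorem Nonsingular.permMat (e : n ≃ m) : Nonsingular (permMat e) := by
  refine ⟨QuiverCycle.permMat e.symm, ?_, ?_⟩ <;> ext i j
  · simp [Matrix.mul_apply, permMat_apply, Matrix.one_apply]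
  · simp [Matrix.mul_apply, permMat_apply, Matrix.one_apply, Equiv.eq_symm_apply, eq_comm]

end Nonsingular

/-! ### Unitary reductions -/

section Unitary

/-- By a unitary transformation of rows, every matrix can be reduced to a matrix in which some rows
are zero and the others are linearly independent. -/
theorem exists_unitary_rows [Fintype m] [DecidableEq m] (N : Matrix m n ℂ) :
    ∃ (U : Matrix.unitaryGroup m ℂ) (q : Set m),
      (∀ y ∈ q, ∀ x, ((U : Matrix m m ℂ) * N) y x = 0) ∧
      ∀ c : m → ℂ, (∀ y ∈ q, c y = 0) → c ᵥ* ((U : Matrix m m ℂ) * N) = 0 → c = 0 := by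
  classical
  let col : n → EuclideanSpace ℂ m := fun x => WithLp.toLp 2 fun y => N y x
  let C : Submodule ℂ (EuclideanSpace ℂ m) := Submodule.span ℂ (Set.range col)
  have hle : Module.finrank ℂ C ≤ Fintype.card m := by
    simpa using Submodule.finrank_le C
  obtain ⟨s, -, hs⟩ := Finset.exists_subset_card_eq (s := (Finset.univ : Finset m))
    (n := Module.finrank ℂ C) (by simpa using hle)
  let e : s ≃ Fin (Module.finrank ℂ C) := s.equivFinOfCardEq hs
  let bC := stdOrthonormalBasis ℂ C
  let v : m → EuclideanSpace ℂ m := fun y => if h : y ∈ s then (bC (e ⟨y, h⟩) : EuclideanSpace ℂ m)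
    else 0
  have hv : Orthonormal ℂ ((s : Set m).domRestrict v) := by
    have : (s : Set m).domRestrict v = fun y => ((bC (e y) : C) : EuclideanSpace ℂ m) := by
      ext1 y
      have : y.1 ∈ s := y.2
      simp [v, Set.domRestrict, this]
    rw [this]
    have h := bC.orthonormal.comp e e.injective
    exact h.comp_linearIsometry C.subtypeₗᵢ
  obtain ⟨b, hb⟩ := hv.exists_orthonormalBasis_extension_of_card_eq (by simp)
  have hbC : ∀ y ∈ s, b y ∈ C := by
    intro y hy
    rw [hb y hy]
    simp [v, hy]
  have hbperp : ∀ y, y ∉ s → ∀ u ∈ C, inner ℂ (b y) u = 0 := by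
    intro y hy u hu
    have hspan : u ∈ Submodule.span ℂ (Set.range fun j => ((bC j : C) : EuclideanSpace ℂ m)) := by
      have := congrArg (Submodule.map C.subtype) bC.toBasis.span_eq
      rw [Submodule.map_span, Submodule.map_subtype_top, ← Set.range_comp] at this
      rw [← this] at hu
      simpa [Function.comp_def] using hu
    clear hu
    induction hspan using Submodule.span_induction with
    | mem u h =>
      obtain ⟨j, rfl⟩ := h
      have h1 : ((bC j : C) : EuclideanSpace ℂ m) = b (e.symm j) := by
        rw [hb _ (e.symm j).2]
        simp [v]
      simp only [h1]
      rw [b.inner_eq_ite, if_neg]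
      rintro rfl
      exact hy (e.symm j).2
    | zero => simp
    | add u w hu' hw' h1 h2 => rw [inner_add_right, h1, h2, add_zero]
    | smul c u hu' h1 => rw [inner_smul_right, h1, mul_zero]
  -- The conjugates make the entries of `U₀ * N` the inner products of `b y` with the columns of
  -- `N`; these vanish for `y ∉ s`.
  let U₀ : Matrix m m ℂ := Matrix.of fun y z => star (b y z)
  have hU : U₀ ∈ Matrix.unitaryGroup m ℂ := by
    rw [Matrix.mem_unitaryGroup_iff]
    ext y y'
    have h := b.inner_eq_ite y y'
    rw [PiLp.inner_apply] at h
    rw [Matrix.one_apply, ← h, Matrix.mul_apply]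
    refine Finset.sum_congr rfl fun z _ => ?_
    simp [U₀, Matrix.star_apply, mul_comm]
  have hUN : ∀ y x, (U₀ * N) y x = inner ℂ (b y) (col x) := by
    intro y x
    rw [PiLp.inner_apply, Matrix.mul_apply]
    refine Finset.sum_congr rfl fun z _ => ?_
    simp [U₀, col, mul_comm]
  refine ⟨⟨U₀, hU⟩, {y | y ∉ s}, fun y hy x => ?_, fun c hc h0 => ?_⟩
  · rw [hUN]
    exact hbperp y hy _ (Submodule.subset_span ⟨x, rfl⟩)
  -- A row relation supported in `s` is a vector of the column space orthogonal to that space, hence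
  -- zero.
  · let u : EuclideanSpace ℂ m := ∑ y, star (c y) • b y
    have huC : u ∈ C := by
      refine Submodule.sum_mem _ fun y _ => ?_
      by_cases hy : y ∈ s
      · exact Submodule.smul_mem _ _ (hbC y hy)
      · rw [hc y hy, star_zero, zero_smul]
        exact Submodule.zero_mem _
    have hu : ∀ w ∈ C, inner ℂ u w = 0 := by
      intro w hw
      induction hw using Submodule.span_induction with
      | mem w h =>
        obtain ⟨x, rfl⟩ := h
        have := congrFun h0 x
        simp only [vecMul, dotProduct, hUN, Pi.zero_apply] at this
        simp only [u, sum_inner, inner_smul_left]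
        simpa using this
      | zero => simp
      | add u w hu' hw' h1 h2 => rw [inner_add_right, h1, h2, add_zero]
      | smul c u hu' h1 => rw [inner_smul_right, h1, mul_zero]
    have hu0 : u = 0 := inner_self_eq_zero.1 (hu u huC)
    have hli := Fintype.linearIndependent_iff.1 b.orthonormal.linearIndependent
      (fun y => star (c y)) hu0
    ext y
    simpa using hli y

/-- By a unitary transformation of columns, every matrix can be reduced to a matrix in which some
columns are zero and the others are linearly independent. -/
theorem exists_unitary_cols [Fintype m] [DecidableEq m] [Fintype n] (N : Matrix n m ℂ) :
    ∃ (U : Matrix.unitaryGroup m ℂ) (q : Set m),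
      (∀ y ∈ q, ∀ x, (N * ((U⁻¹ : Matrix.unitaryGroup m ℂ) : Matrix m m ℂ)) x y = 0) ∧
      ∀ c : m → ℂ, (∀ y ∈ q, c y = 0) →
        (N * ((U⁻¹ : Matrix.unitaryGroup m ℂ) : Matrix m m ℂ)) *ᵥ c = 0 → c = 0 := by
  obtain ⟨U, q, h1, h2⟩ := exists_unitary_rows Nᴴ
  have e : N * ((U⁻¹ : Matrix.unitaryGroup m ℂ) : Matrix m m ℂ) =
      ((U : Matrix m m ℂ) * Nᴴ)ᴴ := by
    rw [conjTranspose_mul, conjTranspose_conjTranspose]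
    rfl
  refine ⟨U, q, fun y hy x => ?_, fun c hc h => ?_⟩
  · rw [e, conjTranspose_apply, h1 y hy, star_zero]
  · have := h2 (star c) (fun y hy => by simp [hc y hy]) (by
      rw [e, ← star_inj, star_mulVec, conjTranspose_conjTranspose, star_zero] at h
      exact h)
    simpa using this

/-- Unitary transformations of the strips of a space form a unitary transformation of the space. -/
theorem exists_unitary_glue [Fintype m] [DecidableEq m] {ι : Type} [DecidableEq ι] (lab : m → ι)
    (W : ∀ p, Matrix.unitaryGroup {x // lab x = p} ℂ) :
    ∃ V : Matrix.unitaryGroup m ℂ,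
      (∀ x x', lab x ≠ lab x' → (V : Matrix m m ℂ) x x' = 0) ∧
      ∀ p (x x' : {x // lab x = p}),
        (V : Matrix m m ℂ) x x' = (W p : Matrix {x // lab x = p} {x // lab x = p} ℂ) x x' := by
  let V₀ : Matrix m m ℂ := Matrix.of fun x x' =>
    if h : lab x' = lab x then
      (W (lab x) : Matrix {z // lab z = lab x} {z // lab z = lab x} ℂ) ⟨x, rfl⟩ ⟨x', h⟩ else 0
  have hW : ∀ p (x x' : {x // lab x = p}), V₀ x x' = (W p : Matrix {x // lab x = p} {x // lab x = p} ℂ) x x' := by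
    rintro p ⟨x, rfl⟩ ⟨x', hx'⟩
    simp [V₀, hx']
  have h0 : ∀ x x', lab x ≠ lab x' → V₀ x x' = 0 := fun x x' h => by simp [V₀, h.symm]
  have hV : V₀ ∈ Matrix.unitaryGroup m ℂ := by
    rw [Matrix.mem_unitaryGroup_iff]
    ext x x'
    rw [Matrix.mul_apply]
    simp only [Matrix.star_apply]
    by_cases h : lab x' = lab x
    · have e := congrFun (congrFun (Matrix.mem_unitaryGroup_iff.1 (W (lab x)).2) ⟨x, rfl⟩) ⟨x', h⟩
      simp only [Matrix.mul_apply, Matrix.star_apply, ← hW] at e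
      rw [sum_subtype_of_support (fun z => lab z = lab x) (fun z => V₀ x z * star (V₀ x' z))] at e
      · rw [e]
        simp [Matrix.one_apply]
      · intro z hz
        rw [h0 x z (Ne.symm hz), zero_mul]
    · rw [Matrix.one_apply, if_neg (by rintro rfl; exact h rfl)]
      refine Finset.sum_eq_zero fun z _ => ?_
      by_cases hz : lab x = lab z
      · rw [h0 x' z (by rw [← hz]; exact h), star_zero, mul_zero]
      · rw [h0 x z hz, zero_mul]
  exact ⟨⟨V₀, hV⟩, h0, hW⟩

end Unitary

end LinearAlgebra

end QuiverCycle

namespace QuiverCycle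

/-! ### Calculus of edges -/

namespace Edge

open Matrix

variable {X Y X' Y' X'' Y'' : Type}

@[simp] theorem entry_ofEntry : ∀ (b : Bool) (f : X → Y → ℂ) (x : X) (y : Y),
    (ofEntry b f).entry x y = f x y
  | true, _, _, _ => rfl
  | false, _, _, _ => rfl

@[simp] theorem entry_tr : ∀ {b : Bool} (M : Edge b X Y) (x : X) (y : Y),
    M.tr.entry x y = M.entry x y
  | true, _, _, _ => rfl
  | false, _, _, _ => rfl

@[simp] theorem entry_trBack : ∀ {b : Bool} (M : Edge (!b) X Y) (x : X) (y : Y),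
    (trBack (b := b) M).entry x y = M.entry x y
  | true, _, _, _ => rfl
  | false, _, _, _ => rfl

@[simp] theorem entry_sum_inl_inl : ∀ {b : Bool} (M : Edge b X Y) (M' : Edge b X' Y') (x : X)
    (y : Y), (M.sum M').entry (Sum.inl x) (Sum.inl y) = M.entry x y
  | true, _, _, _, _ => rfl
  | false, _, _, _, _ => rfl

@[simp] theorem entry_sum_inl_inr : ∀ {b : Bool} (M : Edge b X Y) (M' : Edge b X' Y') (x : X)
    (y : Y'), (M.sum M').entry (Sum.inl x) (Sum.inr y) = 0
  | true, _, _, _, _ => rfl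
  | false, _, _, _, _ => rfl

@[simp] theorem entry_sum_inr_inl : ∀ {b : Bool} (M : Edge b X Y) (M' : Edge b X' Y') (x : X')
    (y : Y), (M.sum M').entry (Sum.inr x) (Sum.inl y) = 0
  | true, _, _, _, _ => rfl
  | false, _, _, _, _ => rfl

@[simp] theorem entry_sum_inr_inr : ∀ {b : Bool} (M : Edge b X Y) (M' : Edge b X' Y') (x : X')
    (y : Y'), (M.sum M').entry (Sum.inr x) (Sum.inr y) = M'.entry x y
  | true, _, _, _, _ => rfl
  | false, _, _, _, _ => rfl

theorem entry_sumAssoc {b : Bool} (M : Edge b X Y) (M' : Edge b X' Y') (M'' : Edge b X'' Y'')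
    (x : (X ⊕ X') ⊕ X'') (y : (Y ⊕ Y') ⊕ Y'') :
    (M.sum (M'.sum M'')).entry (Equiv.sumAssoc _ _ _ x) (Equiv.sumAssoc _ _ _ y) =
      ((M.sum M').sum M'').entry x y := by
  rcases x with (x | x) | x <;> rcases y with (y | y) | y <;> simp

theorem entry_sumComm {b : Bool} (M : Edge b X Y) (M' : Edge b X' Y') (x : X ⊕ X') (y : Y ⊕ Y') :
    (M'.sum M).entry (Equiv.sumComm _ _ x) (Equiv.sumComm _ _ y) = (M.sum M').entry x y := by
  rcases x with x | x <;> rcases y with y | y <;> simp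

theorem entry_emptySum {b : Bool} (M : Edge b X Y) (M' : Edge b Empty Empty) (x : Empty ⊕ X)
    (y : Empty ⊕ Y) :
    M.entry (Equiv.emptySum _ _ x) (Equiv.emptySum _ _ y) = (M'.sum M).entry x y := by
  rcases x with x | x
  · exact x.elim
  · rcases y with y | y
    · exact y.elim
    · simp

theorem entry_sum_trBack {b : Bool} (M : Edge (!b) X Y) (M' : Edge (!b) X' Y') (x : X ⊕ X')
    (y : Y ⊕ Y') : ((trBack (b := b) M).sum (trBack (b := b) M')).entry x y =
      (trBack (b := b) (M.sum M')).entry x y := by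
  rcases x with x | x <;> rcases y with y | y <;> simp

variable [Fintype X] [Fintype Y] [Fintype X'] [Fintype Y'] [Fintype X''] [Fintype Y'']

theorem intertwines_true_iff {S : Matrix X' X ℂ} {T : Matrix Y' Y ℂ} {M : Edge true X Y}
    {M' : Edge true X' Y'} : Intertwines S T M M' ↔
      ∀ x y', ∑ x', M'.entry x' y' * S x' x = ∑ y, T y' y * M.entry x y := by
  constructor
  · intro h x y'
    have := congrFun (congrFun h y') x
    rwa [Matrix.mul_apply, Matrix.mul_apply] at this
  · intro h
    ext y' x
    rw [Matrix.mul_apply, Matrix.mul_apply]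
    exact h x y'

theorem intertwines_false_iff {S : Matrix X' X ℂ} {T : Matrix Y' Y ℂ} {M : Edge false X Y}
    {M' : Edge false X' Y'} : Intertwines S T M M' ↔
      ∀ x' y, ∑ y', M'.entry x' y' * T y' y = ∑ x, S x' x * M.entry x y := by
  constructor
  · intro h x' y
    have := congrFun (congrFun h x') y
    rwa [Matrix.mul_apply, Matrix.mul_apply] at this
  · intro h
    ext x' y
    rw [Matrix.mul_apply, Matrix.mul_apply]
    exact h x' y

theorem Intertwines.comp {S : Matrix X' X ℂ} {T : Matrix Y' Y ℂ} {S' : Matrix X'' X' ℂ}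
    {T' : Matrix Y'' Y' ℂ} : ∀ {b : Bool} {M : Edge b X Y} {M' : Edge b X' Y'}
    {M'' : Edge b X'' Y''}, Intertwines S T M M' → Intertwines S' T' M' M'' →
      Intertwines (S' * S) (T' * T) M M''
  | true, M, M', M'', h, h' => by
    change M''.fwd * (S' * S) = T' * T * M.fwd
    change M'.fwd * S = T * M.fwd at h
    change M''.fwd * S' = T' * M'.fwd at h'
    rw [← Matrix.mul_assoc, h', Matrix.mul_assoc, h, Matrix.mul_assoc]
  | false, M, M', M'', h, h' => by
    change M''.bwd * (T' * T) = S' * S * M.bwd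
    change M'.bwd * T = S * M.bwd at h
    change M''.bwd * T' = S' * M'.bwd at h'
    rw [← Matrix.mul_assoc, h', Matrix.mul_assoc, h, Matrix.mul_assoc]

theorem Intertwines.sum {X₁ Y₁ X₁' Y₁' : Type} [Fintype X₁] [Fintype Y₁] [Fintype X₁']
    [Fintype Y₁'] {S : Matrix X' X ℂ} {T : Matrix Y' Y ℂ} {S₁ : Matrix X₁' X₁ ℂ}
    {T₁ : Matrix Y₁' Y₁ ℂ} : ∀ {b : Bool} {M : Edge b X Y} {M' : Edge b X' Y'}
    {M₁ : Edge b X₁ Y₁} {M₁' : Edge b X₁' Y₁'}, Intertwines S T M M' →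
      Intertwines S₁ T₁ M₁ M₁' →
      Intertwines (Matrix.fromBlocks S 0 0 S₁) (Matrix.fromBlocks T 0 0 T₁) (M.sum M₁) (M'.sum M₁')
  | true, M, M', M₁, M₁', h, h' => by
    change M'.fwd * S = T * M.fwd at h
    change M₁'.fwd * S₁ = T₁ * M₁.fwd at h'
    change Matrix.fromBlocks M'.fwd 0 0 M₁'.fwd * Matrix.fromBlocks S 0 0 S₁ =
      Matrix.fromBlocks T 0 0 T₁ * Matrix.fromBlocks M.fwd 0 0 M₁.fwd
    simp [Matrix.fromBlocks_multiply, h, h']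
  | false, M, M', M₁, M₁', h, h' => by
    change M'.bwd * T = S * M.bwd at h
    change M₁'.bwd * T₁ = S₁ * M₁.bwd at h'
    change Matrix.fromBlocks M'.bwd 0 0 M₁'.bwd * Matrix.fromBlocks T 0 0 T₁ =
      Matrix.fromBlocks S 0 0 S₁ * Matrix.fromBlocks M.bwd 0 0 M₁.bwd
    simp [Matrix.fromBlocks_multiply, h, h']

variable [DecidableEq X] [DecidableEq Y] [DecidableEq X'] [DecidableEq Y']

theorem intertwines_one : ∀ {b : Bool} (M : Edge b X Y), Intertwines 1 1 M M
  | true, M => (Matrix.mul_one M.fwd).trans (Matrix.one_mul M.fwd).symm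
  | false, M => (Matrix.mul_one M.bwd).trans (Matrix.one_mul M.bwd).symm

theorem Intertwines.inv {S : Matrix X' X ℂ} {T : Matrix Y' Y ℂ} {S' : Matrix X X' ℂ}
    {T' : Matrix Y Y' ℂ} (hS : S * S' = 1) (hS' : S' * S = 1) (hT : T * T' = 1)
    (hT' : T' * T = 1) : ∀ {b : Bool} {M : Edge b X Y} {M' : Edge b X' Y'},
    Intertwines S T M M' → Intertwines S' T' M' M
  | true, M, M', h => by
    change M'.fwd * S = T * M.fwd at h
    change M.fwd * S' = T' * M'.fwd
    calc M.fwd * S' = T' * (T * M.fwd) * S' := by rw [← Matrix.mul_assoc, hT', Matrix.one_mul]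
      _ = T' * M'.fwd := by rw [← h, ← Matrix.mul_assoc, Matrix.mul_assoc, hS, Matrix.mul_one]
  | false, M, M', h => by
    change M'.bwd * T = S * M.bwd at h
    change M.bwd * T' = S' * M'.bwd
    calc M.bwd * T' = S' * (S * M.bwd) * T' := by rw [← Matrix.mul_assoc, hS', Matrix.one_mul]
      _ = S' * M'.bwd := by rw [← h, ← Matrix.mul_assoc, Matrix.mul_assoc, hT, Matrix.mul_one]

/-- Transposition reverses the direction of a morphism, so the transposed square has to be built
from the inverses. -/
theorem Intertwines.trBack {S : Matrix X' X ℂ} {T : Matrix Y' Y ℂ} {S' : Matrix X X' ℂ}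
    {T' : Matrix Y Y' ℂ} (hS : S * S' = 1) (hS' : S' * S = 1) (hT : T * T' = 1)
    (hT' : T' * T = 1) : ∀ {b : Bool} {M : Edge (!b) X Y} {M' : Edge (!b) X' Y'},
    Intertwines S T M M' →
      Intertwines S'ᵀ T'ᵀ (Edge.trBack (b := b) M) (Edge.trBack (b := b) M')
  | true, M, M', h => by
    have h := Intertwines.inv hS hS' hT hT' h
    change M.bwd * T' = S' * M'.bwd at h
    change M'.bwdᵀ * S'ᵀ = T'ᵀ * M.bwdᵀ
    rw [← transpose_mul, ← transpose_mul, h]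
  | false, M, M', h => by
    have h := Intertwines.inv hS hS' hT hT' h
    change M.fwd * S' = T' * M'.fwd at h
    change M'.fwdᵀ * T'ᵀ = S'ᵀ * M.fwdᵀ
    rw [← transpose_mul, ← transpose_mul, h]

theorem intertwines_permMat (e : X ≃ X') (f : Y ≃ Y') : ∀ {b : Bool} {M : Edge b X Y}
    {M' : Edge b X' Y'}, (∀ x y, M'.entry (e x) (f y) = M.entry x y) →
      Intertwines (permMat e) (permMat f) M M'
  | true, M, M', h => by
    rw [intertwines_true_iff]
    intro x y'
    obtain ⟨y, rfl⟩ := f.surjective y'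
    simp [permMat_apply, h]
  | false, M, M', h => by
    rw [intertwines_false_iff]
    intro x' y
    obtain ⟨x, rfl⟩ := e.surjective x'
    simp [permMat_apply, h]

theorem intertwines_act (S : Matrix.unitaryGroup X ℂ) (T : Matrix.unitaryGroup Y ℂ) :
    ∀ {b : Bool} (M : Edge b X Y), Intertwines S T M (act S T M)
  | true, M => by
    change (T : Matrix Y Y ℂ) * M.fwd * ((S⁻¹ : Matrix.unitaryGroup X ℂ) : Matrix X X ℂ) *
      (S : Matrix X X ℂ) = (T : Matrix Y Y ℂ) * M.fwd
    rw [Matrix.mul_assoc, ← Submonoid.coe_mul]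
    simp
  | false, M => by
    change (S : Matrix X X ℂ) * M.bwd * ((T⁻¹ : Matrix.unitaryGroup Y ℂ) : Matrix Y Y ℂ) *
      (T : Matrix Y Y ℂ) = (S : Matrix X X ℂ) * M.bwd
    rw [Matrix.mul_assoc, ← Submonoid.coe_mul]
    simp

theorem act_one_one : ∀ {b : Bool} (M : Edge b X Y), act 1 1 M = M
  | true, M => by
    change (1 : Matrix Y Y ℂ) * M.fwd * ((1⁻¹ : Matrix.unitaryGroup X ℂ) : Matrix X X ℂ) = M.fwd
    simp
  | false, M => by
    change (1 : Matrix X X ℂ) * M.bwd * ((1⁻¹ : Matrix.unitaryGroup Y ℂ) : Matrix Y Y ℂ) = M.bwd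
    simp

end Edge

/-! ### Calculus of representations of a cycle -/

namespace CycleRep

variable {t : ℕ} {o : ZMod t → Bool} {A B C A' B' : CycleRep o}

theorem Iso.refl (A : CycleRep o) : A.Iso A :=
  ⟨fun _ => 1, fun _ => Nonsingular.one, fun i => Edge.intertwines_one (A.mat i)⟩

theorem Iso.symm (h : A.Iso B) : B.Iso A := by
  obtain ⟨S, hS, h⟩ := h
  choose S' h1 h2 using hS
  exact ⟨S', fun v => ⟨S v, h2 v, h1 v⟩, fun i =>
    (h i).inv (h1 _) (h2 _) (h1 _) (h2 _)⟩

theorem Iso.trans (h : A.Iso B) (h' : B.Iso C) : A.Iso C := by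
  obtain ⟨S, hS, h⟩ := h
  obtain ⟨S', hS', h'⟩ := h'
  exact ⟨fun v => S' v * S v, fun v => (hS' v).mul (hS v), fun i => (h i).comp (h' i)⟩

theorem Iso.sum (h : A.Iso A') (h' : B.Iso B') : (A.sum B).Iso (A'.sum B') := by
  obtain ⟨S, hS, h⟩ := h
  obtain ⟨S', hS', h'⟩ := h'
  exact ⟨fun v => Matrix.fromBlocks (S v) 0 0 (S' v), fun v => (hS v).fromBlocks (hS' v),
    fun i => (h i).sum (h' i)⟩

theorem iso_of_equiv (e : ∀ v, A.idx v ≃ B.idx v)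
    (h : ∀ i x y, (B.mat i).entry (e i x) (e (i + 1) y) = (A.mat i).entry x y) : A.Iso B :=
  ⟨fun v => permMat (e v), fun v => Nonsingular.permMat (e v), fun i =>
    Edge.intertwines_permMat (e i) (e (i + 1)) (h i)⟩

theorem sum_assoc_iso (A B C : CycleRep o) : ((A.sum B).sum C).Iso (A.sum (B.sum C)) :=
  iso_of_equiv (fun _ => Equiv.sumAssoc _ _ _) fun i x y =>
    Edge.entry_sumAssoc (A.mat i) (B.mat i) (C.mat i) x y

theorem zero_sum_iso (A : CycleRep o) : ((zero o).sum A).Iso A :=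
  iso_of_equiv (fun v => Equiv.emptySum Empty (A.idx v)) fun i x y =>
    Edge.entry_emptySum (A.mat i) ((zero o).mat i) x y

theorem listSum_append_iso (L L' : List (CycleRep o)) :
    (listSum (L ++ L')).Iso ((listSum L).sum (listSum L')) := by
  induction L with
  | nil => exact (zero_sum_iso _).symm
  | cons A L ih => exact ((Iso.refl A).sum ih).trans (sum_assoc_iso _ _ _).symm

theorem listSum_map_iso {α : Type} (L : List α) (f g : α → CycleRep o)
    (h : ∀ p ∈ L, (f p).Iso (g p)) : (listSum (L.map f)).Iso (listSum (L.map g)) := by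
  induction L with
  | nil => exact Iso.refl _
  | cons A L ih =>
    exact (h _ (by simp)).sum (ih fun p hp => h p (by simp [hp]))

theorem Iso.transposeBack {A B : CycleRep fun i => !(o i)} (h : A.Iso B) :
    (CycleRep.transposeBack A).Iso (CycleRep.transposeBack B) := by
  obtain ⟨S, hS, h⟩ := h
  choose S' h1 h2 using hS
  exact ⟨fun v => (S' v).transpose, fun v => Nonsingular.transpose ⟨S v, h2 v, h1 v⟩,
    fun i => (h i).trBack (h1 _) (h2 _) (h1 _) (h2 _)⟩

theorem iso_transposeBack_transpose (A : CycleRep o) : A.Iso A.transpose.transposeBack :=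
  iso_of_equiv (fun _ => Equiv.refl _) fun i x y =>
    (Edge.entry_trBack (A.mat i).tr x y).trans (Edge.entry_tr (A.mat i) x y)

theorem transposeBack_sum_iso (A B : CycleRep fun i => !(o i)) :
    (CycleRep.transposeBack (A.sum B)).Iso
      ((CycleRep.transposeBack A).sum (CycleRep.transposeBack B)) :=
  iso_of_equiv (fun _ => Equiv.refl _) fun i x y =>
    Edge.entry_sum_trBack (A.mat i) (B.mat i) x y

end CycleRep

/-! ### Calculus of representations of a chain -/

namespace ChainRep

variable {o : ℕ → Bool} {a b : ℕ} {A B C A' B' : ChainRep o a b}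

theorem Iso.refl (A : ChainRep o a b) : A.Iso A :=
  ⟨fun _ => 1, fun _ => Nonsingular.one, fun i => Edge.intertwines_one (A.mat i)⟩

theorem Iso.symm (h : A.Iso B) : B.Iso A := by
  obtain ⟨S, hS, h⟩ := h
  choose S' h1 h2 using hS
  exact ⟨S', fun v => ⟨S v, h2 v, h1 v⟩, fun i =>
    (h i).inv (h1 _) (h2 _) (h1 _) (h2 _)⟩

theorem Iso.trans (h : A.Iso B) (h' : B.Iso C) : A.Iso C := by
  obtain ⟨S, hS, h⟩ := h
  obtain ⟨S', hS', h'⟩ := h'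
  exact ⟨fun v => S' v * S v, fun v => (hS' v).mul (hS v), fun i => (h i).comp (h' i)⟩

theorem Iso.sum (h : A.Iso A') (h' : B.Iso B') : (A.sum B).Iso (A'.sum B') := by
  obtain ⟨S, hS, h⟩ := h
  obtain ⟨S', hS', h'⟩ := h'
  exact ⟨fun v => Matrix.fromBlocks (S v) 0 0 (S' v), fun v => (hS v).fromBlocks (hS' v),
    fun i => (h i).sum (h' i)⟩

theorem iso_of_equiv (e : ∀ v, A.idx v ≃ B.idx v)
    (h : ∀ i x y, (B.mat i).entry (e i x) (e (i + 1) y) = (A.mat i).entry x y) : A.Iso B :=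
  ⟨fun v => permMat (e v), fun v => Nonsingular.permMat (e v), fun i =>
    Edge.intertwines_permMat (e i) (e (i + 1)) (h i)⟩

theorem sum_assoc_iso (A B C : ChainRep o a b) : ((A.sum B).sum C).Iso (A.sum (B.sum C)) :=
  iso_of_equiv (fun _ => Equiv.sumAssoc _ _ _) fun i x y =>
    Edge.entry_sumAssoc (A.mat i) (B.mat i) (C.mat i) x y

theorem sum_comm_iso (A B : ChainRep o a b) : (A.sum B).Iso (B.sum A) :=
  iso_of_equiv (fun _ => Equiv.sumComm _ _) fun i x y =>
    Edge.entry_sumComm (A.mat i) (B.mat i) x y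

theorem listSum_perm_iso {L L' : List (ChainRep o a b)} (h : L.Perm L') :
    (listSum L).Iso (listSum L') := by
  induction h with
  | nil => exact Iso.refl _
  | cons A _ ih => exact (Iso.refl A).sum ih
  | swap A B L =>
    exact (sum_assoc_iso B A (listSum L)).symm.trans
      (((sum_comm_iso B A).sum (Iso.refl _)).trans (sum_assoc_iso A B (listSum L)))
  | trans _ _ ih ih' => exact ih.trans ih'

end ChainRep

end QuiverCycle

namespace QuiverCycle

theorem Edge.intertwines_iff {X Y X' Y' : Type} [Fintype X] [Fintype Y] [Fintype X'] [Fintype Y']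
    {S : Matrix X' X ℂ} {T : Matrix Y' Y ℂ} {b : Bool} {M : Edge b X Y} {M' : Edge b X' Y'} :
    Edge.Intertwines S T M M' ↔
      (b = true → ∀ x y', ∑ x', M'.entry x' y' * S x' x = ∑ y, T y' y * M.entry x y) ∧
      (b = false → ∀ x' y, ∑ y', M'.entry x' y' * T y' y = ∑ x, S x' x * M.entry x y) := by
  cases b
  · simp [Edge.intertwines_false_iff]
  · simp [Edge.intertwines_true_iff]

/-! ### The push-down -/

namespace ChainRep

variable {t : ℕ} {o : ZMod t → Bool} {a b : ℕ}

/-- With the second index literally `k + 1`, the transport in the definition of `pushDown`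
disappears. The proofs about push-downs therefore substitute this equation before computing entries.
-/
theorem entry_pushDown_succ (B : ChainRep (fun k => o (vtx t k)) a b) {i : ZMod t} {k : ℕ}
    (hk : k ∈ (Finset.Icc a b).filter fun k => vtx t k = i)
    (hk' : k + 1 ∈ (Finset.Icc a b).filter fun k => vtx t k = i + 1)
    (x : B.idx k) (y : B.idx (k + 1)) :
    (B.pushDown.mat i).entry (⟨⟨k, hk⟩, x⟩ : B.pushDown.idx i)
      (⟨⟨k + 1, hk'⟩, y⟩ : B.pushDown.idx (i + 1)) = (B.mat k).entry x y := by
  refine (Edge.entry_ofEntry _ _ _ _).trans ?_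
  simp

theorem entry_pushDown_of_ne (B : ChainRep (fun k => o (vtx t k)) a b) {i : ZMod t} {k k' : ℕ}
    (hk : k ∈ (Finset.Icc a b).filter fun k => vtx t k = i)
    (hk' : k' ∈ (Finset.Icc a b).filter fun k => vtx t k = i + 1) (h : k' ≠ k + 1)
    (x : B.idx k) (y : B.idx k') :
    (B.pushDown.mat i).entry (⟨⟨k, hk⟩, x⟩ : B.pushDown.idx i)
      (⟨⟨k', hk'⟩, y⟩ : B.pushDown.idx (i + 1)) = 0 := by
  refine (Edge.entry_ofEntry _ _ _ _).trans ?_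
  exact dif_neg h

theorem Iso.pushDown {B C : ChainRep (fun k => o (vtx t k)) a b} (h : B.Iso C) :
    B.pushDown.Iso C.pushDown := by
  obtain ⟨S, hS, h⟩ := h
  refine ⟨fun v => Matrix.blockDiagonal'
    fun k : {k : ℕ // k ∈ (Finset.Icc a b).filter fun k => vtx t k = v} => S k.1, fun v => ?_,
    fun i => ?_⟩
  · choose S' h1 h2 using hS
    refine ⟨Matrix.blockDiagonal' fun k => S' k.1, ?_, ?_⟩
    · refine (Matrix.blockDiagonal'_mul _ _).symm.trans ?_
      simp only [h1]
      exact Matrix.blockDiagonal'_one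
    · refine (Matrix.blockDiagonal'_mul _ _).symm.trans ?_
      simp only [h2]
      exact Matrix.blockDiagonal'_one
  · refine Edge.intertwines_iff.2 ⟨?_, ?_⟩
    · rintro ho ⟨k, x⟩ ⟨k', y'⟩
      -- A block diagonal base change leaves only the summand over the chain vertex `k`, and
      -- likewise only `k'` on the other side; the square then reduces to the one at the arrow `k`
      -- of the chain if `k' = k + 1`, and to `0 = 0` otherwise.
      have e1 : ∑ x', (C.pushDown.mat i).entry x' (⟨k', y'⟩ : C.pushDown.idx (i + 1)) *
          Matrix.blockDiagonal' (fun k : {k : ℕ // k ∈ (Finset.Icc a b).filter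
            fun k => vtx t k = i} => S k.1) x' ⟨k, x⟩ =
          ∑ x', (C.pushDown.mat i).entry (⟨k, x'⟩ : C.pushDown.idx i)
            (⟨k', y'⟩ : C.pushDown.idx (i + 1)) * S k.1 x' x := by
        refine (Fintype.sum_sigma _).trans ?_
        rw [Fintype.sum_eq_single k]
        · simp only [Matrix.blockDiagonal'_apply_eq]
        · intro k₁ hk₁
          refine Finset.sum_eq_zero fun x' _ => ?_
          rw [Matrix.blockDiagonal'_apply_ne _ _ _ hk₁, mul_zero]
      have e2 : ∑ y, Matrix.blockDiagonal' (fun k : {k : ℕ // k ∈ (Finset.Icc a b).filter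
            fun k => vtx t k = i + 1} => S k.1) ⟨k', y'⟩ y *
            (B.pushDown.mat i).entry (⟨k, x⟩ : B.pushDown.idx i) y =
          ∑ y, S k'.1 y' y * (B.pushDown.mat i).entry (⟨k, x⟩ : B.pushDown.idx i)
            (⟨k', y⟩ : B.pushDown.idx (i + 1)) := by
        refine (Fintype.sum_sigma _).trans ?_
        rw [Fintype.sum_eq_single k']
        · simp only [Matrix.blockDiagonal'_apply_eq]
        · intro k₁ hk₁
          refine Finset.sum_eq_zero fun x' _ => ?_
          rw [Matrix.blockDiagonal'_apply_ne _ _ _ hk₁.symm, zero_mul]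
      refine e1.trans (Eq.trans ?_ e2.symm)
      obtain ⟨k, hk⟩ := k
      obtain ⟨k', hk'⟩ := k'
      have hi := (Finset.mem_filter.1 hk).2
      by_cases hkk : k' = k + 1
      · subst hkk
        subst hi
        simp only [entry_pushDown_succ]
        exact (Edge.intertwines_iff.1 (h k)).1 ho x y'
      · rw [Finset.sum_eq_zero, Finset.sum_eq_zero]
        · intro y _
          rw [entry_pushDown_of_ne B hk hk' hkk, mul_zero]
        · intro y _
          rw [entry_pushDown_of_ne C hk hk' hkk, zero_mul]
    · rintro ho ⟨k, x'⟩ ⟨k', y⟩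
      have e1 : ∑ y', (C.pushDown.mat i).entry (⟨k, x'⟩ : C.pushDown.idx i) y' *
          Matrix.blockDiagonal' (fun k : {k : ℕ // k ∈ (Finset.Icc a b).filter
            fun k => vtx t k = i + 1} => S k.1) y' ⟨k', y⟩ =
          ∑ y', (C.pushDown.mat i).entry (⟨k, x'⟩ : C.pushDown.idx i)
            (⟨k', y'⟩ : C.pushDown.idx (i + 1)) * S k'.1 y' y := by
        refine (Fintype.sum_sigma _).trans ?_
        rw [Fintype.sum_eq_single k']
        · simp only [Matrix.blockDiagonal'_apply_eq]
        · intro k₁ hk₁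
          refine Finset.sum_eq_zero fun x' _ => ?_
          rw [Matrix.blockDiagonal'_apply_ne _ _ _ hk₁, mul_zero]
      have e2 : ∑ x, Matrix.blockDiagonal' (fun k : {k : ℕ // k ∈ (Finset.Icc a b).filter
            fun k => vtx t k = i} => S k.1) ⟨k, x'⟩ x *
            (B.pushDown.mat i).entry x (⟨k', y⟩ : B.pushDown.idx (i + 1)) =
          ∑ x, S k.1 x' x * (B.pushDown.mat i).entry (⟨k, x⟩ : B.pushDown.idx i)
            (⟨k', y⟩ : B.pushDown.idx (i + 1)) := by
        refine (Fintype.sum_sigma _).trans ?_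
        rw [Fintype.sum_eq_single k]
        · simp only [Matrix.blockDiagonal'_apply_eq]
        · intro k₁ hk₁
          refine Finset.sum_eq_zero fun x' _ => ?_
          rw [Matrix.blockDiagonal'_apply_ne _ _ _ hk₁.symm, zero_mul]
      refine e1.trans (Eq.trans ?_ e2.symm)
      obtain ⟨k, hk⟩ := k
      obtain ⟨k', hk'⟩ := k'
      have hi := (Finset.mem_filter.1 hk).2
      by_cases hkk : k' = k + 1
      · subst hkk
        subst hi
        simp only [entry_pushDown_succ]
        exact (Edge.intertwines_iff.1 (h k)).2 ho x' y
      · rw [Finset.sum_eq_zero, Finset.sum_eq_zero]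
        · intro y _
          rw [entry_pushDown_of_ne B hk hk' hkk, mul_zero]
        · intro y _
          rw [entry_pushDown_of_ne C hk hk' hkk, zero_mul]

theorem pushDown_sum_iso (B C : ChainRep (fun k => o (vtx t k)) a b) :
    (B.sum C).pushDown.Iso (B.pushDown.sum C.pushDown) := by
  refine CycleRep.iso_of_equiv (fun v => Equiv.sigmaSumDistrib _ _) ?_
  rintro i ⟨⟨k, hk⟩, x⟩ ⟨⟨k', hk'⟩, y⟩
  by_cases hkk : k' = k + 1
  · subst hkk
    rw [entry_pushDown_succ]
    rcases x with x | x <;> rcases y with y | y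
    · refine (Edge.entry_sum_inl_inl (B.pushDown.mat i) (C.pushDown.mat i) ⟨_, x⟩ ⟨_, y⟩).trans ?_
      rw [entry_pushDown_succ]
      exact (Edge.entry_sum_inl_inl (B.mat k) (C.mat k) x y).symm
    · refine (Edge.entry_sum_inl_inr (B.pushDown.mat i) (C.pushDown.mat i) ⟨_, x⟩ ⟨_, y⟩).trans ?_
      exact (Edge.entry_sum_inl_inr (B.mat k) (C.mat k) x y).symm
    · refine (Edge.entry_sum_inr_inl (B.pushDown.mat i) (C.pushDown.mat i) ⟨_, x⟩ ⟨_, y⟩).trans ?_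
      exact (Edge.entry_sum_inr_inl (B.mat k) (C.mat k) x y).symm
    · refine (Edge.entry_sum_inr_inr (B.pushDown.mat i) (C.pushDown.mat i) ⟨_, x⟩ ⟨_, y⟩).trans ?_
      rw [entry_pushDown_succ]
      exact (Edge.entry_sum_inr_inr (B.mat k) (C.mat k) x y).symm
  · refine Eq.trans ?_ (entry_pushDown_of_ne (B.sum C) hk hk' hkk x y).symm
    rcases x with x | x <;> rcases y with y | y
    · refine (Edge.entry_sum_inl_inl (B.pushDown.mat i) (C.pushDown.mat i) ⟨_, x⟩ ⟨_, y⟩).trans ?_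
      exact entry_pushDown_of_ne _ hk hk' hkk x y
    · exact Edge.entry_sum_inl_inr (B.pushDown.mat i) (C.pushDown.mat i) ⟨_, x⟩ ⟨_, y⟩
    · exact Edge.entry_sum_inr_inl (B.pushDown.mat i) (C.pushDown.mat i) ⟨_, x⟩ ⟨_, y⟩
    · refine (Edge.entry_sum_inr_inr (B.pushDown.mat i) (C.pushDown.mat i) ⟨_, x⟩ ⟨_, y⟩).trans ?_
      exact entry_pushDown_of_ne _ hk hk' hkk x y

theorem pushDown_zero_iso :
    (zero (fun k => o (vtx t k)) a b).pushDown.Iso (CycleRep.zero o) := by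
  have h : ∀ v, IsEmpty ((zero (fun k => o (vtx t k)) a b).pushDown.idx v) :=
    fun v => ⟨fun x => Empty.elim x.2⟩
  have h' : ∀ v, IsEmpty ((CycleRep.zero o).idx v) := fun v => ⟨fun x => Empty.elim x⟩
  exact CycleRep.iso_of_equiv (fun v => Equiv.equivOfIsEmpty _ _)
    fun i x => (h i).elim x

theorem pushDown_listSum_iso (L : List (ChainRep (fun k => o (vtx t k)) a b)) :
    (listSum L).pushDown.Iso (CycleRep.listSum (L.map pushDown)) := by
  induction L with
  | nil => exact pushDown_zero_iso
  | cons A L ih => exact (pushDown_sum_iso A (listSum L)).trans ((CycleRep.Iso.refl _).sum ih)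

/-- The bounds matter because `L` is cut off to the chain while `G` is not; inside the chain the two
bases are the same integers. -/
theorem pushDown_L_iso {i j : ℕ} (hi : a ≤ i) (hj : j ≤ b) :
    (L (fun k => o (vtx t k)) a b i j).pushDown.Iso (G o i j) := by
  let e : ∀ v, (L (fun k => o (vtx t k)) a b i j).pushDown.idx v ≃ (G o i j).idx v := fun v =>
    { toFun := fun p => ⟨p.1.1, by
        have h1 := Finset.mem_filter.1 p.1.2
        have h2 := p.2.2
        exact Finset.mem_filter.2 ⟨Finset.mem_Icc.2 h2.2, h1.2⟩⟩
      invFun := fun q => ⟨⟨q.1, by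
        have h1 := Finset.mem_filter.1 q.2
        have h2 := Finset.mem_Icc.1 h1.1
        exact Finset.mem_filter.2 ⟨Finset.mem_Icc.2 ⟨hi.trans h2.1, h2.2.trans hj⟩, h1.2⟩⟩,
        ⟨(), by
          have h1 := Finset.mem_filter.1 q.2
          have h2 := Finset.mem_Icc.1 h1.1
          exact ⟨⟨hi.trans h2.1, h2.2.trans hj⟩, h2⟩⟩⟩
      left_inv := fun _ => rfl
      right_inv := fun _ => rfl }
  refine CycleRep.iso_of_equiv e ?_
  rintro s ⟨⟨k, hk⟩, x⟩ ⟨⟨k', hk'⟩, y⟩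
  refine (Edge.entry_ofEntry _ _ _ _).trans ?_
  by_cases hkk : k' = k + 1
  · subst hkk
    rw [entry_pushDown_succ]
    refine Eq.trans ?_ (Edge.entry_ofEntry _ _ _ _).symm
    exact if_pos rfl
  · refine Eq.trans ?_ (entry_pushDown_of_ne _ hk hk' hkk x y).symm
    exact if_neg hkk

theorem pushDown_transposeBack_iso (B : ChainRep (fun k => !(o (vtx t k))) a b) :
    (CycleRep.transposeBack (pushDown (o := fun i => !(o i)) B)).Iso
      (pushDown (transposeBack (o := fun k => o (vtx t k)) B)) := by
  refine CycleRep.iso_of_equiv (fun _ => Equiv.refl _) ?_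
  rintro i ⟨⟨k, hk⟩, x⟩ ⟨⟨k', hk'⟩, y⟩
  refine Eq.trans ?_ (Edge.entry_trBack ((pushDown (o := fun i => !(o i)) B).mat i) _ _).symm
  by_cases hkk : k' = k + 1
  · subst hkk
    refine (entry_pushDown_succ (transposeBack (o := fun k => o (vtx t k)) B) hk hk' x y).trans ?_
    refine Eq.trans ?_ (entry_pushDown_succ (o := fun i => !(o i)) B hk hk' x y).symm
    exact Edge.entry_trBack (b := o (vtx t k)) (B.mat k) x y
  · refine (entry_pushDown_of_ne (transposeBack (o := fun k => o (vtx t k)) B)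
      hk hk' hkk x y).trans ?_
    exact (entry_pushDown_of_ne (o := fun i => !(o i)) B hk hk' hkk x y).symm

end ChainRep

end QuiverCycle

namespace QuiverCycle

/-! ### Labels and unitary transformations that fix the labelled vectors -/

/-- The label `c` is greater than `k`, where `none` is greater than every number. -/
def Above (k : ℕ) (c : Option ℕ) : Prop := ∀ j, c = some j → k < j

theorem above_none (k : ℕ) : Above k none := fun _ h => by simp at h

theorem above_some {k j : ℕ} : Above k (some j) ↔ k < j :=
  ⟨fun h => h j rfl, fun h i hi => by simp only [Option.some.injEq] at hi; omega⟩

theorem ne_none_of_not_above {k : ℕ} {c : Option ℕ} (h : ¬ Above k c) : c ≠ none := by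
  rintro rfl
  exact h (above_none k)

section Fixes

variable {X Y : Type} [DecidableEq X] [DecidableEq Y]

/-- The matrix `P` acts only on the basis vectors without label. -/
def Fixes (lab : X → Option ℕ) (P : Matrix X X ℂ) : Prop :=
  ∀ x x', lab x ≠ none ∨ lab x' ≠ none → P x x' = (1 : Matrix X X ℂ) x x'

theorem Fixes.one (lab : X → Option ℕ) : Fixes lab (1 : Matrix X X ℂ) := fun _ _ _ => rfl

theorem Fixes.transpose {lab : X → Option ℕ} {P : Matrix X X ℂ} (h : Fixes lab P) :
    Fixes lab P.transpose := fun x x' hx => by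
  rw [Matrix.transpose_apply, h x' x hx.symm]
  simp [Matrix.one_apply, eq_comm]

/-- Such a matrix is block diagonal with respect to the labels, which is why conditions on label
blocks survive the base change. -/
theorem Fixes.eq_zero {lab : X → Option ℕ} {P : Matrix X X ℂ} (h : Fixes lab P) {x x' : X}
    (hx : lab x' ≠ lab x) : P x x' = 0 := by
  have hne : x ≠ x' := by
    rintro rfl
    exact hx rfl
  rw [h, Matrix.one_apply_ne hne]
  by_contra! hc
  exact hx (hc.2.trans hc.1.symm)

variable [Fintype X] [Fintype Y]

theorem Fixes.unitary_inv {lab : X → Option ℕ} {U : Matrix.unitaryGroup X ℂ}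
    (h : Fixes lab (U : Matrix X X ℂ)) :
    Fixes lab ((U⁻¹ : Matrix.unitaryGroup X ℂ) : Matrix X X ℂ) := fun x x' hx => by
  change star ((U : Matrix X X ℂ) x' x) = _
  rw [h x' x hx.symm]
  simp [Matrix.one_apply, eq_comm, apply_ite]

/-- The result of a change of bases, in terms of entries. -/
def transform (P : Matrix X X ℂ) (Q : Matrix Y Y ℂ) (f : X → Y → ℂ) (x : X) (y : Y) : ℂ :=
  ∑ x', ∑ y', P x x' * Q y y' * f x' y'

/-- Replacing one of the two unitary matrices by the transpose of its inverse gives a single formula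
for both orientations. Only nonsingularity and the label condition are kept, since the invariants
need no more. -/
theorem Edge.exists_act_eq_transform {labX : X → Option ℕ} {labY : Y → Option ℕ}
    (S : Matrix.unitaryGroup X ℂ) (T : Matrix.unitaryGroup Y ℂ)
    (hS : Fixes labX (S : Matrix X X ℂ)) (hT : Fixes labY (T : Matrix Y Y ℂ)) : ∀ b : Bool,
    ∃ (P : Matrix X X ℂ) (Q : Matrix Y Y ℂ), Nonsingular P ∧ Nonsingular Q ∧ Fixes labX P ∧
      Fixes labY Q ∧ ∀ (M : Edge b X Y) x y,
        (Edge.act S T M).entry x y = transform P Q M.entry x y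
  | true => by
    refine ⟨((S⁻¹ : Matrix.unitaryGroup X ℂ) : Matrix X X ℂ).transpose, T,
      (Nonsingular.unitary _).transpose, Nonsingular.unitary _, hS.unitary_inv.transpose, hT, ?_⟩
    intro M x y
    change ((T : Matrix Y Y ℂ) * M.fwd *
      ((S⁻¹ : Matrix.unitaryGroup X ℂ) : Matrix X X ℂ)) y x = _
    simp only [Matrix.mul_apply, Finset.sum_mul, transform, Matrix.transpose_apply]
    refine Finset.sum_congr rfl fun x' _ => Finset.sum_congr rfl fun y' _ => ?_
    change _ = _ * _ * M.fwd y' x'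
    ring
  | false => by
    refine ⟨S, ((T⁻¹ : Matrix.unitaryGroup Y ℂ) : Matrix Y Y ℂ).transpose,
      Nonsingular.unitary _, (Nonsingular.unitary _).transpose, hS, hT.unitary_inv.transpose, ?_⟩
    intro M x y
    change ((S : Matrix X X ℂ) * M.bwd *
      ((T⁻¹ : Matrix.unitaryGroup Y ℂ) : Matrix Y Y ℂ)) x y = _
    simp only [Matrix.mul_apply, Finset.sum_mul, transform, Matrix.transpose_apply]
    rw [Finset.sum_comm]
    refine Finset.sum_congr rfl fun x' _ => Finset.sum_congr rfl fun y' _ => ?_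
    change _ = _ * _ * M.bwd x' y'
    ring

variable {labX : X → Option ℕ} {labY : Y → Option ℕ} {P : Matrix X X ℂ} {Q : Matrix Y Y ℂ}

theorem transform_congr (hP : Fixes labX P) (hQ : Fixes labY Q) {f g : X → Y → ℂ} {x : X} {y : Y}
    (h : ∀ x' y', labX x' = labX x → labY y' = labY y → f x' y' = g x' y') :
    transform P Q f x y = transform P Q g x y := by
  refine Finset.sum_congr rfl fun x' _ => Finset.sum_congr rfl fun y' _ => ?_
  by_cases hx : labX x' = labX x
  · by_cases hy : labY y' = labY y
    · rw [h x' y' hx hy]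
    · rw [hQ.eq_zero hy, mul_zero, zero_mul, zero_mul]
  · rw [hP.eq_zero hx, zero_mul, zero_mul, zero_mul]

theorem transform_eq_zero (hP : Fixes labX P) (hQ : Fixes labY Q) {f : X → Y → ℂ} {x : X} {y : Y}
    (h : ∀ x' y', labX x' = labX x → labY y' = labY y → f x' y' = 0) :
    transform P Q f x y = 0 := by
  rw [transform_congr (g := fun _ _ => 0) hP hQ h]
  simp [transform]

theorem transform_eq_self (hP : Fixes labX P) (hQ : Fixes labY Q) {f : X → Y → ℂ} {x : X} {y : Y}
    (hx : labX x ≠ none) (hy : labY y ≠ none) : transform P Q f x y = f x y := by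
  have hx' : ∀ x', P x x' = (1 : Matrix X X ℂ) x x' := fun x' => hP x x' (Or.inl hx)
  have hy' : ∀ y', Q y y' = (1 : Matrix Y Y ℂ) y y' := fun y' => hQ y y' (Or.inl hy)
  simp [transform, hx', hy', Matrix.one_apply]

end Fixes

/-! ### The invariants of the algorithm for cycles -/

section CycleInv

variable {t : ℕ}

/-- The relation, after step `r`, between the matrix `M` of the arrow `i` in the split quiver and
the matrix `F` that is obtained by the same unitary transformations without dropping blocks. -/
structure EdgeInv (r : ℕ) (i : ZMod t) {X Y : Type} [Fintype X] [Fintype Y]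
    (labX : X → Option ℕ) (labY : Y → Option ℕ) (b : Bool) (F M : X → Y → ℂ) : Prop where
  eq_none : ∀ x y, labX x = none → labY y = none → M x y = F x y
  eq_succ : ∀ x y k, labX x = some k → labY y = some (k + 1) → M x y = F x y
  eq_last : ∀ x y, labX x = some (r + 1) → labY y = none → M x y = F x y
  cw_zero : b = true → ∀ x y k, labY y = some (k + 1) → Above k (labX x) → F x y = 0
  ccw_zero : b = false → ∀ x y k, labX x = some k → k ≤ r → Above (k + 1) (labY y) → F x y = 0
  cw_surj : b = true → ∀ k, 1 ≤ k → k ≤ r → vtx t k = i → ∀ d : Y → ℂ,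
    (∀ y, ¬ Above (k + 1) (labY y) → d y = 0) →
    (∀ x, Above k (labX x) → ∑ y, d y * F x y = 0) → d = 0
  ccw_inj : b = false → ∀ k, k ≤ r → ∀ d : Y → ℂ,
    (∀ y, labY y ≠ some (k + 1) → d y = 0) →
    (∀ x, labX x = some k → ∑ y, F x y * d y = 0) → d = 0

variable {r : ℕ} {i : ZMod t} {X Y : Type} [Fintype X] [Fintype Y]
  {labX : X → Option ℕ} {labY : Y → Option ℕ} {b : Bool} {F M : X → Y → ℂ}

/-- The base change mixes unlabelled vectors only. Blocks with prescribed labels are therefore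
transformed within themselves, and blocks between two labelled classes do not change at all; only
`cw_surj` needs the invertibility of `P` and `Q`. -/
theorem EdgeInv.transform [DecidableEq X] [DecidableEq Y] (h : EdgeInv r i labX labY b F M) {P : Matrix X X ℂ}
    {Q : Matrix Y Y ℂ} (hP : Fixes labX P) (hQ : Fixes labY Q) (hP' : Nonsingular P) (hQ' : Nonsingular Q) :
    EdgeInv r i labX labY b (transform P Q F) (transform P Q M) where
  eq_none x y hx hy := transform_congr hP hQ fun x' y' hx' hy' =>
    h.eq_none x' y' (hx'.trans hx) (hy'.trans hy)
  eq_succ x y k hx hy := transform_congr hP hQ fun x' y' hx' hy' =>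
    h.eq_succ x' y' k (hx'.trans hx) (hy'.trans hy)
  eq_last x y hx hy := transform_congr hP hQ fun x' y' hx' hy' =>
    h.eq_last x' y' (hx'.trans hx) (hy'.trans hy)
  cw_zero hb x y k hy hx := transform_eq_zero hP hQ fun x' y' hx' hy' =>
    h.cw_zero hb x' y' k (hy'.trans hy) (hx' ▸ hx)
  ccw_zero hb x y k hx hk hy := transform_eq_zero hP hQ fun x' y' hx' hy' =>
    h.ccw_zero hb x' y' k (hx'.trans hx) hk (hy' ▸ hy)
  cw_surj hb k hk hkr hki d hd hd0 := by
    classical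
    let d' : Y → ℂ := Matrix.vecMul d Q
    let e : X → ℂ := fun x' => ∑ y', d' y' * F x' y'
    have hsum : ∀ x, ∑ y, d y * QuiverCycle.transform P Q F x y = ∑ x', P x x' * e x' := by
      intro x
      simp only [QuiverCycle.transform, e, d', Matrix.vecMul, dotProduct, Finset.mul_sum,
        Finset.sum_mul]
      rw [Finset.sum_comm]
      refine Finset.sum_congr rfl fun x' _ => ?_
      rw [Finset.sum_comm]
      refine Finset.sum_congr rfl fun y' _ => Finset.sum_congr rfl fun y _ => ?_
      ring
    -- `P` respects the span of the labels above `k`, so the truncated vector is still killed by `P`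
    -- and must be zero.
    let e' : X → ℂ := fun x => if Above k (labX x) then e x else 0
    have he' : e' = 0 := by
      apply hP'.mulVec_eq_zero
      ext x
      change ∑ x', P x x' * e' x' = 0
      by_cases hx : Above k (labX x)
      · rw [← hd0 x hx, hsum]
        refine Finset.sum_congr rfl fun x' _ => ?_
        by_cases hx' : labX x' = labX x
        · simp only [e']
          rw [if_pos (hx' ▸ hx)]
        · rw [hP.eq_zero hx', zero_mul, zero_mul]
      · refine Finset.sum_eq_zero fun x' _ => ?_
        rw [hP x x' (Or.inl (ne_none_of_not_above hx)), Matrix.one_apply]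
        split_ifs with hxx
        · subst hxx
          simp [e', hx]
        · rw [zero_mul]
    have hd' : d' = 0 := by
      refine h.cw_surj hb k hk hkr hki d' (fun y hy => ?_) fun x hx => ?_
      · refine Finset.sum_eq_zero fun y' _ => ?_
        change d y' * Q y' y = 0
        rw [hQ y' y (Or.inr (ne_none_of_not_above hy)), Matrix.one_apply]
        split_ifs with hyy
        · subst hyy
          rw [hd _ hy, zero_mul]
        · rw [mul_zero]
      · have := congrFun he' x
        simpa [e', hx] using this
    exact hQ'.vecMul_eq_zero hd'
  ccw_inj hb k hk d hd hd0 := by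
    refine h.ccw_inj hb k hk d hd fun x hx => ?_
    rw [← hd0 x hx]
    refine Finset.sum_congr rfl fun y _ => ?_
    by_cases hy : labY y = some (k + 1)
    · rw [transform_eq_self hP hQ (by simp [hx]) (by simp [hy])]
    · rw [hd y hy, mul_zero, mul_zero]

/-- The new labels after a vertex has been split, which gives the label `k` to some of the vectors
without label. -/
def Refines (k : ℕ) (lab lab' : X → Option ℕ) : Prop :=
  ∀ x, lab' x = lab x ∨ (lab x = none ∧ lab' x = some k)

/-- This serves every arrow other than `[r+1]`: its far end keeps its labels, and its near end may
only lose unlabelled vectors to the new greatest label. The conditions for `k = r + 1` concern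
another arrow or an empty label class. -/
theorem EdgeInv.relabel_source (h : EdgeInv r i labX labY b F M) {labX' : X → Option ℕ}
    (hX' : Refines (r + 2) labX labX') (hX : ∀ x k, labX x = some k → vtx t k = i ∧ k ≤ r + 1)
    (hY : ∀ y k, labY y = some k → k ≤ r + 1) (hi : i ≠ vtx t (r + 1)) :
    EdgeInv (r + 1) i labX' labY b F M := by
  have hlt : ∀ x k, labX' x = some k → k ≤ r + 1 → labX x = some k := by
    intro x k hx hk
    rcases hX' x with h1 | ⟨-, h1⟩
    · rw [← h1, hx]
    · rw [hx] at h1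
      simp only [Option.some.injEq] at h1
      omega
  have hab : ∀ x k, Above k (labX' x) → Above k (labX x) := by
    intro x k hx
    rcases hX' x with h1 | ⟨h1, -⟩
    · rwa [← h1]
    · rw [h1]
      exact above_none k
  have hab' : ∀ x k, k ≤ r + 1 → Above k (labX x) → Above k (labX' x) := by
    intro x k hk hx
    rcases hX' x with h1 | ⟨-, h1⟩
    · rwa [h1]
    · rw [h1, above_some]
      omega
  -- The value `k = r + 1` is excluded because `i ≠ [r+1]`.
  have hne : ∀ k, vtx t k = i → k ≤ r + 1 → k ≤ r := by
    intro k hk hkr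
    rcases Nat.lt_or_ge k (r + 1) with h1 | h1
    · omega
    · obtain rfl : k = r + 1 := by omega
      exact absurd hk.symm hi
  refine ⟨?_, ?_, ?_, ?_, ?_, ?_, ?_⟩
  · intro x y hx hy
    rcases hX' x with h1 | ⟨h1, -⟩
    · exact h.eq_none x y (h1 ▸ hx) hy
    · exact h.eq_none x y h1 hy
  · intro x y k hx hy
    exact h.eq_succ x y k (hlt x k hx (by have := hY y _ hy; omega)) hy
  · intro x y hx hy
    rcases hX' x with h1 | ⟨h1, -⟩
    · rw [h1] at hx
      have := (hX x _ hx).2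
      omega
    · exact h.eq_none x y h1 hy
  · intro hb x y k hy hx
    exact h.cw_zero hb x y k hy (hab x k hx)
  · intro hb x y k hx hk hy
    have hx' := hlt x k hx hk
    exact h.ccw_zero hb x y k hx' (hne k (hX x k hx').1 hk) hy
  · intro hb k hk hkr hki d hd hd0
    exact h.cw_surj hb k hk (hne k hki hkr) hki d hd fun x hx => hd0 x (hab' x k hkr hx)
  · intro hb k hk d hd hd0
    rcases Nat.lt_or_ge k (r + 1) with h1 | h1
    · refine h.ccw_inj hb k (by omega) d hd fun x hx => hd0 x ?_
      rcases hX' x with h2 | ⟨h2, -⟩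
      · rw [h2, hx]
      · rw [hx] at h2
        simp at h2
    · ext y
      refine hd y fun hy => ?_
      have := hY y _ hy
      omega

/-- This serves the arrow `[r+1]`, whose matrix is reduced in step `r + 1`. For `k ≤ r` the old
conditions persist because relabelling does not alter which labels exceed `k + 1`; for `k = r + 1`
they are the form just achieved, carried from `M` to `F` by `eq_none` and `eq_last`. -/
theorem EdgeInv.relabel_target (h : EdgeInv r i labX labY b F M) {labY' : Y → Option ℕ}
    {M' : X → Y → ℂ} (hY' : Refines (r + 2) labY labY') (hX : ∀ x k, labX x = some k → k ≤ r + 1)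
    (hY : ∀ y k, labY y = some k → k ≤ r + 1)
    (hM' : ∀ x y, (labX x = none ↔ labY' y = none) → M' x y = M x y)
    (hcw : b = true → (∀ x y, labX x = none → labY' y = some (r + 2) → M x y = 0) ∧
      ∀ d : Y → ℂ, (∀ y, labY' y ≠ none → d y = 0) →
        (∀ x, labX x = none → ∑ y, d y * M x y = 0) → d = 0)
    (hccw : b = false → (∀ x y, labX x = some (r + 1) → labY' y = none → M x y = 0) ∧
      ∀ d : Y → ℂ, (∀ y, labY' y ≠ some (r + 2) → d y = 0) →
        (∀ x, labX x = some (r + 1) → ∑ y, M x y * d y = 0) → d = 0) :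
    EdgeInv (r + 1) i labX labY' b F M' := by
  have hnone : ∀ y, labY' y = none → labY y = none := by
    intro y hy
    rcases hY' y with h1 | ⟨h1, -⟩
    · rw [← h1, hy]
    · exact h1
  have hlast : ∀ y, labY' y = some (r + 2) → labY y = none := by
    intro y hy
    rcases hY' y with h1 | ⟨h1, -⟩
    · rw [h1] at hy
      have := hY y _ hy
      omega
    · exact h1
  have hle : ∀ y k, labY' y = some k → k ≤ r + 2 := by
    intro y k hy
    rcases hY' y with h1 | ⟨-, h1⟩
    · rw [h1] at hy
      have := hY y _ hy
      omega
    · rw [hy] at h1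
      simp only [Option.some.injEq] at h1
      omega
  have hlt : ∀ y k, k ≤ r + 1 → (labY' y = some k ↔ labY y = some k) := by
    intro y k hk
    rcases hY' y with h1 | ⟨h1, h2⟩
    · rw [h1]
    · rw [h1, h2]
      simp only [Option.some.injEq, reduceCtorEq, iff_false]
      omega
  have hab : ∀ y k, Above k (labY' y) → Above k (labY y) := by
    intro x k hx
    rcases hY' x with h1 | ⟨h1, -⟩
    · rwa [← h1]
    · rw [h1]
      exact above_none k
  have hab' : ∀ y k, k ≤ r + 1 → Above k (labY y) → Above k (labY' y) := by
    intro x k hk hx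
    rcases hY' x with h1 | ⟨-, h1⟩
    · rwa [h1]
    · rw [h1, above_some]
      omega
  have htopY : ∀ y, Above (r + 2) (labY' y) → labY' y = none := by
    intro y hy
    rcases e : labY' y with _ | k
    · rfl
    · rw [e, above_some] at hy
      have := hle y k e
      omega
  have htopX : ∀ x, Above (r + 1) (labX x) → labX x = none := by
    intro x hx
    rcases e : labX x with _ | k
    · rfl
    · rw [e, above_some] at hx
      have := hX x k e
      omega
  refine ⟨?_, ?_, ?_, ?_, ?_, ?_, ?_⟩
  · intro x y hx hy
    rw [hM' x y (by simp [hx, hy])]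
    exact h.eq_none x y hx (hnone y hy)
  · intro x y k hx hy
    rw [hM' x y (by simp [hx, hy])]
    rcases Nat.lt_or_ge k (r + 1) with h1 | h1
    · exact h.eq_succ x y k hx ((hlt y _ (by omega)).1 hy)
    · obtain rfl : k = r + 1 := by have := hX x k hx; omega
      exact h.eq_last x y hx (hlast y hy)
  · intro x y hx hy
    have := hX x _ hx
    omega
  · intro hb x y k hy hx
    rcases Nat.lt_or_ge k (r + 1) with h1 | h1
    · exact h.cw_zero hb x y k ((hlt y _ (by omega)).1 hy) hx
    · obtain rfl : k = r + 1 := by have := hle y _ hy; omega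
      rw [← h.eq_none x y (htopX x hx) (hlast y hy)]
      exact (hcw hb).1 x y (htopX x hx) hy
  · intro hb x y k hx hk hy
    rcases Nat.lt_or_ge k (r + 1) with h1 | h1
    · exact h.ccw_zero hb x y k hx (by omega) (hab y _ hy)
    · obtain rfl : k = r + 1 := by omega
      rw [← h.eq_last x y hx (hnone y (htopY y hy))]
      exact (hccw hb).1 x y hx (htopY y hy)
  · intro hb k hk hkr hki d hd hd0
    rcases Nat.lt_or_ge k (r + 1) with h1 | h1
    · exact h.cw_surj hb k hk (by omega) hki d
        (fun y hy => hd y fun hy' => hy (hab y _ hy')) hd0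
    · obtain rfl : k = r + 1 := by omega
      have hd' : ∀ y, labY' y ≠ none → d y = 0 := fun y hy => hd y fun hy' => hy (htopY y hy')
      refine (hcw hb).2 d hd' fun x hx => ?_
      rw [← hd0 x (by rw [hx]; exact above_none _)]
      refine Finset.sum_congr rfl fun y _ => ?_
      by_cases hy : labY' y = none
      · rw [h.eq_none x y hx (hnone y hy)]
      · rw [hd' y hy, zero_mul, zero_mul]
  · intro hb k hk d hd hd0
    rcases Nat.lt_or_ge k (r + 1) with h1 | h1
    · exact h.ccw_inj hb k (by omega) d
        (fun y hy => hd y fun hy' => hy ((hlt y _ (by omega)).1 hy')) hd0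
    · obtain rfl : k = r + 1 := by omega
      refine (hccw hb).2 d hd fun x hx => ?_
      rw [← hd0 x hx]
      refine Finset.sum_congr rfl fun y _ => ?_
      by_cases hy : labY' y = some (r + 2)
      · rw [h.eq_last x y hx (hlast y hy)]
      · rw [hd y hy, mul_zero, mul_zero]

end CycleInv

/-! ### The form of a step, in terms of entries -/

section ShaveForm

variable {X Y : Type} {r : ℕ} {labX : X → Option ℕ} {labY : Y → Option ℕ}

/-- The dropped block always joins a labelled vector with an unlabelled one. -/
theorem ShaveForm.entry_eq : ∀ {b : Bool} {M M' : Edge b X Y}, ShaveForm r labX labY M M' →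
    ∀ x y, (labX x = none ↔ labY y = none) → M'.entry x y = M.entry x y
  | true, _, _, h, x, y, hxy => (h.2.2 y x).trans (if_neg fun hc => by
      have := hxy.2 hc.1
      rw [hc.2] at this
      simp at this)
  | false, _, _, h, x, y, hxy => (h.2.2 x y).trans (if_neg fun hc => by
      have := hxy.1 hc.1
      rw [hc.2] at this
      simp at this)

/-- Vectors with support conditions replace vectors on subtypes, so that strips can be compared and
refined without transporting index types. -/
theorem linearIndependent_sub_iff [Fintype Y] (D : Y → Prop) (C : X → Prop) (f : Y → X → ℂ) :
    LinearIndependent ℂ (fun (y : {y // D y}) (x : {x // C x}) => f y.1 x.1) ↔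
      ∀ d : Y → ℂ, (∀ y, ¬ D y → d y = 0) → (∀ x, C x → ∑ y, d y * f y x = 0) → d = 0 := by
  classical
  refine (linearIndependent_rows_iff_vecMul
    (M := Matrix.of fun (y : {y // D y}) (x : {x // C x}) => f y.1 x.1)).trans ?_
  constructor
  · intro h d hd hd0
    have := h (fun y => d y.1) (by
      ext x
      change ∑ y : {y // D y}, d y.1 * f y.1 x.1 = 0
      rw [sum_subtype_of_support D (fun y => d y * f y x.1) fun y hy => by rw [hd y hy, zero_mul]]
      exact hd0 x.1 x.2)
    ext y
    by_cases hy : D y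
    · exact congrFun this ⟨y, hy⟩
    · exact hd y hy
  · intro h c hc
    have := h (fun y => if hy : D y then c ⟨y, hy⟩ else 0) (fun y hy => by simp [hy]) (by
      intro x hx
      have e := congrFun hc ⟨x, hx⟩
      simp only [Matrix.vecMul, dotProduct, Matrix.of_apply, Pi.zero_apply] at e
      rw [← sum_subtype_of_support D _ (fun y hy => by simp [hy]), ← e]
      exact Finset.sum_congr rfl fun y _ => by rw [dif_pos y.2])
    ext y
    simpa [y.2] using congrFun this y.1

theorem shaveForm_true_iff [Fintype Y] {M M' : Edge true X Y} : ShaveForm r labX labY M M' ↔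
    (∀ x y, labX x = none → labY y = some (r + 1) → M.entry x y = 0) ∧
    (∀ d : Y → ℂ, (∀ y, labY y ≠ none → d y = 0) →
        (∀ x, labX x = none → ∑ y, d y * M.entry x y = 0) → d = 0) ∧
    ∀ x y, M'.entry x y = if labY y = none ∧ labX x = some r then 0 else M.entry x y := by
  rw [ShaveForm, linearIndependent_sub_iff (fun y => labY y = none) (fun x => labX x = none) M.fwd]
  exact ⟨fun h => ⟨fun x y hx hy => h.1 y x hy hx, h.2.1, fun x y => h.2.2 y x⟩,
    fun h => ⟨fun y x hy hx => h.1 x y hx hy, h.2.1, fun y x => h.2.2 x y⟩⟩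

theorem shaveForm_false_iff [Fintype Y] {M M' : Edge false X Y} : ShaveForm r labX labY M M' ↔
    (∀ x y, labX x = some r → labY y = none → M.entry x y = 0) ∧
    (∀ d : Y → ℂ, (∀ y, labY y ≠ some (r + 1) → d y = 0) →
        (∀ x, labX x = some r → ∑ y, M.entry x y * d y = 0) → d = 0) ∧
    ∀ x y, M'.entry x y = if labX x = none ∧ labY y = some (r + 1) then 0 else M.entry x y := by
  rw [ShaveForm, linearIndependent_sub_iff (fun y => labY y = some (r + 1))
    (fun x => labX x = some r) fun y x => M.bwd x y]
  refine and_congr Iff.rfl (and_congr ?_ Iff.rfl)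
  simp only [mul_comm]
  rfl

theorem ShaveForm.of_true [Fintype Y] : ∀ {b : Bool} {M M' : Edge b X Y},
    ShaveForm r labX labY M M' → b = true →
      (∀ x y, labX x = none → labY y = some (r + 1) → M.entry x y = 0) ∧
      ∀ d : Y → ℂ, (∀ y, labY y ≠ none → d y = 0) →
        (∀ x, labX x = none → ∑ y, d y * M.entry x y = 0) → d = 0
  | true, _, _, h, _ => ⟨(shaveForm_true_iff.1 h).1, (shaveForm_true_iff.1 h).2.1⟩

theorem ShaveForm.of_false [Fintype Y] : ∀ {b : Bool} {M M' : Edge b X Y},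
    ShaveForm r labX labY M M' → b = false →
      (∀ x y, labX x = some r → labY y = none → M.entry x y = 0) ∧
      ∀ d : Y → ℂ, (∀ y, labY y ≠ some (r + 1) → d y = 0) →
        (∀ x, labX x = some r → ∑ y, M.entry x y * d y = 0) → d = 0
  | false, _, _, h, _ => ⟨(shaveForm_false_iff.1 h).1, (shaveForm_false_iff.1 h).2.1⟩

end ShaveForm

end QuiverCycle

namespace QuiverCycle

/-! ### The invariants along a run -/

section CycleRun

variable {t : ℕ} {o : ZMod t → Bool}

/-- The representation with the spaces of `A` and given matrices. -/
def CycleRep.withMat (A : CycleRep o) (F : ∀ i, Edge (o i) (A.idx i) (A.idx (i + 1))) :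
    CycleRep o where
  idx := A.idx
  mat := F

/-- The invariants of the algorithm for cycles after step `r`, where `F` is obtained from `A` by
the unitary transformations made so far. -/
structure CycleInv (A : CycleRep o) (l r : ℕ) (s : CycleState A)
    (F : ∀ i, Edge (o i) (A.idx i) (A.idx (i + 1))) : Prop where
  iso : A.Iso (A.withMat F)
  lab : ∀ v x k, s.lab v x = some k → vtx t k = v ∧ l + 1 ≤ k ∧ k ≤ r + 1
  edge : ∀ i, EdgeInv r i (s.lab i) (s.lab (i + 1)) (o i) (F i).entry (s.mat i).entry

theorem add_one_ne_self (ht : 2 ≤ t) (v : ZMod t) : v + 1 ≠ v := by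
  have : Fact (1 < t) := ⟨ht⟩
  simp

theorem rowCond_iff {X Y : Type} [Fintype Y] : ∀ {b : Bool} (M : Edge b X Y),
    M.RowCond ↔ (b = true → ∀ d : Y → ℂ, (∀ x, ∑ y, d y * M.entry x y = 0) → d = 0)
  | true, M => by
    simp only [forall_const]
    refine (linearIndependent_rows_iff_vecMul (M := M.fwd)).trans (forall_congr' fun c => ?_)
    exact imp_congr_left ⟨fun h x => congrFun h x, fun h => funext h⟩
  | false, M => by simp [Edge.RowCond]

/-- The first `l` steps change nothing, so `A` itself counts as the state after step `l` of a run
whose first bad arrow is `l + 1`. Minimality of that arrow is precisely `cw_surj` for `k ≤ l`. -/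
theorem CycleInv.init (A : CycleRep o) (l : ℕ)
    (h : ∀ k, 1 ≤ k → k < l + 1 → (A.mat (vtx t k)).RowCond) :
    CycleInv A (l + 1) l (CycleState.init A) A.mat where
  iso := CycleRep.Iso.refl A
  lab v x k hk := by simp [CycleState.init] at hk
  edge i :=
    { eq_none := fun _ _ _ _ => rfl
      eq_succ := fun _ _ _ _ _ => rfl
      eq_last := fun _ _ _ _ => rfl
      cw_zero := fun _ x y k hy _ => by simp [CycleState.init] at hy
      ccw_zero := fun _ x y k hx _ _ => by simp [CycleState.init] at hx
      cw_surj := by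
        rintro hb k hk hkl rfl d - hd
        exact (rowCond_iff _).1 (h k hk (by omega)) hb d fun x => hd x (above_none _)
      ccw_inj := fun _ k _ d hd _ => funext fun y => hd y (by simp [CycleState.init]) }

/-- `F` and the current matrices undergo the same base change at `[r+2]`. Afterwards the arrow
`[r+1]` is handled by `relabel_target` and every other arrow by `relabel_source`. -/
theorem CycleInv.step (ht : 2 ≤ t) {A : CycleRep o} {l r : ℕ} (hlr : l ≤ r + 1)
    {s s' : CycleState A} {F : ∀ i, Edge (o i) (A.idx i) (A.idx (i + 1))}
    (h : CycleInv A l r s F) (hs : CycleStep A (r + 1) s s') : ∃ F', CycleInv A l (r + 1) s' F' := by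
  obtain ⟨U, hU, hlab, hlab1, hlab2, hform, hmat, hmat'⟩ := hs
  -- Since `t ≥ 2` there are no loops, so the split vertex is only one end of the reduced arrow.
  have hv : vtx t (r + 1) + 1 ≠ vtx t (r + 1) := add_one_ne_self ht _
  let W : ∀ v, Matrix.unitaryGroup (A.idx v) ℂ := Function.update (fun _ => 1) (vtx t (r + 1) + 1) U
  have hW : W (vtx t (r + 1) + 1) = U := Function.update_self _ _ _
  have hW1 : ∀ v, v ≠ vtx t (r + 1) + 1 → W v = 1 := fun v hv => Function.update_of_ne hv _ _
  have hfix : ∀ v, Fixes (s.lab v) (W v : Matrix (A.idx v) (A.idx v) ℂ) := by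
    intro v
    by_cases hv : v = vtx t (r + 1) + 1
    · subst hv
      rw [hW]
      exact hU
    · rw [hW1 v hv]
      exact Fixes.one _
  have hrefine : ∀ v, Refines (r + 2) (s.lab v) (s'.lab v) := by
    intro v x
    by_cases hv : v = vtx t (r + 1) + 1
    · subst hv
      by_cases hx : s.lab _ x = none
      · rcases hlab2 x hx with h1 | h1
        · exact Or.inl (h1.trans hx.symm)
        · exact Or.inr ⟨hx, h1⟩
      · exact Or.inl (hlab1 x hx)
    · exact Or.inl (congrFun (hlab v hv) x)
  refine ⟨fun i => Edge.act (W i) (W (i + 1)) (F i), ?_, ?_, ?_⟩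
  · exact h.iso.trans ⟨fun v => (W v : Matrix (A.idx v) (A.idx v) ℂ),
      fun v => Nonsingular.unitary (W v), fun i => Edge.intertwines_act (W i) (W (i + 1)) (F i)⟩
  · intro v x k hk
    by_cases hv : v = vtx t (r + 1) + 1
    · subst hv
      rcases hrefine _ x with h1 | ⟨-, h1⟩
      · rw [h1] at hk
        have := h.lab _ x k hk
        exact ⟨this.1, by omega, by omega⟩
      · rw [hk] at h1
        simp only [Option.some.injEq] at h1
        subst h1
        exact ⟨rfl, by omega, by omega⟩
    · rw [hlab v hv] at hk
      have := h.lab _ x k hk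
      exact ⟨this.1, by omega, by omega⟩
  · intro i
    obtain ⟨P, Q, hP, hQ, hfP, hfQ, hact⟩ := Edge.exists_act_eq_transform (W i) (W (i + 1))
      (hfix i) (hfix (i + 1)) (o i)
    have hE := (h.edge i).transform hfP hfQ hP hQ
    have e1 : (Edge.act (W i) (W (i + 1)) (F i)).entry = transform P Q (F i).entry :=
      funext fun x => funext fun y => hact _ x y
    have e2 : (Edge.act (W i) (W (i + 1)) (s.mat i)).entry = transform P Q (s.mat i).entry :=
      funext fun x => funext fun y => hact _ x y
    rw [← e1, ← e2] at hE
    by_cases hi : i = vtx t (r + 1)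
    · subst hi
      have e3 : Edge.act (W (vtx t (r + 1))) (W (vtx t (r + 1) + 1)) (s.mat (vtx t (r + 1))) =
          Edge.act 1 U (s.mat (vtx t (r + 1))) := by
        rw [hW, hW1 _ hv.symm]
      have e4 : s'.lab (vtx t (r + 1)) = s.lab (vtx t (r + 1)) := hlab _ hv.symm
      rw [e4]
      rw [← e3] at hform
      exact hE.relabel_target (hrefine _) (fun x k hk => (h.lab _ x k hk).2.2)
        (fun x k hk => (h.lab _ x k hk).2.2) hform.entry_eq hform.of_true hform.of_false
    · have e3 : s'.mat i = Edge.act (W i) (W (i + 1)) (s.mat i) := by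
        have hi' : i + 1 ≠ vtx t (r + 1) + 1 := fun hc => hi (add_right_cancel hc)
        rw [hW1 _ hi']
        by_cases hi2 : i = vtx t (r + 1) + 1
        · subst hi2
          rw [hW, hmat]
        · rw [hW1 _ hi2, hmat' i hi hi2, Edge.act_one_one]
      have e4 : s'.lab (i + 1) = s.lab (i + 1) := hlab _ fun hc => hi (add_right_cancel hc)
      rw [e3, e4]
      exact hE.relabel_source (hrefine _)
        (fun x k hk => ⟨(h.lab _ x k hk).1, (h.lab _ x k hk).2.2⟩)
        (fun x k hk => (h.lab _ x k hk).2.2) hi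

theorem CycleReach.le {A : CycleRep o} {l r : ℕ} {s : CycleState A} (h : CycleReach A l r s) :
    l ≤ r := by
  induction h with
  | first => exact le_rfl
  | next => omega

theorem CycleReach.exists_inv (ht : 2 ≤ t) {A : CycleRep o} {l r : ℕ} {s : CycleState A}
    (hl : FirstBad A l) (h : CycleReach A l r s) : ∃ F, CycleInv A l r s F := by
  induction h with
  | first s hs =>
    obtain ⟨h1, -, -, h2⟩ := hl
    obtain ⟨l, rfl⟩ : ∃ l', l = l' + 1 := ⟨l - 1, by omega⟩
    exact (CycleInv.init A l h2).step ht le_rfl hs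
  | next r s s' hr _ hs ih =>
    obtain ⟨F, hF⟩ := ih
    exact hF.step ht (by have := hr.le; omega) hs

/-! ### Termination -/

theorem CycleStep.lab_mono {A : CycleRep o} {r : ℕ} {s s' : CycleState A}
    (hs : CycleStep A r s s') {v : ZMod t} {x : A.idx v} {k : ℕ} (hk : s.lab v x = some k) :
    s'.lab v x = some k := by
  obtain ⟨U, -, hlab, hlab1, -⟩ := hs
  by_cases hv : v = vtx t r + 1
  · subst hv
    rw [hlab1 x (by simp [hk]), hk]
  · rw [hlab v hv, hk]

/-- If the run did not stop after step `j ≥ t`, some entry between `(j+1)'` and `[j+2]` was nonzero,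
so the vertex `(j+1)'` is not zero; labels are never withdrawn later. -/
theorem CycleReach.exists_lab {A : CycleRep o} {l r : ℕ} {s : CycleState A} (hl : l ≤ t)
    (h : CycleReach A l r s) (j : ℕ) (hj : t ≤ j) (hjr : j < r) :
    ∃ (v : ZMod t) (x : A.idx v), s.lab v x = some (j + 1) := by
  induction h with
  | first => omega
  | next r s s' hr hfinal hs ih =>
    rcases Nat.lt_or_ge j r with h1 | h1
    · obtain ⟨v, x, hx⟩ := ih h1
      exact ⟨v, x, hs.lab_mono hx⟩
    · obtain rfl : j = r := by omega
      simp only [CycleStops, not_and, not_forall] at hfinal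
      obtain ⟨x, y, hx, -⟩ := hfinal hj
      exact ⟨_, x, hs.lab_mono hx⟩

theorem CycleReach.le_bound {A : CycleRep o} [Fintype (Σ v, A.idx v)] {l r : ℕ} {s : CycleState A}
    (hl : l ≤ t) (h : CycleReach A l r s) : r ≤ t + Fintype.card (Σ v, A.idx v) := by
  have hex : ∀ j : Fin (r - t), ∃ p : Σ v, A.idx v, s.lab p.1 p.2 = some (t + j + 1) := by
    intro j
    obtain ⟨v, x, hx⟩ := h.exists_lab hl (t + j) (by omega) (by omega)
    exact ⟨⟨v, x⟩, hx⟩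
  choose f hf using hex
  have hinj : Function.Injective f := by
    intro j j' hjj
    have h1 := hf j
    have h2 := hf j'
    rw [hjj, h2] at h1
    simp only [Option.some.injEq] at h1
    exact Fin.ext (by omega)
  have := Fintype.card_le_of_injective f hinj
  simp only [Fintype.card_fin] at this
  omega

end CycleRun

end QuiverCycle

namespace QuiverCycle

/-! ### Steps of the algorithm for cycles exist -/

section CycleStepExists

/-- A unitary transformation of a part of a space extends to the space. -/
theorem exists_unitary_extend {Y : Type} [Fintype Y] [DecidableEq Y] (g : Y → Bool)
    (U₀ : Matrix.unitaryGroup {y // g y = true} ℂ) :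
    ∃ U : Matrix.unitaryGroup Y ℂ,
      (∀ y y' : {y // g y = true}, (U : Matrix Y Y ℂ) y y' = (U₀ : Matrix _ _ ℂ) y y') ∧
      ∀ y y', g y = false ∨ g y' = false → (U : Matrix Y Y ℂ) y y' = (1 : Matrix Y Y ℂ) y y' := by
  obtain ⟨U, h1, h2⟩ := exists_unitary_glue g
    (fun p => match p with
      | true => U₀
      | false => 1)
  refine ⟨U, h2 true, fun y y' hy => ?_⟩
  by_cases hyy : g y = g y'
  · have hy1 : g y = false := by
      rcases hy with hy | hy
      · exact hy
      · exact hyy.trans hy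
    rw [h2 false ⟨y, hy1⟩ ⟨y', hyy.symm.trans hy1⟩]
    simp [Matrix.one_apply]
  · rw [h1 y y' hyy, Matrix.one_apply_ne]
    rintro rfl
    exact hyy rfl

variable {X Y : Type} [Fintype X] [DecidableEq X] [Fintype Y] [DecidableEq Y]

/-- The transformation acts on the unlabelled part of `Y` only. Clockwise, the rows that vanish on
the unlabelled columns receive the new label; counterclockwise, it is the nonvanishing, independent
columns that receive it. Freshness of `r + 1` ensures that the conditions on this label concern new
vectors only. -/
theorem exists_shaveForm (r : ℕ) (labX : X → Option ℕ) (labY : Y → Option ℕ)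
    (hY : ∀ y, labY y ≠ some (r + 1)) : ∀ {b : Bool} (M : Edge b X Y),
    ∃ (U : Matrix.unitaryGroup Y ℂ) (labY' : Y → Option ℕ) (M' : Edge b X Y),
      Fixes labY (U : Matrix Y Y ℂ) ∧ Refines (r + 1) labY labY' ∧
      ShaveForm r labX labY' (Edge.act 1 U M) M'
  | true, M => by
    classical
    let g : Y → Bool := fun y => (labY y).isNone
    have hg : ∀ y, g y = true ↔ labY y = none := fun y => Option.isNone_iff_eq_none
    obtain ⟨U₀, q, hq, hq'⟩ := exists_unitary_rows
      (Matrix.of fun (y : {y // g y = true}) (x : {x // labX x = none}) => M.entry x.1 y.1)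
    obtain ⟨U, hU, hU'⟩ := exists_unitary_extend g U₀
    have hact : ∀ (x : {x // labX x = none}) (y : {y // g y = true}),
        (Edge.act 1 U M).entry x.1 y.1 = ((U₀ : Matrix {y // g y = true} {y // g y = true} ℂ) *
          Matrix.of fun (y : {y // g y = true}) (x : {x // labX x = none}) => M.entry x.1 y.1)
            y x := by
      intro x y
      have e : (Edge.act 1 U M).entry x.1 y.1 = ∑ y', (U : Matrix Y Y ℂ) y.1 y' * M.entry x.1 y' := by
        change ((U : Matrix Y Y ℂ) * M.fwd *
          ((1⁻¹ : Matrix.unitaryGroup X ℂ) : Matrix X X ℂ)) y.1 x.1 = _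
        rw [inv_one, OneMemClass.coe_one, Matrix.mul_one, Matrix.mul_apply]
        rfl
      rw [e, Matrix.mul_apply, ← sum_subtype_of_support (fun y' => g y' = true)]
      · simp only [hU, Matrix.of_apply]
      · intro y' hy'
        rw [hU' _ _ (Or.inr (by simpa using hy')), Matrix.one_apply_ne, zero_mul]
        rintro rfl
        exact hy' y.2
    let labY' : Y → Option ℕ := fun y =>
      if h : g y = true then (if ⟨y, h⟩ ∈ q then some (r + 1) else none) else labY y
    refine ⟨U, labY', Edge.ofEntry true fun x y =>
      -- The block `*` from `r'` to the remaining vertex is dropped.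
      if labY' y = none ∧ labX x = some r then 0 else (Edge.act 1 U M).entry x y, ?_, ?_, ?_⟩
    · intro y y' h
      exact hU' y y' (h.imp (fun h => by simpa [← hg] using h) fun h => by simpa [← hg] using h)
    · intro y
      by_cases h : g y = true
      · by_cases hyq : (⟨y, h⟩ : {y // g y = true}) ∈ q
        · exact Or.inr ⟨(hg y).1 h, by simp [labY', h, hyq]⟩
        · exact Or.inl (by simp [labY', h, hyq, (hg y).1 h])
      · exact Or.inl (by simp [labY', h])
    · refine shaveForm_true_iff.2 ⟨fun x y hx hy => ?_, fun d hd hd0 => ?_, fun x y =>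
        Edge.entry_ofEntry _ _ _ _⟩
      · by_cases h : g y = true
        · by_cases hyq : (⟨y, h⟩ : {y // g y = true}) ∈ q
          · rw [hact ⟨x, hx⟩ ⟨y, h⟩]
            exact hq _ hyq _
          · simp [labY', h, hyq] at hy
        · simp only [labY', h] at hy
          exact absurd hy (hY y)
      · have hdg : ∀ y, g y ≠ true → d y = 0 := fun y hy => hd y (by
          have := mt (hg y).2 hy
          simpa [labY', hy] using this)
        have := hq' (fun y => d y.1) (fun y hy => hd _ (by
          have h := y.2
          simp [labY', h, hy])) (by
          ext x
          change ∑ y : {y // g y = true}, d y.1 * _ = 0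
          rw [← hd0 x.1 x.2, ← sum_subtype_of_support (fun y => g y = true) _
            (fun y hy => by rw [hdg y hy, zero_mul])]
          exact Finset.sum_congr rfl fun y _ => by rw [hact x y])
        ext y
        by_cases h : g y = true
        · exact congrFun this ⟨y, h⟩
        · exact hdg y h
  | false, M => by
    classical
    let g : Y → Bool := fun y => (labY y).isNone
    have hg : ∀ y, g y = true ↔ labY y = none := fun y => Option.isNone_iff_eq_none
    obtain ⟨U₀, q, hq, hq'⟩ := exists_unitary_cols
      (Matrix.of fun (x : {x // labX x = some r}) (y : {y // g y = true}) => M.entry x.1 y.1)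
    obtain ⟨U, hU, hU'⟩ := exists_unitary_extend g U₀
    have hact : ∀ (x : {x // labX x = some r}) (y : {y // g y = true}),
        (Edge.act 1 U M).entry x.1 y.1 = ((Matrix.of fun (x : {x // labX x = some r})
          (y : {y // g y = true}) => M.entry x.1 y.1) *
            ((U₀⁻¹ : Matrix.unitaryGroup {y // g y = true} ℂ) :
              Matrix {y // g y = true} {y // g y = true} ℂ)) x y := by
      intro x y
      have e : (Edge.act 1 U M).entry x.1 y.1 =
          ∑ y', M.entry x.1 y' * star ((U : Matrix Y Y ℂ) y.1 y') := by
        change ((1 : Matrix X X ℂ) * M.bwd *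
          ((U⁻¹ : Matrix.unitaryGroup Y ℂ) : Matrix Y Y ℂ)) x.1 y.1 = _
        simp only [Matrix.one_mul, Matrix.mul_apply]
        rfl
      rw [e, Matrix.mul_apply, ← sum_subtype_of_support (fun y' => g y' = true)]
      · simp only [hU, Matrix.of_apply]
        rfl
      · intro y' hy'
        rw [hU' _ _ (Or.inr (by simpa using hy')), Matrix.one_apply_ne, star_zero, mul_zero]
        rintro rfl
        exact hy' y.2
    let labY' : Y → Option ℕ := fun y =>
      if h : g y = true then (if ⟨y, h⟩ ∈ q then none else some (r + 1)) else labY y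
    refine ⟨U, labY', Edge.ofEntry false fun x y =>
      if labX x = none ∧ labY' y = some (r + 1) then 0 else (Edge.act 1 U M).entry x y, ?_, ?_, ?_⟩
    · intro y y' h
      exact hU' y y' (h.imp (fun h => by simpa [← hg] using h) fun h => by simpa [← hg] using h)
    · intro y
      by_cases h : g y = true
      · by_cases hyq : (⟨y, h⟩ : {y // g y = true}) ∈ q
        · exact Or.inl (by simp [labY', h, hyq, (hg y).1 h])
        · exact Or.inr ⟨(hg y).1 h, by simp [labY', h, hyq]⟩
      · exact Or.inl (by simp [labY', h])
    · refine shaveForm_false_iff.2 ⟨fun x y hx hy => ?_, fun d hd hd0 => ?_, fun x y =>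
        Edge.entry_ofEntry _ _ _ _⟩
      · by_cases h : g y = true
        · by_cases hyq : (⟨y, h⟩ : {y // g y = true}) ∈ q
          · rw [hact ⟨x, hx⟩ ⟨y, h⟩]
            exact hq _ hyq _
          · simp [labY', h, hyq] at hy
        · simp only [labY', h] at hy
          exact absurd ((hg y).2 hy) h
      · have hdg : ∀ y, g y ≠ true → d y = 0 := fun y hy => hd y (by
          simpa [labY', hy] using hY y)
        have := hq' (fun y => d y.1) (fun y hy => hd _ (by
          have h := y.2
          simp [labY', h, hy])) (by
          ext x
          change ∑ y : {y // g y = true}, _ * d y.1 = 0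
          rw [← hd0 x.1 x.2, ← sum_subtype_of_support (fun y => g y = true) _
            (fun y hy => by rw [hdg y hy, mul_zero])]
          exact Finset.sum_congr rfl fun y _ => by rw [hact x y])
        ext y
        by_cases h : g y = true
        · exact congrFun this ⟨y, h⟩
        · exact hdg y h

theorem exists_cycleStep {t : ℕ} (ht : 2 ≤ t) {o : ZMod t → Bool} (A : CycleRep o) (r : ℕ)
    (s : CycleState A) (hs : ∀ v x, s.lab v x ≠ some (r + 1)) : ∃ s', CycleStep A r s s' := by
  obtain ⟨U, lab', M', h1, h2, h3⟩ := exists_shaveForm r (s.lab (vtx t r)) (s.lab (vtx t r + 1))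
    (hs _) (s.mat (vtx t r))
  have hv : vtx t r + 1 ≠ vtx t r := add_one_ne_self ht _
  refine ⟨⟨Function.update (Function.update s.mat (vtx t r) M') (vtx t r + 1)
    (Edge.act U 1 (s.mat (vtx t r + 1))), Function.update s.lab (vtx t r + 1) lab'⟩,
    U, h1, fun v hv => Function.update_of_ne hv _ _, ?_, ?_, ?_, ?_, ?_⟩
  · intro x hx
    simp only [Function.update_self]
    exact (h2 x).resolve_right fun h => hx h.1
  · intro x hx
    simp only [Function.update_self]
    exact (h2 x).imp (fun h => h.trans hx) fun h => h.2
  · simp only [Function.update_self, Function.update_of_ne hv.symm]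
    exact h3
  · exact Function.update_self _ _ _
  · intro j hj hj'
    simp only [Function.update_of_ne hj', Function.update_of_ne hj]

end CycleStepExists

/-! ### Every run of the algorithm for cycles can be continued until it stops -/

section CycleWorks

variable {t : ℕ} {o : ZMod t → Bool}

theorem exists_vtx_eq (ht : 2 ≤ t) (n : ℕ) (hn : t ≤ n) (i : ZMod t) :
    ∃ k, 1 ≤ k ∧ k ≤ n ∧ n < k + t ∧ vtx t k = i := by
  have : NeZero t := ⟨by omega⟩
  -- The largest `k ≤ n` over `i`: go back from `n` by the residue of `n - i`, which is less than
  -- `t`.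
  refine ⟨n - ((n : ZMod t) - i).val, ?_, ?_, ?_, ?_⟩
  · have := ZMod.val_lt ((n : ZMod t) - i)
    omega
  · omega
  · have := ZMod.val_lt ((n : ZMod t) - i)
    omega
  · have := ZMod.val_lt ((n : ZMod t) - i)
    rw [vtx_eq_cast, Nat.cast_sub (by omega), ZMod.natCast_zmod_val]
    ring

theorem exists_firstBad (ht : 2 ≤ t) (A : CycleRep o) (h : ¬ ∀ i, (A.mat i).RowCond) :
    ∃ l, FirstBad A l := by
  classical
  push Not at h
  obtain ⟨i, hi⟩ := h
  obtain ⟨k, hk1, hkt, -, rfl⟩ := exists_vtx_eq ht t le_rfl i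
  have hex : ∃ l, 1 ≤ l ∧ ¬ (A.mat (vtx t l)).RowCond := ⟨k, hk1, hi⟩
  refine ⟨Nat.find hex, (Nat.find_spec hex).1, (Nat.find_min' hex ⟨hk1, hi⟩).trans hkt,
    (Nat.find_spec hex).2, fun i hi1 hil => ?_⟩
  by_contra hc
  exact Nat.find_min hex hil ⟨hi1, hc⟩

theorem cycleAlgorithmWorks (ht : 2 ≤ t) (A : CycleRep o) : CycleAlgorithmWorks A := by
  have : NeZero t := ⟨by omega⟩
  have hfirst : ∀ l, ∃ s, CycleStep A l (CycleState.init A) s := fun l =>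
    exists_cycleStep ht A l _ fun v x => by simp [CycleState.init]
  have hnext : ∀ l, FirstBad A l → ∀ r s, CycleReach A l r s → ∃ s', CycleStep A (r + 1) s s' := by
    intro l hl r s hs
    obtain ⟨F, hF⟩ := hs.exists_inv ht hl
    refine exists_cycleStep ht A (r + 1) s fun v x hx => ?_
    have := (hF.lab v x _ hx).2.2
    omega
  have hbound : ∀ l, FirstBad A l → ∀ r s, CycleReach A l r s →
      r ≤ t + Fintype.card (Σ v, A.idx v) := fun l hl r s hs => hs.le_bound hl.2.1
  refine ⟨fun l hl => ⟨hfirst l, fun r s hs _ => hnext l hl r s hs, _, hbound l hl⟩, ?_⟩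
  by_cases h : ∀ i, (A.mat i).RowCond
  · exact ⟨_, CycleAlgorithm.trivial h⟩
  · obtain ⟨l, hl⟩ := exists_firstBad ht A h
    suffices hfinal : ∃ n s, CycleReach A l n s ∧ CycleStops A n s by
      obtain ⟨n, s, h1, h2⟩ := hfinal
      exact ⟨_, CycleAlgorithm.shave l n s hl h1 h2⟩
    by_contra! hc
    -- If no reachable state stopped, runs of every length would exist, against the bound.
    have hall : ∀ m, ∃ s, CycleReach A l (l + m) s := by
      intro m
      induction m with
      | zero =>
        obtain ⟨s, hs⟩ := hfirst l
        exact ⟨s, CycleReach.first s hs⟩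
      | succ m ih =>
        obtain ⟨s, hs⟩ := ih
        obtain ⟨s', hs'⟩ := hnext l hl _ s hs
        exact ⟨s', CycleReach.next _ s s' hs (hc _ s hs) hs'⟩
    obtain ⟨s, hs⟩ := hall (t + Fintype.card (Σ v, A.idx v) + 1)
    have := hbound l hl _ s hs
    omega

end CycleWorks

end QuiverCycle

namespace QuiverCycle

/-! ### Splitting off the shaved chain -/

section Graded

variable {t : ℕ} {o : ZMod t → Bool}

/-- The final form of the invariants, after the algorithm has stopped in step `n`. -/
structure FinalInv (A : CycleRep o) (l n : ℕ) (lab : ∀ v, A.idx v → Option ℕ)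
    (F : ∀ i, Edge (o i) (A.idx i) (A.idx (i + 1))) : Prop where
  lab_spec : ∀ v x k, lab v x = some k → vtx t k = v ∧ l + 1 ≤ k ∧ k ≤ n + 1
  cw_zero : ∀ i, o i = true → ∀ x y k, lab (i + 1) y = some (k + 1) → Above k (lab i x) →
    (F i).entry x y = 0
  cw_last : ∀ i, o i = true → ∀ x y, lab i x = some (n + 1) → (F i).entry x y = 0
  ccw_zero : ∀ i, o i = false → ∀ x y k, lab i x = some k → Above (k + 1) (lab (i + 1) y) →
    (F i).entry x y = 0
  cw_surj : ∀ i, o i = true → ∀ k, 1 ≤ k → k ≤ n → vtx t k = i → ∀ d : A.idx (i + 1) → ℂ,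
    (∀ y, ¬ Above (k + 1) (lab (i + 1) y) → d y = 0) →
    (∀ x, Above k (lab i x) → ∑ y, d y * (F i).entry x y = 0) → d = 0
  ccw_inj : ∀ i, o i = false → ∀ k, k ≤ n → ∀ d : A.idx (i + 1) → ℂ,
    (∀ y, lab (i + 1) y ≠ some (k + 1) → d y = 0) →
    (∀ x, lab i x = some k → ∑ y, (F i).entry x y * d y = 0) → d = 0

/-- The only block left unconstrained by the invariants and not part of the result is the one
between `(n+1)'` and `[n+2]`, and the stopping condition makes it zero. This yields `cw_last` and
the case `k = n + 1` of `ccw_zero`. -/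
theorem CycleInv.final {A : CycleRep o} {l n : ℕ} {s : CycleState A}
    {F : ∀ i, Edge (o i) (A.idx i) (A.idx (i + 1))} (h : CycleInv A l n s F)
    (hfinal : CycleStops A n s) : FinalInv A l n s.lab F := by
  have hlast : ∀ i x y, s.lab i x = some (n + 1) → s.lab (i + 1) y = none →
      (F i).entry x y = 0 := by
    intro i x y hx hy
    rw [← (h.edge i).eq_last x y hx hy]
    obtain ⟨rfl, -⟩ := h.lab i x _ hx
    exact hfinal.2 x y hx hy
  have hpos : ∀ v x k, s.lab v x = some k → ∃ j, k = j + 1 ∧ j < n + 1 := by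
    intro v x k hk
    have := h.lab v x k hk
    exact ⟨k - 1, by omega, by omega⟩
  refine ⟨h.lab, fun i => (h.edge i).cw_zero, ?_, ?_, fun i => (h.edge i).cw_surj,
    fun i => (h.edge i).ccw_inj⟩
  · intro i hi x y hx
    rcases hy : s.lab (i + 1) y with _ | k
    · exact hlast i x y hx hy
    · obtain ⟨j, rfl, hj⟩ := hpos _ _ _ hy
      exact (h.edge i).cw_zero hi x y j hy (by rw [hx, above_some]; exact hj)
  · intro i hi x y k hx hy
    rcases Nat.lt_or_ge n k with hk | hk
    · obtain rfl : k = n + 1 := by have := h.lab i x k hx; omega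
      refine hlast i x y hx ?_
      rcases hy' : s.lab (i + 1) y with _ | j
      · rfl
      · rw [hy', above_some] at hy
        have := h.lab _ y j hy'
        omega
    · exact (h.edge i).ccw_zero hi x y k hx hk hy

/-- The blocks of `F` between `k'` and `(k+1)'` and between the vertices of the cycle. -/
def gradedMat {A : CycleRep o} (lab : ∀ v, A.idx v → Option ℕ)
    (F : ∀ i, Edge (o i) (A.idx i) (A.idx (i + 1))) (i : ZMod t) :
    Edge (o i) (A.idx i) (A.idx (i + 1)) :=
  Edge.ofEntry (o i) fun x y =>
    if lab (i + 1) y = (lab i x).map (· + 1) then (F i).entry x y else 0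

theorem entry_gradedMat {A : CycleRep o} (lab : ∀ v, A.idx v → Option ℕ)
    (F : ∀ i, Edge (o i) (A.idx i) (A.idx (i + 1))) (i : ZMod t) (x : A.idx i)
    (y : A.idx (i + 1)) : (gradedMat lab F i).entry x y =
      if lab (i + 1) y = (lab i x).map (· + 1) then (F i).entry x y else 0 :=
  Edge.entry_ofEntry _ _ _ _

/-! ### Splitting the filtration by labels -/

namespace FinalInv

variable {A : CycleRep o} {l n : ℕ} {lab : ∀ v, A.idx v → Option ℕ}
  {F : ∀ i, Edge (o i) (A.idx i) (A.idx (i + 1))}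

/-- `S` differs from the identity only in the columns with a label, where it adds vectors with
greater labels. -/
def Unitriangular (lab : ∀ v, A.idx v → Option ℕ)
    (S : ∀ v, Matrix (A.idx v) (A.idx v) ℂ) : Prop :=
  ∀ v z x, ¬ (∃ k, lab v x = some k ∧ Above k (lab v z)) →
    S v z x = (1 : Matrix (A.idx v) (A.idx v) ℂ) z x

theorem Unitriangular.apply_some {S : ∀ v, Matrix (A.idx v) (A.idx v) ℂ}
    (hS : Unitriangular lab S) {v : ZMod t} {x z : A.idx v} {k : ℕ} (hx : lab v x = some k)
    (hz : ¬ Above k (lab v z)) : S v z x = (1 : Matrix (A.idx v) (A.idx v) ℂ) z x := by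
  refine hS v z x ?_
  rintro ⟨j, hj, h⟩
  rw [hx, Option.some.injEq] at hj
  subst hj
  exact hz h

theorem Unitriangular.apply_none {S : ∀ v, Matrix (A.idx v) (A.idx v) ℂ}
    (hS : Unitriangular lab S) {v : ZMod t} {x z : A.idx v} (hx : lab v x = none) :
    S v z x = (1 : Matrix (A.idx v) (A.idx v) ℂ) z x := by
  refine hS v z x ?_
  rintro ⟨j, hj, h⟩
  rw [hx] at hj
  simp at hj

/-- The column of `x` is the basis vector `x` corrected by a vector with labels above `m`. At labels
above `m + 1` the correction exists by `cw_surj`; at the other labels it contributes nothing and the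
equation already holds. -/
theorem exists_cw_columns (h : FinalInv A l n lab F) {m : ℕ} (hm : 1 ≤ m) (hmn : m ≤ n)
    (ho : o (vtx t m) = true) {S : ∀ v, Matrix (A.idx v) (A.idx v) ℂ}
    (hS : Unitriangular lab S) :
    ∃ R : Matrix (A.idx (vtx t m)) (A.idx (vtx t m)) ℂ, ∀ x, lab (vtx t m) x = some m →
      (∀ z, ¬ Above m (lab (vtx t m) z) → R z x = (1 : Matrix _ _ ℂ) z x) ∧
      ∀ y, ∑ x', (F (vtx t m)).entry x' y * R x' x =
        ∑ y', S (vtx t m + 1) y y' * (gradedMat lab F (vtx t m)).entry x y' := by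
  have hcol : ∀ x, ∃ c : A.idx (vtx t m) → ℂ, lab (vtx t m) x = some m →
      (∀ z, ¬ Above m (lab (vtx t m) z) → c z = (1 : Matrix (A.idx (vtx t m)) _ ℂ) z x) ∧
      ∀ y, ∑ x', (F (vtx t m)).entry x' y * c x' =
        ∑ y', S (vtx t m + 1) y y' * (gradedMat lab F (vtx t m)).entry x y' := by
    intro x
    by_cases hx : lab (vtx t m) x = some m
    swap
    · exact ⟨0, fun h => absurd h hx⟩
    obtain ⟨c, hc, hc'⟩ := exists_supported_mulVec
      (fun y => Above (m + 1) (lab (vtx t m + 1) y)) (fun x' => Above m (lab (vtx t m) x'))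
      (fun y x' => (F (vtx t m)).entry x' y) (h.cw_surj _ ho m hm hmn rfl)
      -- The defect of the uncorrected basis vector `x` in the commutation relation.
      (fun y => ∑ y', S (vtx t m + 1) y y' * (gradedMat lab F (vtx t m)).entry x y' -
        (F (vtx t m)).entry x y)
    refine ⟨fun z => c z + (1 : Matrix (A.idx (vtx t m)) _ ℂ) z x, fun _ => ⟨fun z hz => ?_,
      fun y => ?_⟩⟩
    · simp only
      rw [hc z hz, zero_add]
    · have e : ∑ x', (F (vtx t m)).entry x' y * (c x' + (1 : Matrix (A.idx (vtx t m)) _ ℂ) x' x) =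
          ∑ x', (F (vtx t m)).entry x' y * c x' + (F (vtx t m)).entry x y := by
        simp [mul_add, Finset.sum_add_distrib, Matrix.one_apply]
      rw [e]
      by_cases hy : Above (m + 1) (lab (vtx t m + 1) y)
      · rw [hc' y hy, sub_add_cancel]
      · obtain ⟨j, hj, hjm⟩ : ∃ j, lab (vtx t m + 1) y = some (j + 1) ∧ j ≤ m := by
          rcases hy' : lab (vtx t m + 1) y with _ | j
          · rw [hy'] at hy
            exact absurd (above_none _) hy
          · rw [hy', above_some] at hy
            have := h.lab_spec _ y j hy'
            exact ⟨j - 1, by congr 1; omega, by omega⟩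
        have e1 : ∑ x', (F (vtx t m)).entry x' y * c x' = 0 := by
          refine Finset.sum_eq_zero fun x' _ => ?_
          by_cases hx' : Above m (lab (vtx t m) x')
          · rw [h.cw_zero _ ho x' y j hj fun i hi => lt_of_le_of_lt hjm (hx' i hi), zero_mul]
          · rw [hc x' hx', mul_zero]
        have e2 : ∑ y', S (vtx t m + 1) y y' * (gradedMat lab F (vtx t m)).entry x y' =
            ∑ y', (1 : Matrix _ _ ℂ) y y' * (gradedMat lab F (vtx t m)).entry x y' := by
          refine Finset.sum_congr rfl fun y' _ => ?_
          rw [entry_gradedMat]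
          split_ifs with hy'
          · rw [hS.apply_some (hy'.trans (by rw [hx]; rfl)) hy]
          · rw [mul_zero, mul_zero]
        rw [e1, e2, zero_add]
        simp only [Matrix.one_apply, ite_mul, one_mul, zero_mul, Finset.sum_ite_eq,
          Finset.mem_univ, if_true]
        rw [entry_gradedMat]
        split_ifs with hy'
        · rfl
        · refine h.cw_zero _ ho x y j hj ?_
          rw [hx, above_some]
          refine lt_of_le_of_ne hjm ?_
          rintro rfl
          exact hy' (by rw [hj, hx]; rfl)
  choose c hc using hcol
  exact ⟨fun z x => c x z, fun x hx => hc x hx⟩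

/-- Since the block from `(m+1)'` to `m'` is injective, any prescribed values on `(m+1)'` factor
through it; this determines the rows of `R` above `m`. In the remaining rows the identity works,
because `ccw_zero` kills the corrections already present in `S`. -/
theorem exists_ccw_columns (h : FinalInv A l n lab F) {m : ℕ} (hmn : m ≤ n)
    (ho : o (vtx t m) = false) {S : ∀ v, Matrix (A.idx v) (A.idx v) ℂ}
    (hS : Unitriangular lab S) :
    ∃ R : Matrix (A.idx (vtx t m)) (A.idx (vtx t m)) ℂ,
      (∀ z x, ¬ Above m (lab (vtx t m) z) → R z x = (1 : Matrix _ _ ℂ) z x) ∧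
      ∀ y, lab (vtx t m + 1) y = some (m + 1) → ∀ x,
        ∑ y', (F (vtx t m)).entry x y' * S (vtx t m + 1) y' y =
        ∑ x', R x x' * (gradedMat lab F (vtx t m)).entry x' y := by
  classical
  have hrow : ∀ x, ∃ c : A.idx (vtx t m) → ℂ,
      (∀ x', lab (vtx t m) x' ≠ some m → c x' = 0) ∧
      ∀ y, lab (vtx t m + 1) y = some (m + 1) → ∑ x', c x' * (F (vtx t m)).entry x' y =
        ∑ y', (F (vtx t m)).entry x y' * S (vtx t m + 1) y' y := fun x =>
    exists_supported_vecMul (fun x' => lab (vtx t m) x' = some m)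
      (fun y => lab (vtx t m + 1) y = some (m + 1)) (fun x' y => (F (vtx t m)).entry x' y)
      (h.ccw_inj _ ho m hmn) _
  choose c hc hc' using hrow
  refine ⟨fun x x' => if Above m (lab (vtx t m) x) then c x x' else (1 : Matrix _ _ ℂ) x x',
    fun z x hz => if_neg hz, fun y hy x => ?_⟩
  by_cases hx : Above m (lab (vtx t m) x)
  · simp only [hx, if_true]
    rw [← hc' x y hy]
    refine Finset.sum_congr rfl fun x' _ => ?_
    rw [entry_gradedMat, hy]
    split_ifs with hx'
    · rfl
    · rw [hc x x', zero_mul, zero_mul]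
      intro hx''
      exact hx' (by rw [hx'']; rfl)
  · simp only [hx, if_false]
    obtain ⟨j, hj, hjm⟩ : ∃ j, lab (vtx t m) x = some j ∧ j ≤ m := by
      rcases hx' : lab (vtx t m) x with _ | j
      · rw [hx'] at hx
        exact absurd (above_none _) hx
      · rw [hx', above_some] at hx
        exact ⟨j, rfl, by omega⟩
    have e1 : ∑ y', (F (vtx t m)).entry x y' * S (vtx t m + 1) y' y =
        ∑ y', (F (vtx t m)).entry x y' * (1 : Matrix _ _ ℂ) y' y := by
      refine Finset.sum_congr rfl fun y' _ => ?_
      by_cases hy' : Above (m + 1) (lab (vtx t m + 1) y')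
      · rw [h.ccw_zero _ ho x y' j hj fun i hi => lt_of_le_of_lt (by omega) (hy' i hi),
          zero_mul, zero_mul]
      · rw [hS.apply_some hy hy']
    rw [e1]
    simp only [Matrix.one_apply, ite_mul, one_mul, zero_mul, mul_ite, mul_one, mul_zero,
      Finset.sum_ite_eq, Finset.sum_ite_eq', Finset.mem_univ, if_true]
    rw [entry_gradedMat]
    split_ifs with hxy
    · rfl
    · refine h.ccw_zero _ ho x y j hj ?_
      rw [hy, above_some]
      refine Nat.succ_lt_succ (lt_of_le_of_ne hjm ?_)
      rintro rfl
      exact hxy (by rw [hy, hj]; rfl)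

/-- Each arrow `[m]` links the columns labelled `m` and `m + 1`. Descending from `n + 1`, the
columns labelled `m + 1` are known, and replacing those labelled `m` disturbs no relation already
obtained. -/
theorem exists_unitriangular (h : FinalInv A l n lab F) (q : ℕ) (hq : q + l ≤ n) :
    ∃ S : ∀ v, Matrix (A.idx v) (A.idx v) ℂ, Unitriangular lab S ∧
      (∀ i, o i = true → ∀ x k, n + 1 - q ≤ k → lab i x = some k → ∀ y,
        ∑ x', (F i).entry x' y * S i x' x = ∑ y', S (i + 1) y y' * (gradedMat lab F i).entry x y') ∧
      (∀ i, o i = false → ∀ y k, n + 1 - q ≤ k → lab (i + 1) y = some (k + 1) → ∀ x,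
        ∑ y', (F i).entry x y' * S (i + 1) y' y =
          ∑ x', S i x x' * (gradedMat lab F i).entry x' y) := by
  classical
  induction q with
  | zero =>
    -- At the start only `k = n + 1` matters: `cw_last` makes both clockwise sides zero, and no
    -- vector carries the label `n + 2`.
    refine ⟨fun _ => 1, fun _ _ _ _ => rfl, fun i hi x k hk hx y => ?_, fun i hi y k hk hy x => ?_⟩
    · obtain rfl : k = n + 1 := by have := h.lab_spec _ x k hx; omega
      simp [Matrix.one_apply, entry_gradedMat, h.cw_last i hi x _ hx]
    · have := h.lab_spec _ y _ hy
      omega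
  | succ q ih =>
    obtain ⟨S, hS, hcw, hccw⟩ := ih (by omega)
    obtain ⟨m, hm⟩ : ∃ m, m = n + 1 - (q + 1) := ⟨_, rfl⟩
    have hm1 : n + 1 - q = m + 1 := by omega
    rw [← hm]
    rw [hm1] at hcw hccw
    obtain ⟨R, hR1, hRcw, hRccw⟩ : ∃ R : Matrix (A.idx (vtx t m)) (A.idx (vtx t m)) ℂ,
        (∀ x, lab (vtx t m) x = some m → ∀ z, ¬ Above m (lab (vtx t m) z) →
          R z x = (1 : Matrix _ _ ℂ) z x) ∧
        (o (vtx t m) = true → ∀ x, lab (vtx t m) x = some m → ∀ y,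
          ∑ x', (F (vtx t m)).entry x' y * R x' x =
            ∑ y', S (vtx t m + 1) y y' * (gradedMat lab F (vtx t m)).entry x y') ∧
        (o (vtx t m) = false → ∀ y, lab (vtx t m + 1) y = some (m + 1) → ∀ x,
          ∑ y', (F (vtx t m)).entry x y' * S (vtx t m + 1) y' y =
          ∑ x', R x x' * (gradedMat lab F (vtx t m)).entry x' y) := by
      rcases Bool.eq_false_or_eq_true (o (vtx t m)) with ho | ho
      · obtain ⟨R, h1⟩ := h.exists_cw_columns (m := m) (by omega) (by omega) ho hS
        exact ⟨R, fun x hx => (h1 x hx).1, fun _ x hx => (h1 x hx).2,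
          fun hc => absurd (ho.symm.trans hc) (by simp)⟩
      · obtain ⟨R, h1, h2⟩ := h.exists_ccw_columns (by omega) ho hS
        exact ⟨R, fun x _ z hz => h1 z x hz, fun hc => absurd (ho.symm.trans hc) (by simp),
          fun _ => h2⟩
    let S' : ∀ v, Matrix (A.idx v) (A.idx v) ℂ := Function.update S (vtx t m)
      fun z x => if lab (vtx t m) x = some m then R z x else S (vtx t m) z x
    have hS'self : S' (vtx t m) =
        fun z x => if lab (vtx t m) x = some m then R z x else S (vtx t m) z x :=
      Function.update_self _ _ _
    have hS'1 : ∀ x, lab (vtx t m) x = some m → ∀ z, S' (vtx t m) z x = R z x := by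
      intro x hx z
      rw [hS'self]
      exact if_pos hx
    have hS'2 : ∀ v x, lab v x ≠ some m → ∀ z, S' v z x = S v z x := by
      intro v x hx z
      by_cases hv : v = vtx t m
      · subst hv
        rw [hS'self]
        exact if_neg hx
      · rw [show S' v = S v from Function.update_of_ne hv _ _]
    refine ⟨S', ?_, ?_, ?_⟩
    · intro v z x hzx
      by_cases hx : lab v x = some m
      · obtain ⟨rfl, -⟩ := h.lab_spec v x m hx
        rw [hS'1 x hx]
        exact hR1 x hx z fun hz => hzx ⟨m, hx, hz⟩
      · rw [hS'2 v x hx]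
        exact hS v z x hzx
    · intro i hi x k hk hx y
      have e : ∑ y', S' (i + 1) y y' * (gradedMat lab F i).entry x y' =
          ∑ y', S (i + 1) y y' * (gradedMat lab F i).entry x y' := by
        refine Finset.sum_congr rfl fun y' _ => ?_
        by_cases hy' : lab (i + 1) y' = some m
        · rw [entry_gradedMat, if_neg, mul_zero, mul_zero]
          rw [hy', hx, Option.map_some, Option.some.injEq]
          omega
        · rw [hS'2 _ y' hy']
      rw [e]
      rcases Nat.lt_or_ge m k with hmk | hmk
      · rw [← hcw i hi x k hmk hx y]
        refine Finset.sum_congr rfl fun x' _ => ?_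
        rw [hS'2 _ x]
        rw [hx, Ne, Option.some.injEq]
        omega
      · obtain rfl : k = m := by omega
        obtain ⟨rfl, -⟩ := h.lab_spec i x k hx
        rw [← hRcw hi x hx y]
        exact Finset.sum_congr rfl fun x' _ => by rw [hS'1 x hx]
    · intro i hi y k hk hy x
      have e : ∑ y', (F i).entry x y' * S' (i + 1) y' y =
          ∑ y', (F i).entry x y' * S (i + 1) y' y := by
        refine Finset.sum_congr rfl fun y' _ => ?_
        rw [hS'2 _ y]
        rw [hy, Ne, Option.some.injEq]
        omega
      rw [e]
      rcases Nat.lt_or_ge m k with hmk | hmk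
      · rw [hccw i hi y k hmk hy x]
        refine Finset.sum_congr rfl fun x' _ => ?_
        by_cases hx' : lab i x' = some m
        · rw [entry_gradedMat, if_neg, mul_zero, mul_zero]
          rw [hy, hx', Option.map_some, Option.some.injEq]
          omega
        · rw [hS'2 _ x' hx']
      · obtain rfl : k = m := by omega
        have hi' : vtx t k = i := by
          have := (h.lab_spec _ y _ hy).1
          exact add_right_cancel this
        subst hi'
        rw [hRccw hi y hy x]
        refine Finset.sum_congr rfl fun x' _ => ?_
        by_cases hx' : lab (vtx t k) x' = some k
        · rw [hS'1 x' hx']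
        · rw [entry_gradedMat, if_neg, mul_zero, mul_zero]
          intro hc
          rw [hy] at hc
          rcases hx'' : lab (vtx t k) x' with _ | j
          · simp [hx''] at hc
          · rw [hx'', Option.map_some, Option.some.injEq] at hc
            obtain rfl : j = k := by omega
            exact hx' hx''

theorem Unitriangular.nonsingular (hlab : ∀ v x k, lab v x = some k → k ≤ n + 1)
    {S : ∀ v, Matrix (A.idx v) (A.idx v) ℂ} (hS : Unitriangular lab S) (v : ZMod t) :
    Nonsingular (S v) := by
  -- The rank reverses the order of labels; as labels are at most `n + 1`, labelled vectors have
  -- positive rank, leaving `0` for `none`.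
  let rk : A.idx v → ℕ := fun x => ((lab v x).map fun k => n + 2 - k).getD 0
  have hone : ∀ z x, rk x ≤ rk z → S v z x = (1 : Matrix (A.idx v) (A.idx v) ℂ) z x := by
    intro z x hzx
    rcases hx : lab v x with _ | k
    · exact hS.apply_none hx
    · refine hS.apply_some hx fun hz => ?_
      have hk := hlab v x k hx
      rcases hz' : lab v z with _ | j
      · simp only [rk, hx, hz', Option.map_some, Option.map_none, Option.getD_some,
          Option.getD_none] at hzx
        omega
      · rw [hz', above_some] at hz
        have hj := hlab v z j hz'
        simp only [rk, hx, hz', Option.map_some, Option.getD_some] at hzx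
        omega
  refine nonsingular_of_triangular rk rk (S v) (fun z x hlt => ?_) fun p => ?_
  · rw [hone z x hlt.le, Matrix.one_apply_ne]
    rintro rfl
    exact lt_irrefl _ hlt
  · have e : (Matrix.of fun (z : {z // rk z = p}) (x : {x // rk x = p}) => S v z.1 x.1) = 1 := by
      ext z x
      rw [Matrix.of_apply, hone _ _ (by rw [x.2, z.2])]
      simp [Matrix.one_apply, Subtype.ext_iff]
    rw [e]
    exact Nonsingular.one

theorem iso_gradedMat (h : FinalInv A l n lab F) (hln : l ≤ n)
    (hl : o (vtx t l) = true) : (A.withMat F).Iso (A.withMat (gradedMat lab F)) := by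
  obtain ⟨S, hS, hcw, hccw⟩ := h.exists_unitriangular (n - l) (by omega)
  rw [show n + 1 - (n - l) = l + 1 by omega] at hcw hccw
  have key : ∀ i, o i = true → ∀ (x : A.idx i) (y : A.idx (i + 1)),
      ∑ x', (F i).entry x' y * S i x' x =
        ∑ y', S (i + 1) y y' * (gradedMat lab F i).entry x y' := by
    intro i hi x y
    rcases hx : lab i x with _ | k
    · have e1 : ∑ x', (F i).entry x' y * S i x' x = (F i).entry x y := by
        simp [hS.apply_none hx, Matrix.one_apply]
      have e2 : ∑ y', S (i + 1) y y' * (gradedMat lab F i).entry x y' =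
          ∑ y', (1 : Matrix _ _ ℂ) y y' * (gradedMat lab F i).entry x y' := by
        refine Finset.sum_congr rfl fun y' _ => ?_
        rw [entry_gradedMat, hx]
        split_ifs with hy'
        · rw [hS.apply_none hy']
        · rw [mul_zero, mul_zero]
      rw [e1, e2]
      simp only [Matrix.one_apply, ite_mul, one_mul, zero_mul, Finset.sum_ite_eq,
        Finset.mem_univ, if_true]
      rw [entry_gradedMat, hx]
      split_ifs with hy
      · rfl
      · rcases hy' : lab (i + 1) y with _ | j
        · exact absurd hy' hy
        · have := h.lab_spec _ y j hy'
          refine h.cw_zero i hi x y (j - 1) (by rw [hy']; congr 1; omega) ?_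
          rw [hx]
          exact above_none _
    · exact hcw i hi x k (h.lab_spec i x k hx).2.1 hx y
  have key' : ∀ i, o i = false → ∀ (x : A.idx i) (y : A.idx (i + 1)),
      ∑ y', (F i).entry x y' * S (i + 1) y' y =
        ∑ x', S i x x' * (gradedMat lab F i).entry x' y := by
    intro i hi x y
    rcases hy : lab (i + 1) y with _ | k
    · have e1 : ∑ y', (F i).entry x y' * S (i + 1) y' y = (F i).entry x y := by
        simp [hS.apply_none hy, Matrix.one_apply]
      have e2 : ∑ x', S i x x' * (gradedMat lab F i).entry x' y =
          ∑ x', (1 : Matrix _ _ ℂ) x x' * (gradedMat lab F i).entry x' y := by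
        refine Finset.sum_congr rfl fun x' _ => ?_
        rw [entry_gradedMat, hy]
        split_ifs with hx'
        · rw [hS.apply_none (Option.map_eq_none_iff.1 hx'.symm)]
        · rw [mul_zero, mul_zero]
      rw [e1, e2]
      simp only [Matrix.one_apply, ite_mul, one_mul, zero_mul, Finset.sum_ite_eq,
        Finset.mem_univ, if_true]
      rw [entry_gradedMat, hy]
      split_ifs with hx
      · rfl
      · rcases hx' : lab i x with _ | j
        · rw [hx'] at hx
          exact absurd rfl hx
        · refine h.ccw_zero i hi x y j hx' ?_
          rw [hy]
          exact above_none _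
    · have hk := h.lab_spec _ y k hy
      obtain ⟨j, rfl⟩ : ∃ j, k = j + 1 := ⟨k - 1, by omega⟩
      refine hccw i hi y j ?_ hy x
      -- The missing case is a counterclockwise arrow into which the label `l + 1` enters; that
      -- arrow would be `l`, which is clockwise.
      by_contra hc
      obtain rfl : j = l := by omega
      have : vtx t j = i := add_right_cancel hk.1
      rw [this, hi] at hl
      simp at hl
  exact CycleRep.Iso.symm ⟨S, hS.nonsingular fun v x k hk => (h.lab_spec v x k hk).2.2,
    fun i => Edge.intertwines_iff.2 ⟨key i, key' i⟩⟩

end FinalInv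

/-- The transport of basis vectors along an equality of vertices. -/
def castIdx (A : CycleRep o) {k : ℕ} {v : ZMod t} (h : vtx t k = v) (x : A.idx (vtx t k)) :
    A.idx v := h ▸ x

theorem lab_castIdx {A : CycleRep o} (lab : ∀ v, A.idx v → Option ℕ) {k : ℕ} {v : ZMod t}
    (h : vtx t k = v) (x : A.idx (vtx t k)) : lab v (castIdx A h x) = lab (vtx t k) x := by
  subst h
  rfl

/-- The basis vectors of `ℙ(𝔸')` and `𝔸̃`, as basis vectors of `A`. -/
def assemble {A : CycleRep o} (s : CycleState A) (a b : ℕ) (v : ZMod t) :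
    ((s.shave a b).pushDown.sum s.rest).idx v → A.idx v
  | Sum.inl p => castIdx A (Finset.mem_filter.1 p.1.2).2 p.2.1
  | Sum.inr x => x.1

/-- The label of a basis vector tells which summand, and which vertex of the chain, it comes from.
-/
theorem assemble_bijective {A : CycleRep o} (s : CycleState A) (a b : ℕ)
    (hlab : ∀ v x k, s.lab v x = some k → vtx t k = v ∧ a ≤ k ∧ k ≤ b) (v : ZMod t) :
    Function.Bijective (assemble s a b v) := by
  constructor
  · rintro (⟨⟨k, hk⟩, x⟩ | x) (⟨⟨k', hk'⟩, x'⟩ | x') h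
    · have h1 : s.lab v (castIdx A (Finset.mem_filter.1 hk).2 x.1) = some k :=
        (lab_castIdx s.lab _ _).trans x.2.1
      have h2 : s.lab v (castIdx A (Finset.mem_filter.1 hk').2 x'.1) = some k' :=
        (lab_castIdx s.lab _ _).trans x'.2.1
      change castIdx A _ x.1 = castIdx A _ x'.1 at h
      rw [h, h2] at h1
      simp only [Option.some.injEq] at h1
      subst h1
      obtain ⟨-, hv⟩ := Finset.mem_filter.1 hk
      subst hv
      have : x = x' := Subtype.ext h
      rw [this]
    · have h1 : s.lab v (castIdx A (Finset.mem_filter.1 hk).2 x.1) = some k :=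
        (lab_castIdx s.lab _ _).trans x.2.1
      change castIdx A _ x.1 = x'.1 at h
      rw [h, x'.2] at h1
      simp at h1
    · have h1 : s.lab v (castIdx A (Finset.mem_filter.1 hk').2 x'.1) = some k' :=
        (lab_castIdx s.lab _ _).trans x'.2.1
      change x.1 = castIdx A _ x'.1 at h
      rw [← h, x.2] at h1
      simp at h1
    · have : x = x' := Subtype.ext h
      rw [this]
  · intro x
    rcases hx : s.lab v x with _ | k
    · exact ⟨Sum.inr ⟨x, hx⟩, rfl⟩
    · obtain ⟨rfl, h1⟩ := hlab v x k hx
      exact ⟨Sum.inl ⟨⟨k, Finset.mem_filter.2 ⟨Finset.mem_Icc.2 h1, rfl⟩⟩, ⟨x, hx, h1⟩⟩, rfl⟩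

/-- The output uses the matrices with dropped blocks, whereas the splitting uses `F`; on the graded
blocks they agree by `eq_succ` and `eq_none`. -/
theorem CycleInv.iso_gradedMat_sum {A : CycleRep o} {l n : ℕ} {s : CycleState A}
    {F : ∀ i, Edge (o i) (A.idx i) (A.idx (i + 1))} (h : CycleInv A l n s F) :
    ((s.shave (l + 1) (n + 1)).pushDown.sum s.rest).Iso (A.withMat (gradedMat s.lab F)) := by
  refine CycleRep.iso_of_equiv
    (fun v => Equiv.ofBijective _ (assemble_bijective s (l + 1) (n + 1) h.lab v)) ?_
  rintro i p q
  change (gradedMat s.lab F i).entry (assemble s (l + 1) (n + 1) i p)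
    (assemble s (l + 1) (n + 1) (i + 1) q) =
    (((s.shave (l + 1) (n + 1)).pushDown.mat i).sum (s.rest.mat i)).entry p q
  rw [entry_gradedMat]
  rcases p with ⟨⟨k, hk⟩, x⟩ | x <;> rcases q with ⟨⟨k', hk'⟩, y⟩ | y
  · have h1 : s.lab i (castIdx A (Finset.mem_filter.1 hk).2 x.1) = some k :=
      (lab_castIdx s.lab _ _).trans x.2.1
    have h2 : s.lab (i + 1) (castIdx A (Finset.mem_filter.1 hk').2 y.1) = some k' :=
      (lab_castIdx s.lab _ _).trans y.2.1
    refine Eq.trans ?_ (Edge.entry_sum_inl_inl ((s.shave (l + 1) (n + 1)).pushDown.mat i)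
      (s.rest.mat i) ⟨_, x⟩ ⟨_, y⟩).symm
    change (if s.lab (i + 1) (castIdx A (Finset.mem_filter.1 hk').2 y.1) =
      (s.lab i (castIdx A (Finset.mem_filter.1 hk).2 x.1)).map (· + 1) then
        (F i).entry (castIdx A (Finset.mem_filter.1 hk).2 x.1)
          (castIdx A (Finset.mem_filter.1 hk').2 y.1) else 0) = _
    rw [h1, h2, Option.map_some]
    by_cases hkk : k' = k + 1
    · subst hkk
      rw [if_pos rfl]
      rw [← (h.edge i).eq_succ _ _ k h1 h2, ChainRep.entry_pushDown_succ]
      obtain ⟨-, hv⟩ := Finset.mem_filter.1 hk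
      subst hv
      refine Eq.trans ?_ (Edge.entry_ofEntry _ _ _ _).symm
      rfl
    · rw [if_neg fun hc => hkk (Option.some.inj hc)]
      exact (ChainRep.entry_pushDown_of_ne _ hk hk' hkk x y).symm
  · have h1 : s.lab i (castIdx A (Finset.mem_filter.1 hk).2 x.1) = some k :=
      (lab_castIdx s.lab _ _).trans x.2.1
    refine Eq.trans ?_ (Edge.entry_sum_inl_inr ((s.shave (l + 1) (n + 1)).pushDown.mat i)
      (s.rest.mat i) ⟨_, x⟩ y).symm
    refine if_neg ?_
    change ¬ (s.lab (i + 1) y.1 = (s.lab i (castIdx A (Finset.mem_filter.1 hk).2 x.1)).map (· + 1))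
    rw [h1, y.2]
    simp
  · have h2 : s.lab (i + 1) (castIdx A (Finset.mem_filter.1 hk').2 y.1) = some k' :=
      (lab_castIdx s.lab _ _).trans y.2.1
    refine Eq.trans ?_ (Edge.entry_sum_inr_inl ((s.shave (l + 1) (n + 1)).pushDown.mat i)
      (s.rest.mat i) x ⟨_, y⟩).symm
    refine if_neg ?_
    change ¬ (s.lab (i + 1) (castIdx A (Finset.mem_filter.1 hk').2 y.1) =
      (s.lab i x.1).map (· + 1))
    rw [h2, x.2]
    simp
  · refine Eq.trans ?_ (Edge.entry_sum_inr_inr ((s.shave (l + 1) (n + 1)).pushDown.mat i)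
      (s.rest.mat i) x y).symm
    refine (if_pos ?_).trans ?_
    · change s.lab (i + 1) y.1 = (s.lab i x.1).map (· + 1)
      rw [x.2, y.2]
      rfl
    · refine Eq.trans ?_ (Edge.entry_ofEntry _ _ _ _).symm
      exact ((h.edge i).eq_none x.1 y.1 x.2 y.2).symm

theorem CycleAlgorithm.iso (ht : 2 ≤ t) {A : CycleRep o} {X : CycleOutput o}
    (h : CycleAlgorithm A X) : A.Iso (X.chain.pushDown.sum X.rest) := by
  cases h with
  | trivial =>
    exact ((ChainRep.pushDown_zero_iso.sum (CycleRep.Iso.refl A)).trans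
      (CycleRep.zero_sum_iso A)).symm
  | shave l n s hl hr hfinal =>
    obtain ⟨F, hF⟩ := hr.exists_inv ht hl
    have ho : o (vtx t l) = true := by
      by_contra hc
      exact hl.2.2.1 ((rowCond_iff _).2 fun h => absurd h hc)
    exact hF.iso.trans (((hF.final hfinal).iso_gradedMat hr.le ho).trans
      hF.iso_gradedMat_sum.symm)

theorem add_le_of_vtx_eq {j k : ℕ} (h : vtx t j = vtx t k) (hk : k < j) : k + t ≤ j := by
  rw [vtx_eq_cast, vtx_eq_cast, ZMod.natCast_eq_natCast_iff] at h
  have := Nat.le_of_dvd (by omega) ((Nat.modEq_iff_dvd' hk.le).1 h.symm)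
  omega

theorem CycleAlgorithm.le {A : CycleRep o} {X : CycleOutput o}
    (h : CycleAlgorithm A X) : X.a ≤ X.b := by
  cases h with
  | trivial => exact le_rfl
  | shave l n s hl hr hfinal => exact Nat.succ_le_succ hr.le

/-- In the resulting representation of the cycle, the clockwise arrows have matrices with linearly
independent rows. -/
theorem CycleAlgorithm.rowCond_rest (ht : 2 ≤ t) {A : CycleRep o} {X : CycleOutput o}
    (h : CycleAlgorithm A X) (i : ZMod t) : (X.rest.mat i).RowCond := by
  cases h with
  | trivial h => exact h i
  | shave l n s hl hr hfinal =>
    obtain ⟨F, hF⟩ := hr.exists_inv ht hl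
    refine (rowCond_iff _).2 fun hi d hd => ?_
    have hfin := hF.final hfinal
    -- Take the last step `k` that treated the arrow `i`, so `n < k + t`. Labels over a vertex
    -- differ by multiples of `t`, so above `k + 1` only `none` occurs at the target, and above `k`
    -- only `none` and possibly `n + 1` at the source; the latter is killed by `cw_last`.
    obtain ⟨k, hk1, hkn, hnk, hki⟩ := exists_vtx_eq ht n hfinal.1 i
    have hY : ∀ y, Above (k + 1) (s.lab (i + 1) y) → s.lab (i + 1) y = none := by
      intro y hy
      rcases hy' : s.lab (i + 1) y with _ | j
      · rfl
      · rw [hy', above_some] at hy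
        have h1 := hF.lab _ y j hy'
        have := add_le_of_vtx_eq (h1.1.trans (congrArg (· + 1) hki.symm) : vtx t j = vtx t (k + 1)) hy
        omega
    have hX : ∀ x, Above k (s.lab i x) → s.lab i x = none ∨ s.lab i x = some (n + 1) := by
      intro x hx
      rcases hx' : s.lab i x with _ | j
      · exact Or.inl rfl
      · rw [hx', above_some] at hx
        have h1 := hF.lab _ x j hx'
        have := add_le_of_vtx_eq (h1.1.trans hki.symm) hx
        exact Or.inr (by congr 1; omega)
    have hli := (linearIndependent_sub_iff (fun y => s.lab (i + 1) y = none)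
      (fun x => s.lab i x = none) (fun y x => (F i).entry x y)).2 (by
        intro d hd hd0
        refine hfin.cw_surj i hi k hk1 hkn hki d (fun y hy => hd y (ne_none_of_not_above hy))
          fun x hx => ?_
        rcases hX x hx with h1 | h1
        · exact hd0 x h1
        · exact Finset.sum_eq_zero fun y _ => by rw [hfin.cw_last i hi x y h1, mul_zero])
    refine linearIndependent_rows_iff_vecMul.1 hli d (funext fun x => ?_)
    refine Eq.trans (Finset.sum_congr rfl fun y _ => ?_) (hd x)
    rw [show (s.rest.mat i).entry x y = (s.mat i).entry x.1 y.1 from Edge.entry_ofEntry _ _ _ _,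
      (hF.edge i).eq_none x.1 y.1 x.2 y.2]

end Graded

end QuiverCycle

namespace QuiverCycle

/-! ### Direct sums of the representations `𝕃_{ij}` -/

section Interval

variable {o : ℕ → Bool} {a b : ℕ}

/-- The vertex `k` of the chain belongs to the interval `p, …, q`. -/
def InInterval (a b p q k : ℕ) : Prop := (p ≤ k ∧ k ≤ q) ∧ a ≤ k ∧ k ≤ b

instance (a b p q k : ℕ) : Decidable (InInterval a b p q k) :=
  inferInstanceAs (Decidable (_ ∧ _))

/-- The direct sum of the representations `𝕃_{pq}` over a finite family of pairs `(p, q)`. -/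
def intervalRep (o : ℕ → Bool) (a b : ℕ) {J : Type} [Fintype J] [DecidableEq J] (p q : J → ℕ) :
    ChainRep o a b where
  idx k := {j : J // InInterval a b (p j) (q j) k}
  isEmpty _ hk := ⟨fun j => hk j.2.2⟩
  mat k := Edge.ofEntry (o k) fun j j' => if j.1 = j'.1 then 1 else 0

variable {J J' : Type} [Fintype J] [DecidableEq J] [Fintype J'] [DecidableEq J']
  {p q : J → ℕ} {p' q' : J' → ℕ}

theorem entry_intervalRep (k : ℕ) (j : (intervalRep o a b p q).idx k)
    (j' : (intervalRep o a b p q).idx (k + 1)) :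
    ((intervalRep o a b p q).mat k).entry j j' = if j.1 = j'.1 then 1 else 0 :=
  Edge.entry_ofEntry _ _ _ _

/-- The restrictions of a matrix to the spaces of two direct sums of intervals. -/
def resMat (o : ℕ → Bool) (a b : ℕ) (p q : J → ℕ) (p' q' : J' → ℕ) (τ : J' → J → ℂ) (k : ℕ) :
    Matrix ((intervalRep o a b p' q').idx k) ((intervalRep o a b p q).idx k) ℂ :=
  fun j' j => τ j'.1 j.1

theorem sum_interval_ite {k : ℕ} (f : J → ℂ) (j₀ : J) :
    ∑ j : (intervalRep o a b p q).idx k, (if j.1 = j₀ then f j.1 else 0) =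
      if InInterval a b (p j₀) (q j₀) k then f j₀ else 0 := by
  split_ifs with h
  · refine (Fintype.sum_eq_single (⟨j₀, h⟩ : (intervalRep o a b p q).idx k) fun j hj => ?_).trans
      (if_pos rfl)
    exact if_neg fun hc => hj (Subtype.ext hc)
  · refine Finset.sum_eq_zero fun j _ => if_neg ?_
    rintro rfl
    exact h j.2

/-- Each way around the square yields the single term `τ j' j`, or zero if the intermediate interval
does not contain the vertex in question. Commutation thus only asks that both ways be present or
absent together. -/
theorem resMat_intertwines {τ : J' → J → ℂ} {k : ℕ}
    (hcw : o k = true → ∀ j j', InInterval a b (p j) (q j) k → InInterval a b (p' j') (q' j') (k + 1) →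
      τ j' j ≠ 0 → (InInterval a b (p' j') (q' j') k ↔ InInterval a b (p j) (q j) (k + 1)))
    (hccw : o k = false → ∀ j j', InInterval a b (p j) (q j) (k + 1) → InInterval a b (p' j') (q' j') k →
      τ j' j ≠ 0 → (InInterval a b (p' j') (q' j') (k + 1) ↔ InInterval a b (p j) (q j) k)) :
    Edge.Intertwines (resMat o a b p q p' q' τ k) (resMat o a b p q p' q' τ (k + 1))
      ((intervalRep o a b p q).mat k) ((intervalRep o a b p' q').mat k) := by
  refine Edge.intertwines_iff.2 ⟨fun hk j j' => ?_, fun hk j' j => ?_⟩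
  · simp only [entry_intervalRep, resMat, ite_mul, one_mul, zero_mul, mul_ite, mul_one, mul_zero]
    have e2 : ∑ y : (intervalRep o a b p q).idx (k + 1), (if j.1 = y.1 then τ j'.1 y.1 else 0) =
        ∑ y : (intervalRep o a b p q).idx (k + 1), (if y.1 = j.1 then τ j'.1 y.1 else 0) := by
      simp only [eq_comm]
    rw [sum_interval_ite (fun x => τ x j.1), e2, sum_interval_ite (fun y => τ j'.1 y)]
    by_cases h0 : τ j'.1 j.1 = 0
    · simp [h0]
    · simp only [hcw hk j.1 j'.1 j.2 j'.2 h0]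
  · simp only [entry_intervalRep, resMat, ite_mul, one_mul, zero_mul, mul_ite, mul_one, mul_zero]
    have e2 : ∑ y : (intervalRep o a b p' q').idx (k + 1), (if j'.1 = y.1 then τ y.1 j.1 else 0) =
        ∑ y : (intervalRep o a b p' q').idx (k + 1), (if y.1 = j'.1 then τ y.1 j.1 else 0) := by
      simp only [eq_comm]
    rw [e2, sum_interval_ite (fun x => τ x j.1), sum_interval_ite (fun y => τ j'.1 y)]
    by_cases h0 : τ j'.1 j.1 = 0
    · simp [h0]
    · simp only [hccw hk j.1 j'.1 j.2 j'.2 h0]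

theorem resMat_nonsingular {τ : J' → J → ℂ} {k : ℕ}
    (h1 : ∀ v : J → ℂ, (∀ j, ¬ InInterval a b (p j) (q j) k → v j = 0) →
      (∀ j', InInterval a b (p' j') (q' j') k → ∑ j, v j * τ j' j = 0) → v = 0)
    (h2 : ∀ w : J' → ℂ, (∀ j', ¬ InInterval a b (p' j') (q' j') k → w j' = 0) →
      (∀ j, InInterval a b (p j) (q j) k → ∑ j', w j' * τ j' j = 0) → w = 0) :
    Nonsingular (resMat o a b p q p' q' τ k) := by
  refine nonsingular_of_kernels (fun v hv => ?_) fun w hw => ?_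
  · have := (linearIndependent_sub_iff (fun j => InInterval a b (p j) (q j) k)
      (fun j' => InInterval a b (p' j') (q' j') k) (fun j j' => τ j' j)).2 h1
    refine linearIndependent_rows_iff_vecMul.1 this v (funext fun j' => ?_)
    refine Eq.trans (Finset.sum_congr rfl fun j _ => ?_) (congrFun hv j')
    exact mul_comm _ _
  · have := (linearIndependent_sub_iff (fun j' => InInterval a b (p' j') (q' j') k)
      (fun j => InInterval a b (p j) (q j) k) τ).2 h2
    exact linearIndependent_rows_iff_vecMul.1 this w hw

theorem intervalRep_iso_of_equiv (e : J ≃ J') (hp : ∀ j, p' (e j) = p j)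
    (hq : ∀ j, q' (e j) = q j) : (intervalRep o a b p q).Iso (intervalRep o a b p' q') := by
  refine ChainRep.iso_of_equiv (fun k => e.subtypeEquiv fun j => by rw [hp, hq]) ?_
  intro k j j'
  refine (entry_intervalRep k _ _).trans (Eq.trans ?_ (entry_intervalRep k j j').symm)
  exact if_congr e.apply_eq_iff_eq rfl rfl

theorem intervalRep_list_iso (L : List (ℕ × ℕ)) :
    (intervalRep o a b (fun j : Fin L.length => (L.get j).1) fun j => (L.get j).2).Iso
      (ChainRep.listSum (L.map fun p => ChainRep.L o a b p.1 p.2)) := by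
  induction L with
  | nil =>
    exact ChainRep.iso_of_equiv (fun k =>
      { toFun := fun j => j.1.elim0
        invFun := fun j => Empty.elim j
        left_inv := fun j => j.1.elim0
        right_inv := fun j => Empty.elim j }) fun k j => j.1.elim0
  | cons pq L ih =>
    refine ChainRep.Iso.trans ?_ ((ChainRep.Iso.refl (ChainRep.L o a b pq.1 pq.2)).sum ih)
    refine ChainRep.Iso.symm (ChainRep.iso_of_equiv (fun k =>
      Equiv.ofBijective (fun j => match j with
        | Sum.inl u => ⟨0, u.2.2, u.2.1⟩
        | Sum.inr j => ⟨j.1.succ, j.2⟩) ?_) ?_)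
    · constructor
      · rintro (u | j) (u' | j') h
        · exact congrArg Sum.inl (Subtype.ext rfl)
        · exact absurd (congrArg Subtype.val h) (Fin.succ_ne_zero _).symm
        · exact absurd (congrArg Subtype.val h) (Fin.succ_ne_zero _)
        · have := Fin.succ_injective _ (congrArg Subtype.val h)
          rw [Subtype.ext this]
      · rintro ⟨j, hj⟩
        induction j using Fin.cases with
        | zero => exact ⟨Sum.inl ⟨(), hj.2, hj.1⟩, rfl⟩
        | succ j => exact ⟨Sum.inr ⟨j, hj⟩, rfl⟩
    · rintro k (u | j) (u' | j')
      · refine Eq.trans ((entry_intervalRep k _ _).trans (if_pos rfl)) ?_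
        refine Eq.trans ?_ (Edge.entry_sum_inl_inl ((ChainRep.L o a b pq.1 pq.2).mat k) _ u u').symm
        refine Eq.trans ?_ (Edge.entry_ofEntry _ _ _ _).symm
        rfl
      · refine Eq.trans ((entry_intervalRep k _ _).trans (if_neg (Fin.succ_ne_zero _).symm)) ?_
        exact (Edge.entry_sum_inl_inr ((ChainRep.L o a b pq.1 pq.2).mat k) _ u j').symm
      · refine Eq.trans ((entry_intervalRep k _ _).trans (if_neg (Fin.succ_ne_zero _))) ?_
        exact (Edge.entry_sum_inr_inl ((ChainRep.L o a b pq.1 pq.2).mat k) _ j u').symm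
      · refine Eq.trans (entry_intervalRep k _ _) ?_
        refine Eq.trans ?_ (Edge.entry_sum_inr_inr ((ChainRep.L o a b pq.1 pq.2).mat k) _ j j').symm
        refine Eq.trans ?_ (entry_intervalRep k j j').symm
        simp

theorem intervalRep_iso_listSum (L : List (ℕ × ℕ))
    (h : (L : Multiset (ℕ × ℕ)) = (Finset.univ : Finset J).val.map fun j => (p j, q j)) :
    (intervalRep o a b p q).Iso
      (ChainRep.listSum (L.map fun p => ChainRep.L o a b p.1 p.2)) := by
  -- An enumeration of `J`; it may differ from `L` by a permutation, which the direct sum does not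
  -- notice up to isomorphism.
  let L' : List (ℕ × ℕ) := Finset.univ.toList.map fun j : J => (p j, q j)
  have hperm : L'.Perm L := by
    rw [← Multiset.coe_eq_coe, h, ← Multiset.map_coe, Finset.coe_toList]
  refine ChainRep.Iso.trans ?_ (ChainRep.listSum_perm_iso (hperm.map _))
  refine ChainRep.Iso.trans ?_ (intervalRep_list_iso L')
  have hlen : (Finset.univ : Finset J).toList.length = L'.length := by simp [L']
  let e : J ≃ Fin L'.length := ((finCongr hlen.symm).trans
    (List.Nodup.getEquivOfForallMemList _ (Finset.nodup_toList _) fun j => by simp)).symm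
  refine ChainRep.Iso.symm (intervalRep_iso_of_equiv e.symm (fun j => ?_) fun j => ?_)
  · simp [e, L', List.Nodup.getEquivOfForallMemList]
  · simp [e, L', List.Nodup.getEquivOfForallMemList]

end Interval

end QuiverCycle

namespace QuiverCycle

/-! ### The reduced form in a step of the algorithm for chains -/

section ChainForm

variable {X Y I : Type} [Fintype X] [Fintype Y] [Fintype I] [DecidableEq X] [DecidableEq Y]
  [DecidableEq I]

/-- The matrix that replaces the basis vectors `X` at the vertex `r` by the fragments that split off
and the beginnings of the fragments that are prolonged to `Y`. -/
def stepEntry (surv : Finset X) (m : X → Y → ℂ) : (I ⊕ {x // x ∉ surv}) ⊕ Y → I ⊕ X → ℂ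
  | Sum.inl (Sum.inl i), Sum.inl i' => if i = i' then 1 else 0
  | Sum.inl (Sum.inr n), Sum.inr x => if n.1 = x then 1 else 0
  | Sum.inr y, Sum.inr x => m x y
  | _, _ => 0

/-- The reduced form, in terms of entries and of a function `rk` that orders the strips. -/
structure StepForm (r : ℕ) (strips : List ℕ) (rk : ℕ → ℕ) (labX : X → ℕ) (labY : Y → ℕ)
    (surv : Finset X) (m : X → Y → ℂ) : Prop where
  inj : ∀ p ∈ strips, ∀ q, rk p = rk q → p = q
  zero_new : ∀ x y, labY y = r + 1 → m x y = 0
  tri : ∀ x y, labY y ∈ strips → rk (labX x) < rk (labY y) → m x y = 0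
  diag : ∀ p ∈ strips, Nonsingular (Matrix.of
    fun (y : {y // labY y = p}) (x : {x // labX x = p ∧ x ∈ surv}) => m x.1 y.1)

variable {r : ℕ} {strips : List ℕ} {rk : ℕ → ℕ} {labX : X → ℕ} {labY : Y → ℕ} {surv : Finset X}
  {m : X → Y → ℂ}

/-- Restriction to the fragments begun by the vertex `k` keeps whole strips, hence whole diagonal
blocks. Coordinates that are copied vanish at once, and those in `surv` vanish from the highest rank
downwards. -/
theorem StepForm.kernel (h : StepForm r strips rk labX labY surv m) (hX : ∀ x, labX x ∈ strips)
    (K : I → Prop) (k : ℕ) (v : I ⊕ X → ℂ) (hv : ∀ i, ¬ K i → v (Sum.inl i) = 0)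
    (hv' : ∀ x, k < labX x → v (Sum.inr x) = 0)
    (h1 : ∀ i, K i → ∑ j, v j * stepEntry surv m (Sum.inl (Sum.inl i)) j = 0)
    (h2 : ∀ n : {x // x ∉ surv}, labX n.1 ≤ k →
      ∑ j, v j * stepEntry surv m (Sum.inl (Sum.inr n)) j = 0)
    (h3 : ∀ y, labY y ≤ k → ∑ j, v j * stepEntry surv m (Sum.inr y) j = 0) : v = 0 := by
  simp only [Fintype.sum_sum_type, stepEntry, mul_ite, mul_one, mul_zero, Finset.sum_ite_eq,
    Finset.mem_univ, if_true, Finset.sum_const_zero, add_zero, zero_add] at h1 h2 h3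
  have hI : ∀ i, v (Sum.inl i) = 0 := fun i => by
    by_cases hi : K i
    · exact h1 i hi
    · exact hv i hi
  have hN : ∀ x, x ∉ surv → v (Sum.inr x) = 0 := fun x hx => by
    by_cases hk : labX x ≤ k
    · exact h2 ⟨x, hx⟩ hk
    · exact hv' x (by omega)
  have hX0 : ∀ x, v (Sum.inr x) = 0 := by
    by_contra! hne
    obtain ⟨x₀, hx₀⟩ := hne
    obtain ⟨x, hx, hmax⟩ := Finset.exists_max_image
      (Finset.univ.filter fun x => v (Sum.inr x) ≠ 0) (fun x => rk (labX x))
      ⟨x₀, by simpa using hx₀⟩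
    simp only [Finset.mem_filter, Finset.mem_univ, true_and] at hx hmax
    have hk : labX x ≤ k := by
      by_contra hc
      exact hx (hv' x (by omega))
    have hs : x ∈ surv := by
      by_contra hc
      exact hx (hN x hc)
    have := (h.diag (labX x) (hX x)).mulVec_eq_zero (v := fun x' => v (Sum.inr x'.1)) (by
      ext y
      have e := h3 y.1 (by rw [y.2]; exact hk)
      simp only [Matrix.mulVec, dotProduct, Matrix.of_apply, Pi.zero_apply]
      rw [← e]
      refine Eq.trans ?_ (sum_subtype_of_support (fun x' => labX x' = labX x ∧ x' ∈ surv)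
        (fun x' => v (Sum.inr x') * m x' y.1) ?_)
      · exact Finset.sum_congr rfl fun x' _ => mul_comm _ _
      · intro x' hx'
        by_cases hs' : x' ∈ surv
        · have hl : labX x' ≠ labX x := fun hc => hx' ⟨hc, hs'⟩
          rcases lt_trichotomy (rk (labX x')) (rk (labX x)) with hlt | heq | hgt
          · rw [h.tri x' y.1 (by rw [y.2]; exact hX x) (by rw [y.2]; exact hlt), mul_zero]
          · exact absurd (h.inj _ (hX x') _ heq) hl
          · have : v (Sum.inr x') = 0 := by
              by_contra hc
              exact absurd (hmax x' hc) (not_le.2 hgt)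
            rw [this, zero_mul]
        · rw [hN x' hs', zero_mul])
    exact hx (congrFun this ⟨x, rfl, hs⟩)
  ext j
  rcases j with i | x
  · exact hI i
  · exact hX0 x

/-- Dually, the coordinates in `Y` vanish from the lowest rank upwards, and those of the fragments
split off follow. The bound `k ≤ r` excludes the new strip, whose entries are all zero. -/
theorem StepForm.cokernel (h : StepForm r strips rk labX labY surv m)
    (hY : ∀ y, labY y ∈ strips ∨ labY y = r + 1)
    (K : I → Prop) (k : ℕ) (hk : k ≤ r) (w : (I ⊕ {x // x ∉ surv}) ⊕ Y → ℂ)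
    (hw : ∀ i, ¬ K i → w (Sum.inl (Sum.inl i)) = 0)
    (hw' : ∀ n : {x // x ∉ surv}, k < labX n.1 → w (Sum.inl (Sum.inr n)) = 0)
    (hw'' : ∀ y, k < labY y → w (Sum.inr y) = 0)
    (h1 : ∀ i, K i → ∑ j', w j' * stepEntry surv m j' (Sum.inl i) = 0)
    (h2 : ∀ x, labX x ≤ k → ∑ j', w j' * stepEntry surv m j' (Sum.inr x) = 0) : w = 0 := by
  simp only [Fintype.sum_sum_type, stepEntry, mul_ite, mul_one, mul_zero, Finset.sum_ite_eq',
    Finset.mem_univ, if_true, Finset.sum_const_zero, add_zero, zero_add] at h1 h2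
  have hI : ∀ i, w (Sum.inl (Sum.inl i)) = 0 := fun i => by
    by_cases hi : K i
    · exact h1 i hi
    · exact hw i hi
  have hY0 : ∀ y, w (Sum.inr y) = 0 := by
    by_contra! hne
    obtain ⟨y₀, hy₀⟩ := hne
    obtain ⟨y, hy, hmin⟩ := Finset.exists_min_image
      (Finset.univ.filter fun y => w (Sum.inr y) ≠ 0) (fun y => rk (labY y))
      ⟨y₀, by simpa using hy₀⟩
    simp only [Finset.mem_filter, Finset.mem_univ, true_and] at hy hmin
    have hyk : labY y ≤ k := by
      by_contra hc
      exact hy (hw'' y (by omega))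
    have hys : labY y ∈ strips := (hY y).resolve_right (by omega)
    have := (h.diag (labY y) hys).vecMul_eq_zero (v := fun y' => w (Sum.inr y'.1)) (by
      ext x
      have e := h2 x.1 (by rw [x.2.1]; exact hyk)
      rw [Finset.sum_eq_zero (fun n _ => if_neg fun hc => n.2 (hc ▸ x.2.2)), zero_add] at e
      simp only [Matrix.vecMul, dotProduct, Matrix.of_apply, Pi.zero_apply]
      rw [← e]
      refine sum_subtype_of_support (fun y' => labY y' = labY y)
        (fun y' => w (Sum.inr y') * m x.1 y') ?_
      intro y' hy'
      rcases hY y' with hs' | hs'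
      · rcases lt_trichotomy (rk (labY y')) (rk (labY y)) with hlt | heq | hgt
        · have : w (Sum.inr y') = 0 := by
            by_contra hc
            exact absurd (hmin y' hc) (not_le.2 hlt)
          rw [this, zero_mul]
        · exact absurd (h.inj _ hs' _ heq) hy'
        · rw [h.tri x.1 y' hs' (by rw [x.2.1]; exact hgt), mul_zero]
      · rw [h.zero_new _ _ hs', mul_zero])
    exact hy (congrFun this ⟨y, rfl⟩)
  ext j
  rcases j with (i | n) | y
  · exact hI i
  · by_cases hn : labX n.1 ≤ k
    · have e := h2 n.1 hn
      simp only [hY0, zero_mul, Finset.sum_const_zero, add_zero] at e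
      rw [Fintype.sum_eq_single n fun n' hn' => if_neg fun hc => hn' (Subtype.ext hc),
        if_pos rfl] at e
      exact e
    · exact hw' n (by omega)
  · exact hY0 y

theorem ChainForm.stepForm_true {c : Bool} {M : Edge c X Y}
    (h : ChainForm r strips labX labY surv M) (hc : c = true) :
    StepForm r strips (fun p => strips.idxOf p) labX labY surv M.entry := by
  subst hc
  exact
    { inj := fun _ hp _ hpq => List.idxOf_inj hp |>.1 hpq
      zero_new := fun x y hy => h.1 y x hy
      tri := fun x y hy hlt => h.2.1 y x hy hlt
      diag := fun p hp => h.2.2.2 p hp }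

/-- For a backward arrow rows and columns change roles, so the position is counted from the end of
the list; the triangularity then has the same direction as for a forward arrow. -/
theorem ChainForm.stepForm_false {c : Bool} {M : Edge c X Y}
    (h : ChainForm r strips labX labY surv M) (hc : c = false) :
    StepForm r strips (fun p => strips.length - strips.idxOf p) labX labY surv M.entry := by
  subst hc
  refine ⟨fun p hp q hpq => ?_, fun x y hy => h.1 x y hy,
    fun x y hy hlt => h.2.1 x y hy (by omega), fun p hp => (h.2.2.2 p hp).transpose⟩
  have h1 := List.idxOf_lt_length_iff.2 hp
  have h2 : strips.idxOf q ≤ strips.length := List.idxOf_le_length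
  exact List.idxOf_inj hp |>.1 (by omega)

end ChainForm

end QuiverCycle

namespace QuiverCycle

/-! ### Isomorphism of the left part of a chain with a direct sum of intervals -/

section LeftIso

variable {o : ℕ → Bool} {a b : ℕ} {J J' : Type} [Fintype J] [DecidableEq J] [Fintype J']
  [DecidableEq J'] {p q : J → ℕ} {p' q' : J' → ℕ} {B : ChainRep o a b} {r : ℕ}

/-- Up to the vertex `r`, the matrices `S` form an isomorphism with a direct sum of intervals. -/
structure LeftIso (B : ChainRep o a b) (r : ℕ) (p q : J → ℕ)
    (S : ∀ k, Matrix ((intervalRep o a b p q).idx k) (B.idx k) ℂ) : Prop where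
  nonsingular : ∀ k, k ≤ r → Nonsingular (S k)
  comm : ∀ k, k < r →
    Edge.Intertwines (S k) (S (k + 1)) (B.mat k) ((intervalRep o a b p q).mat k)

theorem LeftIso.mul {S : ∀ k, Matrix ((intervalRep o a b p q).idx k) (B.idx k) ℂ}
    (h : LeftIso B r p q S) (τ : J' → J → ℂ)
    (h1 : ∀ k, k ≤ r → Nonsingular (resMat o a b p q p' q' τ k))
    (h2 : ∀ k, k < r → Edge.Intertwines (resMat o a b p q p' q' τ k)
      (resMat o a b p q p' q' τ (k + 1)) ((intervalRep o a b p q).mat k)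
      ((intervalRep o a b p' q').mat k)) :
    LeftIso B r p' q' fun k => resMat o a b p q p' q' τ k * S k where
  nonsingular k hk := (h1 k hk).mul (h.nonsingular k hk)
  comm k hk := (h.comm k hk).comp (h2 k hk)

theorem LeftIso.inv_mul {S : ∀ k, Matrix ((intervalRep o a b p q).idx k) (B.idx k) ℂ}
    (h : LeftIso B r p q S) (τ : J → J' → ℂ)
    (h1 : ∀ k, k ≤ r → Nonsingular (resMat o a b p' q' p q τ k))
    (h2 : ∀ k, k < r → Edge.Intertwines (resMat o a b p' q' p q τ k)
      (resMat o a b p' q' p q τ (k + 1)) ((intervalRep o a b p' q').mat k)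
      ((intervalRep o a b p q).mat k)) :
    ∃ S' : ∀ k, Matrix ((intervalRep o a b p' q').idx k) (B.idx k) ℂ,
      LeftIso B r p' q' S' ∧ S r = resMat o a b p' q' p q τ r * S' r := by
  choose N hN hN' using h1
  -- Inverses are known only up to `r`; beyond it the value is irrelevant for `LeftIso B r`.
  refine ⟨fun k => if hk : k ≤ r then N k hk * S k else 0, ⟨fun k hk => ?_, fun k hk => ?_⟩, ?_⟩
  · rw [dif_pos hk]
    exact Nonsingular.mul ⟨_, hN' k hk, hN k hk⟩ (h.nonsingular k hk)
  · rw [dif_pos hk.le, dif_pos (Nat.succ_le_of_lt hk)]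
    exact (h.comm k hk).comp ((h2 k hk).inv (hN _ _) (hN' _ _) (hN _ _) (hN' _ _))
  · beta_reduce
    rw [dif_pos le_rfl, ← Matrix.mul_assoc, hN, Matrix.one_mul]

theorem LeftIso.extend {S : ∀ k, Matrix ((intervalRep o a b p q).idx k) (B.idx k) ℂ}
    (h : LeftIso B r p q S)
    (T : Matrix ((intervalRep o a b p q).idx (r + 1)) (B.idx (r + 1)) ℂ) (hT : Nonsingular T)
    (hST : Edge.Intertwines (S r) T (B.mat r) ((intervalRep o a b p q).mat r)) :
    LeftIso B (r + 1) p q (Function.update S (r + 1) T) where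
  nonsingular k hk := by
    rcases Nat.lt_or_ge r k with h' | h'
    · obtain rfl : k = r + 1 := by omega
      rwa [Function.update_self]
    · rw [Function.update_of_ne (by omega)]
      exact h.nonsingular k h'
  comm k hk := by
    rcases Nat.lt_or_ge k r with h' | h'
    · rw [Function.update_of_ne (by omega), Function.update_of_ne (by omega)]
      exact h.comm k h'
    · obtain rfl : k = r := by omega
      rw [Function.update_of_ne (by omega), Function.update_self]
      exact hST

theorem LeftIso.iso {S : ∀ k, Matrix ((intervalRep o a b p q).idx k) (B.idx k) ℂ}
    (h : LeftIso B b p q S) : B.Iso (intervalRep o a b p q) := by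
  refine ⟨S, fun k => ?_, fun k => ?_⟩
  · rcases Nat.lt_or_ge b k with hk | hk
    · have h1 := B.isEmpty k (by omega)
      have h2 := (intervalRep o a b p q).isEmpty k (by omega)
      exact ⟨0, by ext i; exact h2.elim i, by ext i; exact h1.elim i⟩
    · exact h.nonsingular k hk
  · rcases Nat.lt_or_ge k b with hk | hk
    · exact h.comm k hk
    · have h1 := B.isEmpty (k + 1) (by omega)
      have h2 := (intervalRep o a b p q).isEmpty (k + 1) (by omega)
      exact Edge.intertwines_iff.2 ⟨fun _ _ y => h2.elim y, fun _ _ y => h1.elim y⟩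

end LeftIso

/-! ### Fragments and their ends at the current vertex -/

section Fragments

variable {o : ℕ → Bool} {a b : ℕ} {X Y I : Type} [Fintype X] [DecidableEq X] [Fintype Y]
  [DecidableEq Y] [Fintype I] [DecidableEq I] {p q : I → ℕ} {lab : X → ℕ} {r : ℕ}

theorem exists_eq_inr_of_top (hq : ∀ i, q i < r)
    (j : (intervalRep o a b (Sum.elim p lab) (Sum.elim q fun _ => r)).idx r) :
    ∃ x, j.1 = Sum.inr x := by
  obtain ⟨j | x, hj⟩ := j
  · have := hq j
    simp only [InInterval, Sum.elim_inl] at hj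
    omega
  · exact ⟨x, rfl⟩

/-- The basis of the last space: the ends of the fragments that are not yet split off. -/
theorem exists_topEquiv (p : I → ℕ) (hq : ∀ i, q i < r) (ha : a ≤ r) (hb : r ≤ b)
    (hl : ∀ x, lab x ≤ r) :
    ∃ e : X ≃ (intervalRep o a b (Sum.elim p lab) (Sum.elim q fun _ => r)).idx r,
      ∀ x, (e x).1 = Sum.inr x := by
  refine ⟨Equiv.ofBijective (fun x => ⟨Sum.inr x, ⟨hl x, le_rfl⟩, ha, hb⟩) ⟨?_, ?_⟩, fun x => rfl⟩
  · intro x x' h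
    exact Sum.inr_injective (congrArg Subtype.val h)
  · intro j
    obtain ⟨x, hx⟩ := exists_eq_inr_of_top hq j
    exact ⟨x, Subtype.ext hx.symm⟩

theorem exists_topMat (p : I → ℕ) (hq : ∀ i, q i < r) (ha : a ≤ r) (hb : r ≤ b)
    (hl : ∀ x, lab x ≤ r) (U : Matrix.unitaryGroup X ℂ) :
    ∃ T : Matrix ((intervalRep o a b (Sum.elim p lab) (Sum.elim q fun _ => r)).idx r) X ℂ,
      Nonsingular T ∧ ∀ j x, j.1 = Sum.inr x → ∀ z, T j z = (U : Matrix X X ℂ) x z := by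
  obtain ⟨e, he⟩ := exists_topEquiv (o := o) p hq ha hb hl
  refine ⟨permMat e * (U : Matrix X X ℂ), (Nonsingular.permMat e).mul (Nonsingular.unitary U), ?_⟩
  intro j x hj z
  obtain rfl : j = e x := Subtype.ext (hj.trans (he x).symm)
  rw [Matrix.mul_apply]
  simp [permMat_apply]

theorem sum_top (hq : ∀ i, q i < r) (ha : a ≤ r) (hb : r ≤ b) (hl : ∀ x, lab x ≤ r)
    (f : (intervalRep o a b (Sum.elim p lab) (Sum.elim q fun _ => r)).idx r → ℂ) (g : X → ℂ)
    (h : ∀ j x, j.1 = Sum.inr x → f j = g x) : ∑ j, f j = ∑ x, g x := by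
  obtain ⟨e, he⟩ := exists_topEquiv (o := o) p hq ha hb hl
  rw [← e.sum_comp]
  exact Finset.sum_congr rfl fun x _ => h _ _ (he x)

/-- A nonsingular matrix mixing only equal intervals acts by automorphisms of the sum, since its
restriction to every vertex keeps or discards whole classes. -/
theorem LeftIso.mul_of_label {J : Type} [Fintype J] [DecidableEq J] {p q : J → ℕ}
    {B : ChainRep o a b} {S : ∀ k, Matrix ((intervalRep o a b p q).idx k) (B.idx k) ℂ}
    (h : LeftIso B r p q S) {τ : Matrix J J ℂ} (hn : Nonsingular τ)
    (hτ : ∀ j j', τ j' j ≠ 0 → p j = p j' ∧ q j = q j') :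
    LeftIso B r p q fun k => resMat o a b p q p q τ k * S k := by
  refine h.mul τ (fun k _ => ?_) (fun k _ => ?_)
  · refine resMat_nonsingular (fun v hv h1 => ?_) fun w hw h1 => ?_
    · refine hn.mulVec_eq_zero (funext fun j' => ?_)
      by_cases hj : InInterval a b (p j') (q j') k
      · refine Eq.trans (Finset.sum_congr rfl fun j _ => ?_) (h1 j' hj)
        exact mul_comm _ _
      · refine Finset.sum_eq_zero fun j _ => ?_
        by_cases h0 : τ j' j = 0
        · exact mul_eq_zero_of_left h0 _
        · obtain ⟨e1, e2⟩ := hτ j j' h0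
          rw [hv j (by rwa [e1, e2]), mul_zero]
    · refine hn.vecMul_eq_zero (funext fun j => ?_)
      by_cases hj : InInterval a b (p j) (q j) k
      · exact h1 j hj
      · refine Finset.sum_eq_zero fun j' _ => ?_
        by_cases h0 : τ j' j = 0
        · exact mul_eq_zero_of_right _ h0
        · obtain ⟨e1, e2⟩ := hτ j j' h0
          rw [hw j' (by rwa [← e1, ← e2]), zero_mul]
  · refine resMat_intertwines (fun _ j j' h1 h2 h0 => ?_) fun _ j j' h1 h2 h0 => ?_ <;>
    · obtain ⟨e1, e2⟩ := hτ j j' h0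
      rw [e1, e2] at h1 ⊢
      simp [h1, h2]

theorem LeftIso.unitary {B : ChainRep o a b} {lab : B.idx r → ℕ} (hq : ∀ i, q i < r) (ha : a ≤ r)
    (hb : r ≤ b) (hl : ∀ x, lab x ≤ r)
    {S : ∀ k, Matrix ((intervalRep o a b (Sum.elim p lab) (Sum.elim q fun _ => r)).idx k)
      (B.idx k) ℂ} (h : LeftIso B r (Sum.elim p lab) (Sum.elim q fun _ => r) S)
    {U : Matrix.unitaryGroup (B.idx r) ℂ}
    (hU : ∀ j x, j.1 = Sum.inr x → ∀ z, S r j z = (U : Matrix (B.idx r) (B.idx r) ℂ) x z)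
    (V : Matrix.unitaryGroup (B.idx r) ℂ)
    (hV : ∀ x x', lab x ≠ lab x' → (V : Matrix (B.idx r) (B.idx r) ℂ) x x' = 0) :
    ∃ S' : ∀ k, Matrix ((intervalRep o a b (Sum.elim p lab) (Sum.elim q fun _ => r)).idx k)
      (B.idx k) ℂ, LeftIso B r (Sum.elim p lab) (Sum.elim q fun _ => r) S' ∧
      ∀ j x, j.1 = Sum.inr x → ∀ z, S' r j z = ((V : Matrix (B.idx r) (B.idx r) ℂ) *
        (U : Matrix (B.idx r) (B.idx r) ℂ)) x z := by
  have hn : Nonsingular (Matrix.fromBlocks (1 : Matrix I I ℂ) 0 0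
      (V : Matrix (B.idx r) (B.idx r) ℂ)) :=
    Nonsingular.fromBlocks (N := (V : Matrix (B.idx r) (B.idx r) ℂ)) Nonsingular.one
      (Nonsingular.unitary V)
  refine ⟨_, h.mul_of_label hn ?_, ?_⟩
  · rintro (i | x) (i' | x') hne
    · have : i' = i := by
        by_contra hc
        exact hne (Matrix.one_apply_ne hc)
      subst this
      exact ⟨rfl, rfl⟩
    · exact absurd rfl hne
    · exact absurd rfl hne
    · refine ⟨?_, rfl⟩
      by_contra hc
      exact hne (hV x' x fun h => hc h.symm)
  · intro j x hj z
    rw [Matrix.mul_apply, Matrix.mul_apply]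
    refine sum_top hq ha hb hl _ _ fun j' x' hj' => ?_
    rw [hU j' x' hj']
    refine congrArg (· * _) ?_
    change Matrix.fromBlocks _ _ _ _ j.1 j'.1 = _
    rw [hj, hj']
    rfl

end Fragments

end QuiverCycle

namespace QuiverCycle

/-! ### The algorithm for chains gives a decomposition -/

section ChainStepIso

variable {o : ℕ → Bool} {a b r : ℕ} {X Y I : Type} [DecidableEq X] [DecidableEq I] {p q : I → ℕ} {lab : X → ℕ} {lab' : Y → ℕ}
  {surv : Finset X} {m : X → Y → ℂ}

/-- The beginnings of the fragments after step `r`. -/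
abbrev stepBeg (p : I → ℕ) (lab : X → ℕ) (lab' : Y → ℕ) (surv : Finset X) :
    (I ⊕ {x // x ∉ surv}) ⊕ Y → ℕ :=
  Sum.elim (Sum.elim p fun n => lab n.1) lab'

/-- The ends of the fragments after step `r`. -/
abbrev stepEnd (q : I → ℕ) (Y : Type) (r : ℕ) (surv : Finset X) : (I ⊕ {x // x ∉ surv}) ⊕ Y → ℕ :=
  Sum.elim (Sum.elim q fun _ => r) fun _ => r + 1

/-- Nonzero entries join fragments with the same interval, or a fragment with one of its
prolongations. -/
theorem stepEntry_cases {j : I ⊕ X} {j' : (I ⊕ {x // x ∉ surv}) ⊕ Y}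
    (h : stepEntry surv m j' j ≠ 0) :
    (stepBeg p lab lab' surv j' = Sum.elim p lab j ∧
      stepEnd q Y r surv j' = Sum.elim q (fun _ => r) j) ∨
    ∃ x y, j = Sum.inr x ∧ j' = Sum.inr y ∧ m x y ≠ 0 := by
  rcases j with i | x <;> rcases j' with (i' | n) | y
  · left
    have : i' = i := by
      by_contra hc
      exact h (if_neg hc)
    subst this
    exact ⟨rfl, rfl⟩
  · exact absurd rfl h
  · exact absurd rfl h
  · exact absurd rfl h
  · left
    have : n.1 = x := by
      by_contra hc
      exact h (if_neg hc)
    subst this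
    exact ⟨rfl, rfl⟩
  · exact Or.inr ⟨x, y, rfl, rfl, h⟩

variable [Fintype X] [Fintype Y] [DecidableEq Y] [Fintype I]

theorem StepForm.kernel_cokernel {strips : List ℕ} {rk : ℕ → ℕ}
    (h : StepForm r strips rk lab lab' surv m) (hX : ∀ x, lab x ∈ strips)
    (hY : ∀ y, lab' y ∈ strips ∨ lab' y = r + 1) (p q : I → ℕ) (hb : r ≤ b) (k : ℕ) (hk : k ≤ r) :
    (∀ v : I ⊕ X → ℂ,
      (∀ j, ¬ InInterval a b (Sum.elim p lab j) (Sum.elim q (fun _ => r) j) k → v j = 0) →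
      (∀ j', InInterval a b (stepBeg p lab lab' surv j') (stepEnd q Y r surv j') k →
        ∑ j, v j * stepEntry surv m j' j = 0) → v = 0) ∧
    ∀ w : (I ⊕ {x // x ∉ surv}) ⊕ Y → ℂ,
      (∀ j', ¬ InInterval a b (stepBeg p lab lab' surv j') (stepEnd q Y r surv j') k →
        w j' = 0) →
      (∀ j, InInterval a b (Sum.elim p lab j) (Sum.elim q (fun _ => r) j) k →
        ∑ j', w j' * stepEntry surv m j' j = 0) → w = 0 := by
  by_cases ha : a ≤ k
  · refine ⟨fun v hv h1 => ?_, fun w hw h1 => ?_⟩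
    · refine h.kernel hX (fun i => InInterval a b (p i) (q i) k) k v (fun i hi => hv _ hi)
        (fun x hx => hv _ fun hc => absurd hc.1.1 (not_le.2 hx)) (fun i hi => h1 _ hi)
        (fun n hn => h1 _ ⟨⟨hn, hk⟩, ha, hk.trans hb⟩)
        (fun y hy => h1 _ ⟨⟨hy, hk.trans r.le_succ⟩, ha, hk.trans hb⟩)
    · refine h.cokernel hY (fun i => InInterval a b (p i) (q i) k) k hk w (fun i hi => hw _ hi)
        (fun n hn => hw _ fun hc => absurd hc.1.1 (not_le.2 hn))
        (fun y hy => hw _ fun hc => absurd hc.1.1 (not_le.2 hy)) (fun i hi => h1 _ hi)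
        (fun x hx => h1 _ ⟨⟨hx, hk⟩, ha, hk.trans hb⟩)
  · exact ⟨fun v hv _ => funext fun j => hv j fun hc => ha hc.2.1,
      fun w hw _ => funext fun j => hw j fun hc => ha hc.2.1⟩

/-- Intervals with a common end can fail to commute only where one has begun and the other begins at
`k + 1`. For `k → k + 1` the obstruction is a source already present at `k` with a target beginning
at `k + 1`; for `k ← k + 1` it is the opposite. Those entries must vanish. -/
theorem stepEntry_intertwines {k : ℕ} (hk : k < r)
    (h1 : o k = true → ∀ x y, m x y ≠ 0 → ¬ (lab x ≤ k ∧ lab' y = k + 1))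
    (h2 : o k = false → ∀ x y, m x y ≠ 0 → ¬ (lab' y ≤ k ∧ lab x = k + 1)) :
    Edge.Intertwines
      (resMat o a b (Sum.elim p lab) (Sum.elim q fun _ => r) (stepBeg p lab lab' surv)
        (stepEnd q Y r surv) (stepEntry surv m) k)
      (resMat o a b (Sum.elim p lab) (Sum.elim q fun _ => r) (stepBeg p lab lab' surv)
        (stepEnd q Y r surv) (stepEntry surv m) (k + 1))
      ((intervalRep o a b (Sum.elim p lab) (Sum.elim q fun _ => r)).mat k)
      ((intervalRep o a b (stepBeg p lab lab' surv) (stepEnd q Y r surv)).mat k) := by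
  refine resMat_intertwines (fun ho j j' hj hj' h0 => ?_) fun ho j j' hj hj' h0 => ?_
  · rcases stepEntry_cases (p := p) (q := q) (lab := lab) (lab' := lab') (r := r) h0 with
      ⟨e1, e2⟩ | ⟨x, y, rfl, rfl, hm⟩
    · rw [e1, e2] at hj' ⊢
      exact iff_of_true hj hj'
    · have := h1 ho x y hm
      simp only [InInterval, stepBeg, stepEnd, Sum.elim_inr] at hj hj' ⊢
      omega
  · rcases stepEntry_cases (p := p) (q := q) (lab := lab) (lab' := lab') (r := r) h0 with
      ⟨e1, e2⟩ | ⟨x, y, rfl, rfl, hm⟩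
    · rw [e1, e2] at hj' ⊢
      exact iff_of_true hj hj'
    · have := h2 ho x y hm
      simp only [InInterval, stepBeg, stepEnd, Sum.elim_inr] at hj hj' ⊢
      omega

theorem stepEntry_intertwines_symm {k : ℕ} (hk : k < r)
    (h1 : o k = true → ∀ x y, m x y ≠ 0 → ¬ (lab' y ≤ k ∧ lab x = k + 1))
    (h2 : o k = false → ∀ x y, m x y ≠ 0 → ¬ (lab x ≤ k ∧ lab' y = k + 1)) :
    Edge.Intertwines
      (resMat o a b (stepBeg p lab lab' surv) (stepEnd q Y r surv) (Sum.elim p lab)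
        (Sum.elim q fun _ => r) (fun j j' => stepEntry surv m j' j) k)
      (resMat o a b (stepBeg p lab lab' surv) (stepEnd q Y r surv) (Sum.elim p lab)
        (Sum.elim q fun _ => r) (fun j j' => stepEntry surv m j' j) (k + 1))
      ((intervalRep o a b (stepBeg p lab lab' surv) (stepEnd q Y r surv)).mat k)
      ((intervalRep o a b (Sum.elim p lab) (Sum.elim q fun _ => r)).mat k) := by
  refine resMat_intertwines (fun ho j' j hj' hj h0 => ?_) fun ho j' j hj' hj h0 => ?_
  · rcases stepEntry_cases (p := p) (q := q) (lab := lab) (lab' := lab') (r := r) h0 with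
      ⟨e1, e2⟩ | ⟨x, y, rfl, rfl, hm⟩
    · rw [e1, e2] at hj' ⊢
      exact iff_of_true hj' hj
    · have := h1 ho x y hm
      simp only [InInterval, stepBeg, stepEnd, Sum.elim_inr] at hj hj' ⊢
      omega
  · rcases stepEntry_cases (p := p) (q := q) (lab := lab) (lab' := lab') (r := r) h0 with
      ⟨e1, e2⟩ | ⟨x, y, rfl, rfl, hm⟩
    · rw [e1, e2] at hj' ⊢
      exact iff_of_true hj' hj
    · have := h2 ho x y hm
      simp only [InInterval, stepBeg, stepEnd, Sum.elim_inr] at hj hj' ⊢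
      omega

/-- At a backward arrow the new isomorphism is known only through `S r = R * S' r`, so the square is
checked after multiplication by `R`, which is then cancelled. -/
theorem Edge.intertwines_of_mul_left {X X' X'' Y Y' : Type} [Fintype X] [Fintype Y] [Fintype X']
    [Fintype X''] [Fintype Y']
    [DecidableEq X'] [DecidableEq X''] {S : Matrix X' X ℂ} {T : Matrix Y' Y ℂ}
    {c : Bool} {M : Edge c X Y} {M' : Edge c X' Y'} (hc : c = false) {R : Matrix X'' X' ℂ}
    (hR : Nonsingular R)
    (h : ∀ x'' y, ∑ x', R x'' x' * ∑ y', M'.entry x' y' * T y' y =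
      ∑ x, (R * S) x'' x * M.entry x y) : Edge.Intertwines S T M M' := by
  refine Edge.intertwines_iff.2 ⟨fun h' => absurd (h'.symm.trans hc) (by simp), fun _ x' y => ?_⟩
  have := hR.mulVec_eq_zero
    (v := fun x' => ∑ y', M'.entry x' y' * T y' y - ∑ x, S x' x * M.entry x y) (by
      ext x''
      have e := h x'' y
      simp only [Matrix.mul_apply, Finset.sum_mul, Finset.mul_sum, mul_assoc] at e
      rw [Finset.sum_comm (s := (Finset.univ : Finset X))] at e
      simp only [Matrix.mulVec, dotProduct, mul_sub, Finset.sum_sub_distrib, Pi.zero_apply,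
        Finset.mul_sum]
      rw [e, sub_self])
  exact sub_eq_zero.1 (congrFun this x')

/-- Step `r` for an arrow `r → r + 1`. -/
theorem LeftIso.step_true {B : ChainRep o a b} {lab : B.idx r → ℕ} {lab' : B.idx (r + 1) → ℕ}
    {surv : Finset (B.idx r)} {m : B.idx r → B.idx (r + 1) → ℂ} (ho : o r = true)
    (hq : ∀ i, q i < r) (ha : a ≤ r) (hb : r < b) (hl : ∀ x, lab x ≤ r) (hl' : ∀ y, lab' y ≤ r + 1)
    {S : ∀ k, Matrix ((intervalRep o a b (Sum.elim p lab) (Sum.elim q fun _ => r)).idx k)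
      (B.idx k) ℂ} (h : LeftIso B r (Sum.elim p lab) (Sum.elim q fun _ => r) S)
    {U : Matrix (B.idx r) (B.idx r) ℂ} (hU : ∀ j x, j.1 = Sum.inr x → ∀ z, S r j z = U x z)
    (h1 : ∀ k, k ≤ r → Nonsingular (resMat o a b (Sum.elim p lab) (Sum.elim q fun _ => r)
      (stepBeg p lab lab' surv) (stepEnd q (B.idx (r + 1)) r surv) (stepEntry surv m) k))
    (h2 : ∀ k, k < r → Edge.Intertwines
      (resMat o a b (Sum.elim p lab) (Sum.elim q fun _ => r) (stepBeg p lab lab' surv)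
        (stepEnd q (B.idx (r + 1)) r surv) (stepEntry surv m) k)
      (resMat o a b (Sum.elim p lab) (Sum.elim q fun _ => r) (stepBeg p lab lab' surv)
        (stepEnd q (B.idx (r + 1)) r surv) (stepEntry surv m) (k + 1))
      ((intervalRep o a b (Sum.elim p lab) (Sum.elim q fun _ => r)).mat k)
      ((intervalRep o a b (stepBeg p lab lab' surv) (stepEnd q (B.idx (r + 1)) r surv)).mat k))
    (hm0 : ∀ x y, lab' y = r + 1 → m x y = 0)
    (U' : Matrix.unitaryGroup (B.idx (r + 1)) ℂ)
    (hm : ∀ z y, ∑ x, m x y * U x z =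
      ∑ z', (U' : Matrix (B.idx (r + 1)) (B.idx (r + 1)) ℂ) y z' * (B.mat r).entry z z') :
    ∃ S' : ∀ k, Matrix ((intervalRep o a b (stepBeg p lab lab' surv)
        (stepEnd q (B.idx (r + 1)) r surv)).idx k) (B.idx k) ℂ,
      LeftIso B (r + 1) (stepBeg p lab lab' surv) (stepEnd q (B.idx (r + 1)) r surv) S' ∧
      ∀ j y, j.1 = Sum.inr y → ∀ z, S' (r + 1) j z =
        (U' : Matrix (B.idx (r + 1)) (B.idx (r + 1)) ℂ) y z := by
  have hq' : ∀ n : I ⊕ {x // x ∉ surv}, Sum.elim q (fun _ => r) n < r + 1 := by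
    rintro (i | n)
    · exact (hq i).trans r.lt_succ_self
    · exact r.lt_succ_self
  obtain ⟨T, hT, hTU⟩ := exists_topMat (o := o) (Sum.elim p fun n : {x // x ∉ surv} => lab n.1)
    hq' (ha.trans r.le_succ) hb hl' U'
  refine ⟨_, (h.mul _ h1 h2).extend T hT ?_, ?_⟩
  · refine Edge.intertwines_iff.2 ⟨fun _ z j' => ?_, fun h' => absurd (ho.symm.trans h') (by simp)⟩
    obtain ⟨y, hy⟩ := exists_eq_inr_of_top hq' j'
    have e1 : ∑ z', T j' z' * (B.mat r).entry z z' = ∑ x, m x y * U x z := by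
      rw [hm z y]
      exact Finset.sum_congr rfl fun z' _ => by rw [hTU j' y hy]
    refine Eq.trans ?_ e1.symm
    have e2 : ∀ j : (intervalRep o a b (stepBeg p lab lab' surv)
        (stepEnd q (B.idx (r + 1)) r surv)).idx r, j.1 = Sum.inr y →
        (resMat o a b (Sum.elim p lab) (Sum.elim q fun _ => r) (stepBeg p lab lab' surv)
          (stepEnd q (B.idx (r + 1)) r surv) (stepEntry surv m) r * S r) j z =
        ∑ x, m x y * U x z := by
      intro j hj
      rw [Matrix.mul_apply]
      refine sum_top hq ha hb.le hl _ _ fun i x hi => ?_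
      rw [hU i x hi]
      refine congrArg (· * _) ?_
      change stepEntry surv m j.1 i.1 = _
      rw [hj, hi]
      rfl
    simp only [entry_intervalRep]
    -- A prolonged fragment has exactly one predecessor at `r`; a new one has none, and then its row
    -- of `m` is zero.
    by_cases hr : lab' y ≤ r
    · let j₀ : (intervalRep o a b (stepBeg p lab lab' surv)
        (stepEnd q (B.idx (r + 1)) r surv)).idx r := ⟨Sum.inr y, ⟨hr, r.le_succ⟩, ha, hb.le⟩
      refine (Fintype.sum_eq_single j₀ fun j hj => ?_).trans ?_
      · rw [if_neg, zero_mul]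
        exact fun hc => hj (Subtype.ext (hc.trans hy))
      · rw [if_pos hy.symm, one_mul]
        exact e2 j₀ rfl
    · rw [Finset.sum_eq_zero, Finset.sum_eq_zero]
      · intro x _
        rw [hm0 x y (by have := hl' y; omega), zero_mul]
      · intro j _
        rw [if_neg, zero_mul]
        intro hc
        have := j.2.1.1
        rw [hc, hy] at this
        exact hr this
  · intro j y hj z
    rw [Function.update_self]
    exact hTU j y hj z

/-- Step `r` for an arrow `r ← r + 1`. -/
theorem LeftIso.step_false {B : ChainRep o a b} {lab : B.idx r → ℕ} {lab' : B.idx (r + 1) → ℕ}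
    {surv : Finset (B.idx r)} {m : B.idx r → B.idx (r + 1) → ℂ} (ho : o r = false)
    (hq : ∀ i, q i < r) (ha : a ≤ r) (hb : r < b) (hl' : ∀ y, lab' y ≤ r + 1)
    {S : ∀ k, Matrix ((intervalRep o a b (Sum.elim p lab) (Sum.elim q fun _ => r)).idx k)
      (B.idx k) ℂ} (h : LeftIso B r (Sum.elim p lab) (Sum.elim q fun _ => r) S)
    {U : Matrix (B.idx r) (B.idx r) ℂ} (hU : ∀ j x, j.1 = Sum.inr x → ∀ z, S r j z = U x z)
    (h1 : ∀ k, k ≤ r → Nonsingular (resMat o a b (stepBeg p lab lab' surv)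
      (stepEnd q (B.idx (r + 1)) r surv) (Sum.elim p lab) (Sum.elim q fun _ => r)
      (fun j j' => stepEntry surv m j' j) k))
    (h2 : ∀ k, k < r → Edge.Intertwines
      (resMat o a b (stepBeg p lab lab' surv) (stepEnd q (B.idx (r + 1)) r surv) (Sum.elim p lab)
        (Sum.elim q fun _ => r) (fun j j' => stepEntry surv m j' j) k)
      (resMat o a b (stepBeg p lab lab' surv) (stepEnd q (B.idx (r + 1)) r surv) (Sum.elim p lab)
        (Sum.elim q fun _ => r) (fun j j' => stepEntry surv m j' j) (k + 1))
      ((intervalRep o a b (stepBeg p lab lab' surv) (stepEnd q (B.idx (r + 1)) r surv)).mat k)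
      ((intervalRep o a b (Sum.elim p lab) (Sum.elim q fun _ => r)).mat k))
    (hm0 : ∀ x y, lab' y = r + 1 → m x y = 0)
    (U' : Matrix.unitaryGroup (B.idx (r + 1)) ℂ)
    (hm : ∀ x z', ∑ y, m x y * (U' : Matrix (B.idx (r + 1)) (B.idx (r + 1)) ℂ) y z' =
      ∑ z, U x z * (B.mat r).entry z z') :
    ∃ S' : ∀ k, Matrix ((intervalRep o a b (stepBeg p lab lab' surv)
        (stepEnd q (B.idx (r + 1)) r surv)).idx k) (B.idx k) ℂ,
      LeftIso B (r + 1) (stepBeg p lab lab' surv) (stepEnd q (B.idx (r + 1)) r surv) S' ∧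
      ∀ j y, j.1 = Sum.inr y → ∀ z, S' (r + 1) j z =
        (U' : Matrix (B.idx (r + 1)) (B.idx (r + 1)) ℂ) y z := by
  have hq' : ∀ n : I ⊕ {x // x ∉ surv}, Sum.elim q (fun _ => r) n < r + 1 := by
    rintro (i | n)
    · exact (hq i).trans r.lt_succ_self
    · exact r.lt_succ_self
  obtain ⟨T, hT, hTU⟩ := exists_topMat (o := o) (Sum.elim p fun n : {x // x ∉ surv} => lab n.1)
    hq' (ha.trans r.le_succ) hb hl' U'
  obtain ⟨S', hS', hSS'⟩ := h.inv_mul _ h1 h2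
  refine ⟨_, hS'.extend T hT ?_, ?_⟩
  · refine Edge.intertwines_of_mul_left ho (h1 r le_rfl) fun j z' => ?_
    rw [← hSS']
    obtain ⟨x, hx⟩ := exists_eq_inr_of_top hq j
    have e1 : ∑ z, S r j z * (B.mat r).entry z z' =
        ∑ y, m x y * (U' : Matrix (B.idx (r + 1)) (B.idx (r + 1)) ℂ) y z' := by
      rw [hm x z']
      exact Finset.sum_congr rfl fun z _ => by rw [hU j x hx]
    refine Eq.trans ?_ e1.symm
    -- Extended by zero to the fragments split off, the summand also vanishes on the fragments
    -- beginning at `r + 1`, so the sum over the basis at `r` may run over all fragments.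
    let g : (I ⊕ {x // x ∉ surv}) ⊕ B.idx (r + 1) → ℂ := fun j' => stepEntry surv m j' (Sum.inr x) *
      Sum.elim (fun _ => 0) (fun y => (U' : Matrix (B.idx (r + 1)) (B.idx (r + 1)) ℂ) y z') j'
    have e2 : ∀ j' : (intervalRep o a b (stepBeg p lab lab' surv)
        (stepEnd q (B.idx (r + 1)) r surv)).idx r,
        ∑ y', ((intervalRep o a b (stepBeg p lab lab' surv)
          (stepEnd q (B.idx (r + 1)) r surv)).mat r).entry j' y' * T y' z' =
        Sum.elim (fun _ => 0) (fun y => (U' : Matrix (B.idx (r + 1)) (B.idx (r + 1)) ℂ) y z')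
          j'.1 := by
      rintro ⟨n | y, hj'⟩
      · refine Finset.sum_eq_zero fun y' _ => ?_
        obtain ⟨y, hy⟩ := exists_eq_inr_of_top hq' y'
        refine mul_eq_zero_of_left ((entry_intervalRep _ _ _).trans (if_neg ?_)) _
        rw [hy]
        exact Sum.inl_ne_inr
      · let y₀ : (intervalRep o a b (stepBeg p lab lab' surv)
          (stepEnd q (B.idx (r + 1)) r surv)).idx (r + 1) :=
          ⟨Sum.inr y, ⟨hl' y, le_rfl⟩, ha.trans r.le_succ, hb⟩
        refine (Fintype.sum_eq_single y₀ fun y' hy' => ?_).trans ?_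
        · refine mul_eq_zero_of_left ((entry_intervalRep _ _ _).trans (if_neg ?_)) _
          exact fun hc => hy' (Subtype.ext hc.symm)
        · refine Eq.trans (congrArg (· * _) ((entry_intervalRep _ _ _).trans (if_pos rfl))) ?_
          exact (one_mul _).trans (hTU y₀ y rfl z')
    have e3 : ∑ j' : (intervalRep o a b (stepBeg p lab lab' surv)
        (stepEnd q (B.idx (r + 1)) r surv)).idx r, g j'.1 = ∑ j', g j' := by
      refine sum_subtype_of_support _ g ?_
      rintro (n | y) hj'
      · exact mul_zero _
      · refine mul_eq_zero_of_left (hm0 x y ?_) _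
        by_contra hc
        have := hl' y
        exact hj' ⟨⟨by change lab' y ≤ r; omega, r.le_succ⟩, ha, hb.le⟩
    refine Eq.trans (Finset.sum_congr rfl fun j' _ => ?_) (e3.trans ?_)
    · rw [e2 j']
      refine congrArg (· * _) ?_
      change stepEntry surv m j'.1 j.1 = _
      rw [hx]
    · rw [Fintype.sum_sum_type, Finset.sum_eq_zero, zero_add]
      · rfl
      · intro n _
        exact mul_zero _
  · intro j y hj z
    rw [Function.update_self]
    exact hTU j y hj z

end ChainStepIso

end QuiverCycle

namespace QuiverCycle

/-! ### The invariant of the algorithm for chains -/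

section ChainInv

variable {o : ℕ → Bool} {a b : ℕ} {B : ChainRep o a b}

theorem map_univ_sum {α β γ : Type} [Fintype α] [Fintype β] (f : α ⊕ β → γ) :
    (Finset.univ : Finset (α ⊕ β)).val.map f =
      (Finset.univ : Finset α).val.map (fun x => f (Sum.inl x)) +
        (Finset.univ : Finset β).val.map fun y => f (Sum.inr y) := by
  rw [← Finset.univ_disjSum_univ, Finset.val_disjSum, Multiset.disjSum, Multiset.map_add,
    Multiset.map_map, Multiset.map_map]
  rfl

theorem map_univ_sdiff {α γ : Type} [Fintype α] [DecidableEq α] (T : Finset α) (f : α → γ) :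
    (Finset.univ \ T).val.map f =
      (Finset.univ : Finset {x // x ∉ T}).val.map fun x => f x.1 := by
  have : Finset.univ \ T =
      (Finset.univ : Finset {x // x ∉ T}).map (Function.Embedding.subtype _) := by
    ext x
    simp
  rw [this, Finset.map_val, Multiset.map_map]
  rfl

/-- What is known before step `r` of the algorithm for chains. -/
structure ChainInv (B : ChainRep o a b) (r : ℕ) (s : ChainState B r) : Prop where
  left_le : a ≤ r
  le_right : r ≤ b
  nodup : s.strips.Nodup
  lab_mem : ∀ x, s.lab x ∈ s.strips
  mem_strips : ∀ p ∈ s.strips, a ≤ p ∧ p ≤ r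
  order : ∀ p ∈ s.strips, ∀ q ∈ s.strips, p < q →
    (o (q - 1) = true → s.strips.idxOf p < s.strips.idxOf q) ∧
    (o (q - 1) = false → s.strips.idxOf q < s.strips.idxOf p)
  leftIso : ∃ (I : Type) (_ : Fintype I) (_ : DecidableEq I) (p q : I → ℕ)
    (U : Matrix.unitaryGroup (B.idx r) ℂ)
    (S : ∀ k, Matrix ((intervalRep o a b (Sum.elim p s.lab) (Sum.elim q fun _ => r)).idx k)
      (B.idx k) ℂ),
    (∀ i, a ≤ p i ∧ p i ≤ q i ∧ q i < r) ∧
    s.out = (Finset.univ : Finset I).val.map (fun i => (p i, q i)) ∧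
    s.cur = Edge.act U 1 (B.mat r) ∧
    LeftIso B r (Sum.elim p s.lab) (Sum.elim q fun _ => r) S ∧
    ∀ j x, j.1 = Sum.inr x → ∀ z, S r j z = (U : Matrix (B.idx r) (B.idx r) ℂ) x z

theorem ChainInv.init (hab : a ≤ b) : ChainInv B a (ChainState.init B) where
  left_le := le_rfl
  le_right := hab
  nodup := by simp [ChainState.init]
  lab_mem x := by simp [ChainState.init]
  mem_strips p hp := by
    have : p = a := by simpa [ChainState.init] using hp
    omega
  order p hp q hq hpq := by
    have h1 : p = a := by simpa [ChainState.init] using hp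
    have h2 : q = a := by simpa [ChainState.init] using hq
    omega
  leftIso := by
    -- At the start nothing has split off, every basis vector at `a` is a fragment, and the spaces
    -- to the left are zero.
    obtain ⟨T, hT, hT1⟩ := exists_topMat (o := o) (I := Empty) (X := B.idx a) (q := Empty.elim)
      (lab := (ChainState.init B).lab) Empty.elim (fun i => i.elim) le_rfl hab (fun _ => le_rfl) 1
    refine ⟨Empty, inferInstance, inferInstance, Empty.elim, Empty.elim, 1,
      Function.update (fun _ => 0) a T, fun i => i.elim, rfl, (Edge.act_one_one _).symm,
      ⟨fun k hk => ?_, fun k hk => ?_⟩, ?_⟩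
    · rcases Nat.lt_or_ge k a with h | h
      · have h1 := B.isEmpty k (by omega)
        have h2 := (intervalRep o a b (Sum.elim Empty.elim (ChainState.init B).lab)
          (Sum.elim Empty.elim fun _ => a)).isEmpty k (by omega)
        exact ⟨0, by ext i; exact h2.elim i, by ext i; exact h1.elim i⟩
      · obtain rfl : k = a := le_antisymm hk h
        rw [Function.update_self]
        exact hT
    · have h1 := B.isEmpty k (by omega)
      have h2 := (intervalRep o a b (Sum.elim Empty.elim (ChainState.init B).lab)
        (Sum.elim Empty.elim fun _ => a)).isEmpty k (by omega)
      exact Edge.intertwines_iff.2 ⟨fun _ x _ => h1.elim x, fun _ x _ => h2.elim x⟩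
    · intro j x hj z
      rw [Function.update_self]
      exact hT1 j x hj z

/-- The field `order` links positions and orientations: of two strips `p < q`, the earlier beginning
comes first exactly if the arrow ending at `q` points forwards. This is how a strip is placed when
created, and it turns the zero triangle into the vanishing of the entries that are not morphisms. -/
theorem ChainInv.step {r : ℕ} {s : ChainState B r} {s' : ChainState B (r + 1)}
    (h : ChainInv B r s) (hr : r < b) (hs : ChainStep B r s s') : ChainInv B (r + 1) s' := by
  obtain ⟨V, U', surv, hV, hlab, hform, hcur, hstrips, hout⟩ := hs
  have hnew : r + 1 ∉ s.strips := fun hc => by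
    have := (h.mem_strips _ hc).2
    omega
  have hl : ∀ x, s.lab x ≤ r := fun x => (h.mem_strips _ (h.lab_mem x)).2
  have hl' : ∀ y, s'.lab y ≤ r + 1 := fun y => by
    rcases hlab y with hy | hy
    · exact (h.mem_strips _ hy).2.trans r.le_succ
    · exact hy.le
  have hmem : ∀ p, p ∈ s'.strips ↔ p ∈ s.strips ∨ p = r + 1 := by
    intro p
    rw [hstrips]
    split_ifs <;> simp [or_comm]
  refine ⟨h.left_le.trans r.le_succ, hr, ?_, fun y => (hmem _).2 (hlab y), ?_, ?_, ?_⟩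
  · rw [hstrips]
    split_ifs
    · exact List.Nodup.append h.nodup (List.nodup_singleton _)
        (List.disjoint_singleton.2 hnew)
    · exact List.nodup_cons.2 ⟨hnew, h.nodup⟩
  · intro p hp
    rcases (hmem p).1 hp with hp | rfl
    · have := h.mem_strips p hp
      omega
    · exact ⟨h.left_le.trans r.le_succ, le_rfl⟩
  · intro p hp q hq hpq
    have hps : p ∈ s.strips := by
      rcases (hmem p).1 hp with hp | rfl
      · exact hp
      · rcases (hmem q).1 hq with hq | rfl
        · have := h.mem_strips q hq
          omega
        · omega
    rcases (hmem q).1 hq with hqs | rfl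
    · have := h.order p hps q hqs hpq
      rw [hstrips]
      split_ifs
      · rwa [List.idxOf_append_of_mem hps, List.idxOf_append_of_mem hqs]
      · rw [List.idxOf_cons_ne _ (by rintro rfl; exact hnew hps),
          List.idxOf_cons_ne _ (by rintro rfl; exact hnew hqs)]
        simpa using this
    · rw [hstrips, Nat.add_sub_cancel]
      split_ifs with ho
      · refine ⟨fun _ => ?_, fun hc => absurd (ho.symm.trans hc) (by simp)⟩
        rw [List.idxOf_append_of_mem hps, List.idxOf_append_of_notMem hnew]
        exact (List.idxOf_lt_length_iff.2 hps).trans_le (Nat.le_add_right _ _)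
      · refine ⟨fun hc => absurd hc ho, fun _ => ?_⟩
        rw [List.idxOf_cons_self, List.idxOf_cons_ne _ (by rintro rfl; exact hnew hps)]
        exact Nat.succ_pos _
  · obtain ⟨I, _, _, p, q, U, S, hpq, hsout, hscur, hS, hSU⟩ := h.leftIso
    have hq : ∀ i, q i < r := fun i => (hpq i).2.2
    obtain ⟨S₁, hS₁, hSV⟩ := hS.unitary hq h.left_le h.le_right hl hSU V hV
    -- The matrix `cur` already contains the change `U` made at `r` in the previous step, so from
    -- the original matrix the total change at `r` is `V * U`.
    have hM : Edge.Intertwines ((V : Matrix (B.idx r) (B.idx r) ℂ) *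
        (U : Matrix (B.idx r) (B.idx r) ℂ)) ((U' : Matrix (B.idx (r + 1)) (B.idx (r + 1)) ℂ))
        (B.mat r) (Edge.act V U' s.cur) := by
      have e1 := Edge.intertwines_act U 1 (B.mat r)
      rw [← hscur] at e1
      have e2 := e1.comp (Edge.intertwines_act V U' s.cur)
      rwa [Submonoid.coe_one, Matrix.mul_one] at e2
    set m := (Edge.act V U' s.cur).entry with hm
    have hmem' : ∀ y, s'.lab y ≤ r → s'.lab y ∈ s.strips := fun y hy =>
      (hlab y).resolve_right (by omega)
    have hex : ∃ S' : ∀ k, Matrix ((intervalRep o a b (stepBeg p s.lab s'.lab surv)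
        (stepEnd q (B.idx (r + 1)) r surv)).idx k) (B.idx k) ℂ,
        LeftIso B (r + 1) (stepBeg p s.lab s'.lab surv) (stepEnd q (B.idx (r + 1)) r surv) S' ∧
        ∀ j y, j.1 = Sum.inr y → ∀ z, S' (r + 1) j z =
          (U' : Matrix (B.idx (r + 1)) (B.idx (r + 1)) ℂ) y z := by
      rcases Bool.eq_false_or_eq_true (o r) with ho | ho
      · have hform' : StepForm r s.strips (fun p => s.strips.idxOf p) s.lab s'.lab surv m :=
          hform.stepForm_true ho
        refine hS₁.step_true ho hq h.left_le hr hl hl' hSV (fun k hk => ?_) (fun k hk => ?_)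
          hform'.zero_new U' ((Edge.intertwines_iff.1 hM).1 ho)
        · exact resMat_nonsingular (hform'.kernel_cokernel h.lab_mem hlab p q h.le_right k hk).1
            (hform'.kernel_cokernel h.lab_mem hlab p q h.le_right k hk).2
        · refine stepEntry_intertwines hk (fun hok x y hxy hc => ?_) fun hok x y hxy hc => ?_
          · have hy := hmem' y (by omega)
            refine hxy (hform'.tri x y hy ?_)
            -- Here `y` begins at `k + 1`, so the orientation of the arrow `k` decides the order of
            -- the two strips.
            refine (h.order _ (h.lab_mem x) _ hy (by omega)).1 ?_
            rw [hc.2]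
            exact hok
          · have hy := hmem' y (by omega)
            refine hxy (hform'.tri x y hy ?_)
            refine (h.order _ hy _ (h.lab_mem x) (by omega)).2 ?_
            rw [hc.2]
            exact hok
      · have hform' : StepForm r s.strips (fun p => s.strips.length - s.strips.idxOf p)
            s.lab s'.lab surv m :=
          hform.stepForm_false ho
        have htri : ∀ x y, s'.lab y ∈ s.strips →
            s.strips.idxOf (s'.lab y) < s.strips.idxOf (s.lab x) → m x y = 0 := by
          intro x y hy hlt
          have := List.idxOf_lt_length_iff.2 (h.lab_mem x)
          exact hform'.tri x y hy (by omega)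
        refine hS₁.step_false ho hq h.left_le hr hl' hSV (fun k hk => ?_) (fun k hk => ?_)
          hform'.zero_new U' ((Edge.intertwines_iff.1 hM).2 ho)
        · exact resMat_nonsingular (hform'.kernel_cokernel h.lab_mem hlab p q h.le_right k hk).2
            (hform'.kernel_cokernel h.lab_mem hlab p q h.le_right k hk).1
        · refine stepEntry_intertwines_symm hk (fun hok x y hxy hc => ?_) fun hok x y hxy hc => ?_
          · have hy := hmem' y (by omega)
            refine hxy (htri x y hy ?_)
            refine (h.order _ hy _ (h.lab_mem x) (by omega)).1 ?_
            rw [hc.2]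
            exact hok
          · have hy := hmem' y (by omega)
            refine hxy (htri x y hy ?_)
            refine (h.order _ (h.lab_mem x) _ hy (by omega)).2 ?_
            rw [hc.2]
            exact hok
    obtain ⟨S', hS', hSU'⟩ := hex
    refine ⟨I ⊕ {x // x ∉ surv}, inferInstance, inferInstance, Sum.elim p fun n => s.lab n.1,
      Sum.elim q fun _ => r, U', S', ?_, ?_, hcur, hS', hSU'⟩
    · rintro (i | n)
      · have := hpq i
        simp only [Sum.elim_inl]
        omega
      · have := h.mem_strips _ (h.lab_mem n.1)
        simp only [Sum.elim_inr]
        omega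
    · rw [hout, hsout, map_univ_sum, map_univ_sdiff]
      rfl

theorem ChainReach.inv (hab : a ≤ b) {r : ℕ} {s : ChainState B r} (h : ChainReach B r s) :
    ChainInv B r s := by
  induction h with
  | start => exact ChainInv.init hab
  | next r s s' _ hr hs ih => exact ih.step hr hs

theorem ChainAlgorithm.iso (hab : a ≤ b) {P : List (ℕ × ℕ)}
    (h : ChainAlgorithm B (P : Multiset (ℕ × ℕ))) :
    (∀ p ∈ P, a ≤ p.1 ∧ p.1 ≤ p.2 ∧ p.2 ≤ b) ∧
      B.Iso (ChainRep.listSum (P.map fun p => ChainRep.L o a b p.1 p.2)) := by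
  obtain ⟨s, hs, hP⟩ := h
  have hinv := hs.inv hab
  obtain ⟨I, _, _, p, q, U, S, hpq, hout, -, hS, -⟩ := hinv.leftIso
  have hP' : (P : Multiset (ℕ × ℕ)) = (Finset.univ : Finset (I ⊕ B.idx b)).val.map
      fun j => (Sum.elim p s.lab j, Sum.elim q (fun _ => b) j) := by
    rw [hP, hout, map_univ_sum]
    rfl
  refine ⟨fun pq hpq' => ?_, hS.iso.trans (intervalRep_iso_listSum P hP')⟩
  rw [← Multiset.mem_coe, hP'] at hpq'
  obtain ⟨j, -, rfl⟩ := Multiset.mem_map.1 hpq'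
  rcases j with i | x
  · have := hpq i
    simp only [Sum.elim_inl]
    omega
  · have := hinv.mem_strips _ (hinv.lab_mem x)
    simp only [Sum.elim_inr]
    omega

end ChainInv

end QuiverCycle

namespace QuiverCycle

open Matrix

/-! ### The steps of the algorithm for chains can be carried out -/

section ChainExists

variable {X : Type}

/-- Unitary transformations of rows reduce a matrix whose columns are divided into strips to a
staircase form. -/
theorem exists_staircase (labX : X → ℕ) (rk : ℕ → ℕ) (new : ℕ) (strips : List ℕ)
    (hrk : strips.Pairwise fun p q => rk p ≤ rk q) (hnd : strips.Nodup) (hnew : new ∉ strips)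
    (Y : Type) [Fintype Y] [DecidableEq Y] (N : Matrix Y X ℂ) :
    ∃ (U : Matrix.unitaryGroup Y ℂ) (labY : Y → ℕ),
      (∀ y, labY y ∈ strips ∨ labY y = new) ∧
      (∀ y x, labX x ∈ strips → labY y = new → ((U : Matrix Y Y ℂ) * N) y x = 0) ∧
      (∀ y x, labX x ∈ strips → labY y ∈ strips → rk (labX x) < rk (labY y) →
        ((U : Matrix Y Y ℂ) * N) y x = 0) ∧
      ∀ p ∈ strips, ∀ c : Y → ℂ, (∀ y, labY y ≠ p → c y = 0) →
        (∀ x, labX x = p → ∑ y, c y * ((U : Matrix Y Y ℂ) * N) y x = 0) → c = 0 := by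
  classical
  induction strips generalizing Y with
  | nil => exact ⟨1, fun _ => new, by simp⟩
  | cons p₁ strips ih =>
    obtain ⟨hrk1, hrk2⟩ := List.pairwise_cons.1 hrk
    obtain ⟨hnd1, hnd2⟩ := List.nodup_cons.1 hnd
    simp only [List.mem_cons, not_or] at hnew
    -- The rows independent on the first strip are labelled `p₁`; the rows `s`, zero there, are
    -- passed on to the remaining strips. Later unitary transformations mix only rows in `s`, so
    -- those zeros persist.
    obtain ⟨U₁, s, hs1, hs2⟩ := exists_unitary_rows
      (Matrix.of fun (y : Y) (x : {x // labX x = p₁}) => N y x.1)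
    let g : Y → Bool := fun y => decide (y ∈ s)
    obtain ⟨U₂, lab₂, h1, h2, h3, h4⟩ := ih hrk2 hnd2 hnew.2 {y // g y = true}
      (Matrix.of fun y x => ((U₁ : Matrix Y Y ℂ) * N) y.1 x)
    obtain ⟨U₃, hU3, hU3'⟩ := exists_unitary_extend g U₂
    have eU : ((U₃ * U₁ : Matrix.unitaryGroup Y ℂ) : Matrix Y Y ℂ) * N =
        (U₃ : Matrix Y Y ℂ) * ((U₁ : Matrix Y Y ℂ) * N) := by
      rw [Submonoid.coe_mul, Matrix.mul_assoc]
    have eout : ∀ y x, ¬ g y = true →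
        (((U₃ * U₁ : Matrix.unitaryGroup Y ℂ) : Matrix Y Y ℂ) * N) y x =
          ((U₁ : Matrix Y Y ℂ) * N) y x := by
      intro y x hy
      rw [eU, Matrix.mul_apply]
      simp only [hU3' y _ (Or.inl (by simpa using hy)), Matrix.one_apply, ite_mul, one_mul,
        zero_mul, Finset.sum_ite_eq, Finset.mem_univ, if_true]
    have ein : ∀ (y : {y // g y = true}) x,
        (((U₃ * U₁ : Matrix.unitaryGroup Y ℂ) : Matrix Y Y ℂ) * N) y.1 x =
          ((U₂ : Matrix {y // g y = true} {y // g y = true} ℂ) *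
            Matrix.of fun (y : {y // g y = true}) (x : X) => ((U₁ : Matrix Y Y ℂ) * N) y.1 x)
            y x := by
      intro y x
      rw [eU, Matrix.mul_apply, Matrix.mul_apply]
      rw [← sum_subtype_of_support (fun y' => g y' = true)]
      · exact Finset.sum_congr rfl fun y' _ => by rw [hU3 y y', Matrix.of_apply]
      · intro y' hy'
        rw [hU3' _ _ (Or.inr (by simpa using hy')), Matrix.one_apply_ne, zero_mul]
        rintro rfl
        exact hy' y.2
    have eU1 : ∀ y (x : {x // labX x = p₁}), ((U₁ : Matrix Y Y ℂ) *
        Matrix.of fun (y : Y) (x : {x // labX x = p₁}) => N y x.1) y x =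
          ((U₁ : Matrix Y Y ℂ) * N) y x.1 := fun y x => rfl
    have ezero : ∀ (y : {y // g y = true}) x, labX x = p₁ →
        (((U₃ * U₁ : Matrix.unitaryGroup Y ℂ) : Matrix Y Y ℂ) * N) y.1 x = 0 := by
      intro y x hx
      rw [ein, Matrix.mul_apply]
      refine Finset.sum_eq_zero fun y' _ => ?_
      have := hs1 y'.1 (by simpa [g] using y'.2) ⟨x, hx⟩
      rw [eU1] at this
      rw [Matrix.of_apply, this, mul_zero]
    obtain ⟨lab, labIn, labOut⟩ : ∃ lab : Y → ℕ, (∀ y hy, lab y = lab₂ ⟨y, hy⟩) ∧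
        ∀ y, ¬ g y = true → lab y = p₁ :=
      ⟨fun y => if hy : g y = true then lab₂ ⟨y, hy⟩ else p₁, fun y hy => dif_pos hy,
        fun y hy => dif_neg hy⟩
    refine ⟨U₃ * U₁, lab, ?_, ?_, ?_, ?_⟩
    · intro y
      by_cases hy : g y = true
      · rw [labIn y hy, List.mem_cons]
        rcases h1 ⟨y, hy⟩ with h | h
        · exact Or.inl (Or.inr h)
        · exact Or.inr h
      · simp [labOut y hy]
    · intro y x hx hl
      by_cases hy : g y = true
      · rw [labIn y hy] at hl
        rcases List.mem_cons.1 hx with hx | hx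
        · exact ezero ⟨y, hy⟩ x hx
        · rw [ein ⟨y, hy⟩]
          exact h2 _ _ hx hl
      · rw [labOut y hy] at hl
        exact absurd hl.symm hnew.1
    · intro y x hx _ hlt
      by_cases hy : g y = true
      · rw [labIn y hy] at hlt
        rcases List.mem_cons.1 hx with hx | hx
        · exact ezero ⟨y, hy⟩ x hx
        · rw [ein ⟨y, hy⟩]
          rcases h1 ⟨y, hy⟩ with h | h
          · exact h3 _ _ hx h hlt
          · exact h2 _ _ hx h
      · rw [labOut y hy] at hlt
        rcases List.mem_cons.1 hx with hx | hx
        · rw [hx] at hlt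
          exact absurd hlt (lt_irrefl _)
        · exact absurd hlt (not_lt.2 (hrk1 _ hx))
    · intro p hp c hc hc0
      rcases List.mem_cons.1 hp with rfl | hp
      · have hcs : ∀ y, g y = true → c y = 0 := fun y hy => hc y (by
          rw [labIn y hy]
          intro he
          rcases h1 ⟨y, hy⟩ with h | h
          · exact hnd1 (he ▸ h)
          · exact hnew.1 (h.symm.trans he))
        refine hs2 c (fun y hy => hcs y (by simpa [g] using hy)) (funext fun x => ?_)
        refine Eq.trans (Finset.sum_congr rfl fun y _ => ?_) (hc0 x.1 x.2)
        by_cases hy : g y = true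
        · rw [hcs y hy, zero_mul, zero_mul]
        · rw [eout y _ hy]
          exact congrArg (c y * ·) (eU1 y x)
      · have hcs : ∀ y, ¬ g y = true → c y = 0 := fun y hy => hc y (by
          rw [labOut y hy]
          rintro rfl
          exact hnd1 hp)
        have := h4 p hp (fun y => c y.1) (fun y hy => hc y.1 (by rwa [labIn y.1 y.2]))
          (fun x hx => by
            rw [← hc0 x hx, ← sum_subtype_of_support (fun y => g y = true)]
            · exact Finset.sum_congr rfl fun y _ => by rw [ein]
            · intro y hy
              rw [hcs y hy, zero_mul])
        ext y
        by_cases hy : g y = true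
        · exact congrFun this ⟨y, hy⟩
        · exact hcs y hy

/-- The reduction in a step of the algorithm for chains. -/
theorem exists_chain_reduction [Fintype X] [DecidableEq X] {Y : Type} [Fintype Y] [DecidableEq Y]
    (labX : X → ℕ) (rk : ℕ → ℕ) (new : ℕ) (strips : List ℕ)
    (hrk : strips.Pairwise fun p q => rk p ≤ rk q) (hnd : strips.Nodup) (hnew : new ∉ strips)
    (hX : ∀ x, labX x ∈ strips) (N : Matrix Y X ℂ) :
    ∃ (V : Matrix.unitaryGroup X ℂ) (U : Matrix.unitaryGroup Y ℂ) (labY : Y → ℕ)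
      (surv : Finset X) (M : Matrix Y X ℂ),
      M = (U : Matrix Y Y ℂ) * N * ((V⁻¹ : Matrix.unitaryGroup X ℂ) : Matrix X X ℂ) ∧
      (∀ x x', labX x ≠ labX x' → (V : Matrix X X ℂ) x x' = 0) ∧
      (∀ y, labY y ∈ strips ∨ labY y = new) ∧
      (∀ y x, labY y = new → M y x = 0) ∧
      (∀ y x, labY y ∈ strips → rk (labX x) < rk (labY y) → M y x = 0) ∧
      (∀ y x, labY y = labX x → x ∉ surv → M y x = 0) ∧
      ∀ p ∈ strips, Nonsingular (Matrix.of
        fun (y : {y // labY y = p}) (x : {x // labX x = p ∧ x ∈ surv}) => M y.1 x.1) := by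
  classical
  obtain ⟨U, labY, h1, h2, h3, h4⟩ := exists_staircase labX rk new strips hrk hnd hnew Y N
  set F : Matrix Y X ℂ := (U : Matrix Y Y ℂ) * N with hF
  -- Within each column strip, reduce the diagonal block to zero columns and independent columns;
  -- the latter form `surv`. The triangle of zeros survives because `W` does not mix strips.
  choose W s hs1 hs2 using fun p => exists_unitary_cols
    (Matrix.of fun (y : {y // labY y = p}) (x : {x // labX x = p}) => F y.1 x.1)
  obtain ⟨V, hV, hVW⟩ := exists_unitary_glue labX W
  have hVinv : ∀ x x', ((V⁻¹ : Matrix.unitaryGroup X ℂ) : Matrix X X ℂ) x x' =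
      star ((V : Matrix X X ℂ) x' x) := fun x x' => rfl
  have hWinv : ∀ p x x', (((W p)⁻¹ : Matrix.unitaryGroup _ ℂ) :
      Matrix {x // labX x = p} {x // labX x = p} ℂ) x x' =
      star ((W p : Matrix {x // labX x = p} {x // labX x = p} ℂ) x' x) := fun p x x' => rfl
  let M : Matrix Y X ℂ := F * ((V⁻¹ : Matrix.unitaryGroup X ℂ) : Matrix X X ℂ)
  have hM : ∀ y x, (∀ x', labX x' = labX x → F y x' = 0) → M y x = 0 := by
    intro y x h
    refine (Matrix.mul_apply).trans (Finset.sum_eq_zero fun x' _ => ?_)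
    by_cases hx : labX x' = labX x
    · rw [h x' hx, zero_mul]
    · rw [hVinv, hV x x' (fun hc => hx hc.symm), star_zero, mul_zero]
  have hMp : ∀ p (y : {y // labY y = p}) (x : {x // labX x = p}), M y.1 x.1 =
      ((Matrix.of fun (y : {y // labY y = p}) (x : {x // labX x = p}) => F y.1 x.1) *
        (((W p)⁻¹ : Matrix.unitaryGroup _ ℂ) :
          Matrix {x // labX x = p} {x // labX x = p} ℂ)) y x := by
    intro p y x
    refine (Matrix.mul_apply).trans ?_
    rw [Matrix.mul_apply, ← sum_subtype_of_support (fun x' => labX x' = p)]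
    · refine Finset.sum_congr rfl fun x' _ => ?_
      rw [hVinv, hWinv, hVW p x x', Matrix.of_apply]
    · intro x' hx'
      rw [hVinv, hV x.1 x' (fun hc => hx' (hc.symm.trans x.2)), star_zero, mul_zero]
  let surv : Finset X := Finset.univ.filter fun x => (⟨x, rfl⟩ : {x' // labX x' = labX x}) ∉ s _
  have hsurv : ∀ p (x : {x // labX x = p}), x.1 ∈ surv ↔ x ∉ s p := by
    rintro p ⟨x, rfl⟩
    simp [surv]
  have hdiag : ∀ y x, labY y = labX x → x ∉ surv → M y x = 0 := by
    intro y x hy hx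
    rw [hMp (labX x) ⟨y, hy⟩ ⟨x, rfl⟩]
    refine hs1 _ _ ?_ _
    by_contra hc
    exact hx ((hsurv _ ⟨x, rfl⟩).2 hc)
  refine ⟨V, U, labY, surv, M, rfl, hV, h1, ?_, ?_, hdiag, ?_⟩
  · exact fun y x hy => hM y x fun x' _ => h2 y x' (hX x') hy
  · exact fun y x hy hlt => hM y x fun x' hx' => h3 y x' (hX x') hy (hx' ▸ hlt)
  · intro p hp
    refine nonsingular_of_kernels (fun v hv => ?_) fun w hw => ?_
    · have := hs2 p (fun x => if hx : x.1 ∈ surv then v ⟨x.1, x.2, hx⟩ else 0) (fun x hx => by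
        rw [dif_neg]
        rw [hsurv p x]
        exact not_not.2 hx) (funext fun y => by
          refine Eq.trans ?_ (congrFun hv y)
          let f : X → ℂ := fun x => if h : labX x = p ∧ x ∈ surv then M y.1 x * v ⟨x, h⟩ else 0
          have e1 := sum_subtype_of_support (fun x => labX x = p) f fun x hx =>
            dif_neg fun h => hx h.1
          have e2 := sum_subtype_of_support (fun x => labX x = p ∧ x ∈ surv) f fun x hx =>
            dif_neg hx
          refine Eq.trans (Finset.sum_congr rfl fun x _ => ?_) ((e1.trans e2.symm).trans
            (Finset.sum_congr rfl fun x _ => dif_pos x.2))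
          refine Eq.trans (congrArg (· * _) (hMp p y x).symm) ?_
          by_cases hx : x.1 ∈ surv
          · refine Eq.trans (congrArg (_ * ·) (dif_pos hx)) ?_
            simp only [f, dif_pos (⟨x.2, hx⟩ : labX x.1 = p ∧ x.1 ∈ surv)]
          · refine Eq.trans (congrArg (_ * ·) (dif_neg hx)) ((mul_zero _).trans ?_)
            simp only [f, dif_neg fun h : labX x.1 = p ∧ x.1 ∈ surv => hx h.2])
      ext x
      have := congrFun this ⟨x.1, x.2.1⟩
      rwa [dif_pos x.2.2] at this
    -- A row relation on the surviving columns holds on the whole strip, the other columns being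
    -- zero; undoing `V` gives a row relation of the staircase block, whose rows are independent.
    · let c : Y → ℂ := fun y => if hy : labY y = p then w ⟨y, hy⟩ else 0
      have hc : ∀ y, labY y ≠ p → c y = 0 := fun y hy => dif_neg hy
      have e : ∀ x, labX x = p → ∑ y, c y * M y x = 0 := by
        intro x hx
        rw [← sum_subtype_of_support (fun y => labY y = p) _ fun y hy => by rw [hc y hy, zero_mul]]
        by_cases hxs : x ∈ surv
        · refine Eq.trans (Finset.sum_congr rfl fun y _ => ?_) (congrFun hw ⟨x, hx, hxs⟩)
          exact congrArg (· * M y.1 x) (dif_pos y.2)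
        · exact Finset.sum_eq_zero fun y _ => by rw [hdiag y.1 x (y.2.trans hx.symm) hxs, mul_zero]
      have hFM : F = M * (V : Matrix X X ℂ) := by
        rw [Matrix.mul_assoc, ← Submonoid.coe_mul, inv_mul_cancel, Submonoid.coe_one,
          Matrix.mul_one]
      have := h4 p hp c hc (fun x hx => by
        rw [hFM]
        simp only [Matrix.mul_apply, Finset.mul_sum, ← mul_assoc]
        rw [Finset.sum_comm]
        refine Finset.sum_eq_zero fun x' _ => ?_
        rw [← Finset.sum_mul]
        by_cases hx' : labX x' = labX x
        · rw [e x' (hx'.trans hx), zero_mul]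
        · rw [hV x' x hx', mul_zero])
      ext y
      exact (dif_pos y.2).symm.trans (congrFun this y.1)

end ChainExists

end QuiverCycle

namespace QuiverCycle

open Matrix

/-! ### Reduction for both orientations, and completion of a run -/

section ChainWorks

theorem pairwise_idxOf_le {strips : List ℕ} (h : strips.Nodup) :
    strips.Pairwise fun p q => strips.idxOf p ≤ strips.idxOf q := by
  rw [List.pairwise_iff_getElem]
  intro i j hi hj hij
  rw [h.idxOf_getElem, h.idxOf_getElem]
  exact hij.le

theorem Nonsingular.conjTranspose {m n : Type} [Fintype m] [Fintype n] [DecidableEq m]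
    [DecidableEq n] {M : Matrix m n ℂ} (hM : Nonsingular M) : Nonsingular Mᴴ := by
  obtain ⟨N, h1, h2⟩ := hM
  exact ⟨Nᴴ, by rw [← conjTranspose_mul, h2, conjTranspose_one], by
    rw [← conjTranspose_mul, h1, conjTranspose_one]⟩

theorem exists_chainForm {X Y : Type} [Fintype X] [Fintype Y] [DecidableEq X] [DecidableEq Y]
    (r : ℕ) (strips : List ℕ) (hnd : strips.Nodup) (hnew : r + 1 ∉ strips) (labX : X → ℕ)
    (hX : ∀ x, labX x ∈ strips) : ∀ {c : Bool} (M : Edge c X Y),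
    ∃ (V : Matrix.unitaryGroup X ℂ) (U : Matrix.unitaryGroup Y ℂ) (labY : Y → ℕ)
      (surv : Finset X), (∀ x x', labX x ≠ labX x' → (V : Matrix X X ℂ) x x' = 0) ∧
      (∀ y, labY y ∈ strips ∨ labY y = r + 1) ∧
      ChainForm r strips labX labY surv (Edge.act V U M)
  | true, M => by
    obtain ⟨V, U, labY, surv, M', hM', h1, h2, h3, h4, h5, h6⟩ := exists_chain_reduction labX
      (fun p => strips.idxOf p) (r + 1) strips (pairwise_idxOf_le hnd) hnd hnew hX M.fwd
    subst hM'
    exact ⟨V, U, labY, surv, h1, h2, h3, h4, h5, h6⟩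
  | false, M => by
    -- A backward arrow is reduced through its conjugate transpose, which keeps the transformations
    -- unitary; reversing the list of strips turns the triangle over.
    obtain ⟨V, U, labY, surv, M', hM', h1, h2, h3, h4, h5, h6⟩ := exists_chain_reduction labX
      (fun p => strips.length - strips.idxOf p) (r + 1) strips.reverse
      (List.pairwise_reverse.2 ((pairwise_idxOf_le hnd).imp fun h => by omega))
      (List.nodup_reverse.2 hnd) (by simpa using hnew) (by simpa using hX) M.bwdᴴ
    have e : (Edge.act V U M).bwd = M'ᴴ := by
      change (V : Matrix X X ℂ) * M.bwd * ((U⁻¹ : Matrix.unitaryGroup Y ℂ) : Matrix Y Y ℂ) = _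
      have eU : ((U⁻¹ : Matrix.unitaryGroup Y ℂ) : Matrix Y Y ℂ) = (U : Matrix Y Y ℂ)ᴴ := rfl
      have eV : ((V⁻¹ : Matrix.unitaryGroup X ℂ) : Matrix X X ℂ) = (V : Matrix X X ℂ)ᴴ := rfl
      rw [hM', conjTranspose_mul, conjTranspose_mul, conjTranspose_conjTranspose, eU, eV,
        conjTranspose_conjTranspose, Matrix.mul_assoc]
    have e' : ∀ x y, (Edge.act V U M).bwd x y = star (M' y x) := fun x y => by
      rw [e, conjTranspose_apply]
    refine ⟨V, U, labY, surv, h1, by simpa using h2, fun x y hy => ?_, fun x y hy hlt => ?_,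
      fun x y hy hx => ?_, fun p hp => ?_⟩
    · rw [e', h3 y x hy, star_zero]
    · have := List.idxOf_lt_length_iff.2 (hX x)
      rw [e', h4 y x (by simpa using hy) (by omega), star_zero]
    · rw [e', h5 y x hy hx, star_zero]
    · have := (h6 p (by simpa using hp)).conjTranspose
      convert this using 1
      ext x y
      exact e' x.1 y.1

variable {o : ℕ → Bool} {a b : ℕ}

theorem ChainInv.exists_step {B : ChainRep o a b} {r : ℕ} {s : ChainState B r}
    (h : ChainInv B r s) : ∃ s', ChainStep B r s s' := by
  obtain ⟨V, U, labY, surv, h1, h2, h3⟩ := exists_chainForm r s.strips h.nodup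
    (fun hc => by
      have := (h.mem_strips _ hc).2
      omega) s.lab h.lab_mem s.cur
  exact ⟨⟨Edge.act U 1 (B.mat (r + 1)), labY,
    if o r = true then s.strips ++ [r + 1] else (r + 1) :: s.strips,
    s.out + (Finset.univ \ surv).val.map fun x => (s.lab x, r)⟩, V, U, surv, h1, h2, h3, rfl, rfl,
    rfl⟩

theorem chainAlgorithmWorks (hab : a ≤ b) (B : ChainRep o a b) : ChainAlgorithmWorks B := by
  refine ⟨fun r s hs _ => (hs.inv hab).exists_step, ?_⟩
  have : ∀ n, a + n ≤ b → ∃ s, ChainReach B (a + n) s := by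
    intro n
    induction n with
    | zero => exact fun _ => ⟨_, ChainReach.start⟩
    | succ n ih =>
      intro hn
      obtain ⟨s, hs⟩ := ih (by omega)
      obtain ⟨s', hs'⟩ := (hs.inv hab).exists_step
      exact ⟨s', ChainReach.next _ s s' hs (by omega) hs'⟩
  obtain ⟨s, hs⟩ := (Nat.add_sub_of_le hab) ▸ this (b - a) (by omega)
  exact ⟨_, s, hs, rfl⟩

end ChainWorks

end QuiverCycle

namespace QuiverCycle

/-! ### Regularity of the remaining representation -/

section Regular

/-- The matrix of the edge, considered as a matrix with the rows `Y` and the columns `X`, has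
linearly independent rows. -/
def Edge.LeftKernelTrivial {b : Bool} {X Y : Type} [Fintype Y] (M : Edge b X Y) : Prop :=
  ∀ d : Y → ℂ, (∀ x, ∑ y, d y * M.entry x y = 0) → d = 0

theorem Edge.LeftKernelTrivial.card_le {b : Bool} {X Y : Type} [Fintype X] [Fintype Y]
    {M : Edge b X Y} (h : M.LeftKernelTrivial) : Fintype.card Y ≤ Fintype.card X := by
  have : LinearIndependent ℂ (fun y x => M.entry x y) :=
    (linearIndependent_rows_iff_vecMul (M := Matrix.of fun y x => M.entry x y)).2
      fun c hc => h c fun x => congrFun hc x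
  simpa using this.fintype_card_le_finrank

theorem nonsingular_of_vecMul {m n : Type} [Fintype m] [Fintype n] [DecidableEq m]
    [DecidableEq n] {M : Matrix m n ℂ} (hc : Fintype.card n = Fintype.card m)
    (h : ∀ c : m → ℂ, Matrix.vecMul c M = 0 → c = 0) : Nonsingular M := by
  obtain ⟨N, hN⟩ := Matrix.mulVec_surjective_iff_exists_right_inverse.1
    (mulVec_surjective_of_vecMul h)
  exact ⟨N, hN, (Matrix.mul_eq_one_comm_of_equiv (Fintype.equivOfCardEq hc.symm)).1 hN⟩

theorem Edge.LeftKernelTrivial.isNonsingular {X Y : Type} [Fintype X] [Fintype Y] [DecidableEq X]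
    [DecidableEq Y] (hc : Fintype.card X = Fintype.card Y) : ∀ {b : Bool} {M : Edge b X Y},
    M.LeftKernelTrivial → M.IsNonsingular
  | true, M, h => nonsingular_of_vecMul (M := M.fwd) hc fun c hc => h c fun x => congrFun hc x
  | false, M, h => (nonsingular_of_vecMul (M := M.bwd.transpose) hc
      fun c hc => h c fun x => congrFun hc x).transpose

variable {t : ℕ} {o : ZMod t → Bool}

/-- A function that weakly decreases along a closed walk through all the vertices is constant. -/
theorem apply_eq_of_apply_add_one_le [NeZero t] {f : ZMod t → ℕ} (h : ∀ i, f (i + 1) ≤ f i)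
    (v w : ZMod t) : f v = f w := by
  have key : ∀ (v : ZMod t) (n : ℕ), f (v + n) ≤ f v := by
    intro v n
    induction n with
    | zero => simp
    | succ n ih =>
      refine le_trans ?_ ih
      rw [Nat.cast_succ, ← add_assoc]
      exact h _
  have key' : ∀ v w : ZMod t, f w ≤ f v := by
    intro v w
    have := key v (w - v).val
    rwa [ZMod.natCast_zmod_val, add_sub_cancel] at this
  exact le_antisymm (key' _ _) (key' _ _)

theorem Edge.LeftKernelTrivial.of_intertwines {X Y X' Y' : Type} [Fintype X] [Fintype Y]
    [Fintype X'] [Fintype Y'] [DecidableEq X] [DecidableEq Y] [DecidableEq X'] [DecidableEq Y']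
    {S : Matrix X' X ℂ} {T : Matrix Y' Y ℂ} (hS : Nonsingular S) (hT : Nonsingular T)
    {M : Edge false X Y} {M' : Edge false X' Y'} (h : Edge.Intertwines S T M M')
    (hM : M.LeftKernelTrivial) : M'.LeftKernelTrivial := by
  obtain ⟨T', h1, -⟩ := hT
  change M'.bwd * T = S * M.bwd at h
  intro d hd
  have hd' : Matrix.mulVec M'.bwd d = 0 :=
    funext fun x => Eq.trans (Finset.sum_congr rfl fun y _ => mul_comm _ _) (hd x)
  have e : Matrix.mulVec T (Matrix.mulVec T' d) = d := by
    rw [Matrix.mulVec_mulVec, h1, Matrix.one_mulVec]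
  have h0 : Matrix.mulVec M.bwd (Matrix.mulVec T' d) = 0 := by
    refine hS.mulVec_eq_zero ?_
    rw [Matrix.mulVec_mulVec, ← h, ← Matrix.mulVec_mulVec, e, hd']
  have h2 : Matrix.mulVec T' d = 0 := hM _ fun x =>
    Eq.trans (Finset.sum_congr rfl fun y _ => mul_comm _ _) (congrFun h0 x)
  rw [← e, h2, Matrix.mulVec_zero]

theorem Edge.LeftKernelTrivial.sum_right {b : Bool} {X Y X' Y' : Type} [Fintype Y] [Fintype Y']
    {M : Edge b X Y} {M' : Edge b X' Y'} (h : (M.sum M').LeftKernelTrivial) :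
    M'.LeftKernelTrivial := by
  intro d hd
  have h0 := h (Sum.elim 0 d) (by
    rintro (x | x)
    · simp
    · simpa using hd x)
  exact funext fun y => congrFun h0 (Sum.inr y)

/-- A direct summand inherits injectivity of the counterclockwise arrows. -/
theorem CycleRep.Iso.leftKernelTrivial_right {A C D : CycleRep o} (h : A.Iso (C.sum D)) {i : ZMod t}
    (hi : o i = false) (hA : (A.mat i).LeftKernelTrivial) : (D.mat i).LeftKernelTrivial := by
  obtain ⟨S, hS, hcomm⟩ := h
  have key : ∀ {b : Bool} {M : Edge b (A.idx i) (A.idx (i + 1))}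
      {M' : Edge b ((C.sum D).idx i) ((C.sum D).idx (i + 1))}, b = false →
      Edge.Intertwines (S i) (S (i + 1)) M M' → M.LeftKernelTrivial → M'.LeftKernelTrivial := by
    rintro b M M' rfl h hM
    exact hM.of_intertwines (hS i) (hS (i + 1)) h
  exact Edge.LeftKernelTrivial.sum_right (M := C.mat i) (key hi (hcomm i) hA)

theorem CycleAlgorithm.regular (ht : 2 ≤ t) {A : CycleRep o} {X : CycleOutput o}
    (hX : CycleAlgorithm A X) {Y : CycleOutput fun i => !(o i)}
    (hY : CycleAlgorithm X.rest.transpose Y) : Y.rest.transposeBack.Regular := by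
  have : NeZero t := ⟨by omega⟩
  -- `LeftKernelTrivial` reads the entries as an array from `i` to `i + 1` and so ignores
  -- transposition. Arrows clockwise in `o` have it from the first run and pass it to the summand;
  -- the others become clockwise in the transpose and get it from the second run.
  have hker : ∀ i, (Y.rest.mat i).LeftKernelTrivial := by
    intro i
    rcases Bool.eq_false_or_eq_true (o i) with hi | hi
    · refine (hY.iso ht).leftKernelTrivial_right (by simp [hi]) fun d hd => ?_
      refine (rowCond_iff _).1 (hX.rowCond_rest ht i) hi d fun x => ?_
      refine Eq.trans (Finset.sum_congr rfl fun y _ => ?_) (hd x)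
      exact congrArg (d y * ·) (Edge.entry_tr (X.rest.mat i) x y).symm
    · exact (rowCond_iff _).1 (hY.rowCond_rest ht i) (by simp [hi])
  have hdim : ∀ v w, Y.rest.transposeBack.dim v = Y.rest.transposeBack.dim w :=
    apply_eq_of_apply_add_one_le fun i => (hker i).card_le
  refine ⟨hdim, fun i => Edge.LeftKernelTrivial.isNonsingular (hdim _ _) fun d hd => ?_⟩
  refine hker i d fun x => ?_
  refine Eq.trans (Finset.sum_congr rfl fun y _ => ?_) (hd x)
  exact congrArg (d y * ·) (Edge.entry_trBack (Y.rest.mat i) x y).symm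

/-- The push-down of a direct sum of representations `𝕃_{ij}`. -/
theorem ChainRep.Iso.pushDown_listSum {a b : ℕ} {B : ChainRep (fun k => o (vtx t k)) a b}
    {P : List (ℕ × ℕ)} (hP : ∀ p ∈ P, a ≤ p.1 ∧ p.1 ≤ p.2 ∧ p.2 ≤ b)
    (h : B.Iso (ChainRep.listSum (P.map fun p => ChainRep.L _ _ _ p.1 p.2))) :
    B.pushDown.Iso (CycleRep.listSum (P.map fun p => G o p.1 p.2)) := by
  refine h.pushDown.trans ((ChainRep.pushDown_listSum_iso _).trans ?_)
  rw [List.map_map]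
  exact CycleRep.listSum_map_iso P _ _ fun p hp =>
    ChainRep.pushDown_L_iso (hP p hp).1 (hP p hp).2.2

end Regular

end QuiverCycle

/-! ### Assembling the regularizing decomposition -/

theorem theorem5p1 (t : ℕ) (ht : 2 ≤ t) (o : ZMod t → Bool) (A : CycleRep o) :
    CycleAlgorithmWorks A ∧
    ∀ X : CycleOutput o, CycleAlgorithm A X →
      A.Iso (X.chain.pushDown.sum X.rest) ∧
      CycleAlgorithmWorks X.rest.transpose ∧
      ∀ Y : CycleOutput (fun i => !(o i)), CycleAlgorithm X.rest.transpose Y →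
        X.rest.transpose.Iso (Y.chain.pushDown.sum Y.rest) ∧
        ChainAlgorithmWorks X.chain ∧
        ChainAlgorithmWorks
          (ChainRep.transposeBack (o := fun k => o (vtx t k)) Y.chain) ∧
        ∀ P Q : List (ℕ × ℕ),
          ChainAlgorithm X.chain (P : Multiset (ℕ × ℕ)) →
          ChainAlgorithm (ChainRep.transposeBack (o := fun k => o (vtx t k)) Y.chain)
            (Q : Multiset (ℕ × ℕ)) →
          (∀ p ∈ P, X.a ≤ p.1 ∧ p.1 ≤ p.2 ∧ p.2 ≤ X.b) ∧
          (∀ p ∈ Q, Y.a ≤ p.1 ∧ p.1 ≤ p.2 ∧ p.2 ≤ Y.b) ∧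
          X.chain.Iso (ChainRep.listSum (P.map fun p => ChainRep.L _ _ _ p.1 p.2)) ∧
          (ChainRep.transposeBack (o := fun k => o (vtx t k)) Y.chain).Iso
            (ChainRep.listSum (Q.map fun p => ChainRep.L _ _ _ p.1 p.2)) ∧
          A.Iso ((CycleRep.listSum ((P ++ Q).map fun p => G o p.1 p.2)).sum
            Y.rest.transposeBack) ∧
          Y.rest.transposeBack.Regular := by
  refine ⟨cycleAlgorithmWorks ht A, fun X hX => ⟨hX.iso ht, cycleAlgorithmWorks ht _, fun Y hY =>
    ⟨hY.iso ht, chainAlgorithmWorks hX.le _, chainAlgorithmWorks hY.le _, fun P Q hP hQ => ?_⟩⟩⟩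
  obtain ⟨hPb, hPi⟩ := hP.iso hX.le
  obtain ⟨hQb, hQi⟩ := hQ.iso hY.le
  refine ⟨hPb, hQb, hPi, hQi, ?_, hX.regular ht hY⟩
  -- Transposing the second splitting back decomposes the remainder of the first, since
  -- transposition commutes with direct sums and with the push-down.
  have hrest : X.rest.Iso
      ((CycleRep.listSum (Q.map fun p => G o p.1 p.2)).sum Y.rest.transposeBack) :=
    (CycleRep.iso_transposeBack_transpose X.rest).trans
      ((CycleRep.Iso.transposeBack (hY.iso ht)).trans
        ((CycleRep.transposeBack_sum_iso _ _).trans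
          (((ChainRep.pushDown_transposeBack_iso Y.chain).trans
            (ChainRep.Iso.pushDown_listSum hQb hQi)).sum (CycleRep.Iso.refl _))))
  rw [List.map_append]
  exact (hX.iso ht).trans (((ChainRep.Iso.pushDown_listSum hPb hPi).sum hrest).trans
    ((CycleRep.sum_assoc_iso _ _ _).symm.trans
      ((CycleRep.listSum_append_iso _ _).symm.sum (CycleRep.Iso.refl _))))
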